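/- Let $(X,\mu)$ be a standard probability space and let $\mathcal R\subset X\times X$ be an equivalence relation that is measurable as a subset of $X\times X$, has countable classes, and is nonsingular (the $\mathcal R$-saturation of every $\mu$-null set is $\mu$-null). The full group $[\mathcal R]$ consists of the nonsingular automorphisms $\theta$ of $(X,\mu)$ with $(x,\theta(x))\in\mathcal R$ for a.e. $x$; for a function $f$ on $X$ put $\theta(f)=f\circ\theta^{-1}$; and $\theta$ is called $\mu$-bounded if $\log\frac{\mathrm d(\mu\circ\theta)}{\mathrm d\mu}$ is essentially bounded. A $\sigma$-finite measure $\nu$ equivalent to $\mu$ is $\mathcal R$-invariant ($\mathcal R$ preserves $\nu$) if $\int_X \#\{y : (x,y)\in W\}\,\mathrm d\nu(x)=\int_X \#\{x : (x,y)\in W\}\,\mathrm d\nu(y)$ for all measurable $W\subset\mathcal R$. Call $\mathcal R$ ergodic if every $f\in L^\infty(X,\mu)$ with $f(x)=f(y)$ for a.e. $(x,y)\in\mathcal R$ (i.e. for a.e. $x$ and all $y$ with $(x,y)\in\mathcal R$) is a.e. constant. An ergodic $\mathcal R$ is of type $\mathrm{III}$ if no single class of $\mathcal R$ has full measure and there is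 no $\mathcal R$-invariant $\sigma$-finite measure, of total mass $1$ or $\infty$, equivalent to $\mu$. Finally, $\mathcal R$ is strongly ergodic if, for every sequence of measurable sets $A_n\subset X$ with $\lim_n\mu(A_n\triangle g(A_n))=0$ for all $g\in[\mathcal R]$, one has $\lim_n\mu(A_n)(1-\mu(A_n))=0$. Theorem. Let $\mathcal R$ be such an equivalence relation on $(X,\mu)$. Assume that $\mathcal R$ is ergodic and that it either preserves $\mu$ or is of type $\mathrm{III}$. Then the following are equivalent: (i) $\mathcal R$ is strongly ergodic. (ii) There exist a constant $\kappa>0$ and a finite family $\theta_1,\dots,\theta_n$ of $\mu$-bounded elements of $[\mathcal R]$ such that, for all $f\in L^2(X,\mu)$ (complex-valued), with $\mu(f)=\int_X f\,\mathrm d\mu$, $$\|f-\mu(f)\|_2^2\le\kappa\sum_{k=1}^n\|\theta_k(f)-f\|_2^2 .$$ -/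

import Mathlib

open MeasureTheory Filter Topology
open scoped NNReal ENNReal symmDiff

namespace EqRel

section

variable {X : Type*} [MeasurableSpace X]

/-- Standing assumptions on an equivalence relation on a measure space: measurable as a subset of
`X × X`, with countable classes, and such that the saturation of a null set is a null set. -/
structure IsCountableNonsingular (R : Setoid X) (μ : Measure X) : Prop where
  measurableSet : MeasurableSet {p : X × X | R p.1 p.2}
  countable_class : ∀ x, {y | R x y}.Countable
  nonsingular : ∀ N : Set X, μ N = 0 → μ {y | ∃ x ∈ N, R x y} = 0

/-- A nonsingular automorphism: both `θ` and `θ⁻¹` send null sets to null sets. -/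
def IsNonsingularAut (μ : Measure X) (θ : X ≃ᵐ X) : Prop :=
  Measure.QuasiMeasurePreserving θ μ μ ∧ Measure.QuasiMeasurePreserving θ.symm μ μ

/-- The full group `[R]`: the nonsingular automorphisms `θ` with `(x, θ x) ∈ R` for a.e. `x`.
(Elements are represented by everywhere defined automorphisms, not identified when they agree
almost everywhere.) -/
def fullGroup (R : Setoid X) (μ : Measure X) : Set (X ≃ᵐ X) :=
  {θ | IsNonsingularAut μ θ ∧ ∀ᵐ x ∂μ, R x (θ x)}

/-- `θ` is `μ`-bounded: `log (d(μ ∘ θ)/dμ)` is (essentially) bounded. Here `μ ∘ θ` is the measure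
`A ↦ μ (θ(A))`, that is `μ.comap θ`. -/
def IsBoundedAut (μ : Measure X) (θ : X ≃ᵐ X) : Prop :=
  IsNonsingularAut μ θ ∧
    ∃ C : ℝ, ∀ᵐ x ∂μ, |Real.log ((μ.comap θ).rnDeriv μ x).toReal| ≤ C

/-- `R` is ergodic: every invariant function in `L^∞(X, μ)` is a.e. constant. A subset of `R` is
null when its projection to `X` is null, so that `f x = f y` for a.e. `(x, y) ∈ R` means that for
a.e. `x` it holds for all `y` in the class of `x`. -/
def IsErgodic (R : Setoid X) (μ : Measure X) : Prop :=
  ∀ f : X → ℂ, MemLp f ∞ μ → (∀ᵐ x ∂μ, ∀ y, R x y → f x = f y) → ∃ c : ℂ, f =ᵐ[μ] fun _ => c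

/-- `R` is strongly ergodic: every almost invariant sequence of measurable sets is trivial. -/
def IsStronglyErgodic (R : Setoid X) (μ : Measure X) : Prop :=
  ∀ A : ℕ → Set X, (∀ n, MeasurableSet (A n)) →
    (∀ g ∈ fullGroup R μ, Tendsto (fun n => μ (A n ∆ (g '' A n))) atTop (𝓝 0)) →
    Tendsto (fun n => μ (A n) * (1 - μ (A n))) atTop (𝓝 0)

/-- The left counting measure `ν_ℓ(W) = ∫ #{y | (x, y) ∈ W} dν(x)`, for `W ⊆ R`. -/
noncomputable def leftCount (ν : Measure X) (W : Set (X × X)) : ℝ≥0∞ :=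
  ∫⁻ x, (({y | (x, y) ∈ W}.encard : ℕ∞) : ℝ≥0∞) ∂ν

/-- The right counting measure `ν_r(W) = ∫ #{x | (x, y) ∈ W} dν(y)`, for `W ⊆ R`. -/
noncomputable def rightCount (ν : Measure X) (W : Set (X × X)) : ℝ≥0∞ :=
  ∫⁻ y, (({x | (x, y) ∈ W}.encard : ℕ∞) : ℝ≥0∞) ∂ν

/-- `ν` is `R`-invariant (equivalently, `R` preserves `ν`): the left and right counting measures
on `R` coincide. -/
def IsInvariant (R : Setoid X) (ν : Measure X) : Prop :=
  ∀ W : Set (X × X), MeasurableSet W → (∀ p ∈ W, R p.1 p.2) → leftCount ν W = rightCount ν W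

/-- `𝓜(X)`: the `σ`-finite measures in the measure class of `μ`. -/
def measureClass (μ : Measure X) : Set (Measure X) :=
  {ν | SigmaFinite ν ∧ ν ≪ μ ∧ μ ≪ ν}

/-- Type I: only one equivalence class up to measure zero. -/
def IsTypeI (R : Setoid X) (μ : Measure X) : Prop :=
  IsErgodic R μ ∧ ∃ x, ∀ᵐ y ∂μ, R x y

/-- Type II₁: not of type I, with an invariant probability measure in the measure class. -/
def IsTypeIIOne (R : Setoid X) (μ : Measure X) : Prop :=
  IsErgodic R μ ∧ ¬ IsTypeI R μ ∧
    ∃ ν ∈ measureClass μ, IsProbabilityMeasure ν ∧ IsInvariant R ν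

/-- Type II_∞: not of type I, with an infinite invariant measure in the measure class. -/
def IsTypeIIInfty (R : Setoid X) (μ : Measure X) : Prop :=
  IsErgodic R μ ∧ ¬ IsTypeI R μ ∧
    ∃ ν ∈ measureClass μ, ν Set.univ = ∞ ∧ IsInvariant R ν

/-- Type III: ergodic and of none of the types I, II₁, II_∞. -/
def IsTypeIII (R : Setoid X) (μ : Measure X) : Prop :=
  IsErgodic R μ ∧ ¬ IsTypeI R μ ∧ ¬ IsTypeIIOne R μ ∧ ¬ IsTypeIIInfty R μ

end

end EqRel

/-!
A countable group `G` of automorphisms with bounded distortion generates `R` up to a null set, so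
the relation is described by the action of `G` together with its Radon–Nikodym cocycle.

Suppose that `R` is strongly ergodic. If `R` preserves `μ` or is of type III, then one bound `K`
serves all sets `Y` of nearly full measure: almost every point can be moved into `Y` by an element
of `G` whose cocycle is at most `K` there. Hence a set of small measure has many disjoint copies of
comparable size, and a finitely additive mean that scales under bounded automorphisms as `μ` does
must be small on sets of small measure. It is then a measure, and by ergodicity it is `μ`. Applied
to limits of the conditional measures of `μ` on sets `B n`, this says that sets which are almost
invariant relative to their own measure become independent of every fixed set. The union of such a
set with a maximal almost invariant set of measure at most `1 / 8` is again almost invariant, so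
finitely many bounded automorphisms expand all sets of measure at most `1 / 2`. Cheeger's argument
turns this isoperimetric inequality into the spectral gap.

Conversely, the spectral gap inequality for indicator functions is a bound of `μ A * (1 - μ A)` by
displacements of `A`.
-/

namespace EqRel

section Exhaustion

variable {X : Type*} [MeasurableSpace X]

theorem exists_superset_forall_measure_le_add (μ : Measure X) [IsFiniteMeasure μ]
    {P : Set X → Prop} {A : Set X} (hA : P A) {ε : ℝ≥0∞} (hε : ε ≠ 0) :
    ∃ B, P B ∧ A ⊆ B ∧ ∀ C, P C → A ⊆ C → μ C ≤ μ B + ε := by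
  by_contra! hcon
  let s := ⨆ B : {B : Set X // P B ∧ A ⊆ B}, μ B
  have hs : s ≠ ∞ :=
    ne_top_of_le_ne_top (measure_ne_top μ Set.univ) (iSup_le fun B => measure_mono B.1.subset_univ)
  have : Nonempty {B : Set X // P B ∧ A ⊆ B} := ⟨⟨A, hA, subset_rfl⟩⟩
  have hle : s + ε ≤ s := by
    refine (ENNReal.iSup_add fun B : {B : Set X // P B ∧ A ⊆ B} => μ B).trans_le (iSup_le ?_)
    intro ⟨B, hB, hAB⟩
    obtain ⟨C, hC, hAC, hlt⟩ := hcon B hB hAB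
    exact hlt.le.trans (le_iSup (fun B : {B : Set X // P B ∧ A ⊆ B} => μ B) ⟨C, hC, hAC⟩)
  exact hle.not_gt (ENNReal.lt_add_right hs hε)

theorem exists_ae_maximal (μ : Measure X) [IsFiniteMeasure μ] (P : Set X → Prop) {A₀ : Set X}
    (h₀ : P A₀) (hU : ∀ A : ℕ → Set X, Monotone A → (∀ n, P (A n)) → P (⋃ n, A n)) :
    ∃ A, P A ∧ ∀ B, P B → A ⊆ B → μ B ≤ μ A := by
  have hstep (n : ℕ) (A : {A // P A}) : ∃ B : {B // P B}, A.1 ⊆ B.1 ∧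
      ∀ C, P C → A.1 ⊆ C → μ C ≤ μ B.1 + ((n : ℝ≥0∞) + 1)⁻¹ := by
    obtain ⟨B, hB, hAB, hmax⟩ := exists_superset_forall_measure_le_add μ A.2
      (ε := ((n : ℝ≥0∞) + 1)⁻¹) (by simp)
    exact ⟨⟨B, hB⟩, hAB, hmax⟩
  choose next hsub hnext using hstep
  let A : ℕ → {A // P A} := fun n => Nat.rec ⟨A₀, h₀⟩ next n
  have hmono : Monotone fun n => (A n).1 := monotone_nat_of_le_succ fun n => hsub n (A n)
  refine ⟨⋃ n, (A n).1, hU _ hmono fun n => (A n).2, fun B hB hAB => ?_⟩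
  have hle (n : ℕ) : μ B ≤ μ (⋃ n, (A n).1) + ((n : ℝ≥0∞) + 1)⁻¹ :=
    calc μ B ≤ μ (A (n + 1)).1 + ((n : ℝ≥0∞) + 1)⁻¹ :=
          hnext n (A n) B hB ((Set.subset_iUnion (fun n => (A n).1) n).trans hAB)
      _ ≤ _ := by gcongr; exact Set.subset_iUnion (fun n => (A n).1) (n + 1)
  have hlim : Tendsto (fun n : ℕ => μ (⋃ n, (A n).1) + ((n : ℝ≥0∞) + 1)⁻¹) atTop
      (𝓝 (μ (⋃ n, (A n).1) + 0)) :=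
    tendsto_const_nhds.add (by
      simpa using (tendsto_add_atTop_iff_nat 1).2 ENNReal.tendsto_inv_nat_nhds_zero)
  simpa using ge_of_tendsto' hlim hle

end Exhaustion

section LimitPoints

variable {Z : Type*} {B S : Set (Set Z)}

/-- The points all of whose neighbourhoods in the basis `B` belong to the family `S`. -/
def limitPoints (B S : Set (Set Z)) : Set Z := {z | ∀ U ∈ B, z ∈ U → U ∈ S}

theorem isClosed_limitPoints [TopologicalSpace Z] (hB : ∀ U ∈ B, IsOpen U) :
    IsClosed (limitPoints B S) := by
  rw [← isOpen_compl_iff, isOpen_iff_mem_nhds]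
  intro z hz
  obtain ⟨U, hU, hzU, hUS⟩ : ∃ U ∈ B, z ∈ U ∧ U ∉ S := by
    by_contra! h
    exact hz h
  filter_upwards [(hB U hU).mem_nhds hzU] with y hy hyL using hUS (hyL U hU hy)

theorem exists_disjoint_of_mem_limitPoints [TopologicalSpace Z] [T2Space Z]
    (hB : TopologicalSpace.IsTopologicalBasis B) {V : Set Z} (hV : IsOpen V) {z z' : Z}
    (hz : z ∈ V) (hz' : z' ∈ V) (hzS : z ∈ limitPoints B S) (hzS' : z' ∈ limitPoints B S)
    (hne : z ≠ z') :
    ∃ U ∈ B, ∃ U' ∈ B, U ⊆ V ∧ U' ⊆ V ∧ Disjoint U U' ∧ U ∈ S ∧ U' ∈ S := by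
  obtain ⟨O, O', hO, hO', hzO, hzO', hd⟩ := t2_separation hne
  obtain ⟨U, hU, hzU, hUs⟩ := hB.mem_nhds_iff.1 (inter_mem (hV.mem_nhds hz) (hO.mem_nhds hzO))
  obtain ⟨U', hU', hzU', hUs'⟩ := hB.mem_nhds_iff.1
    (inter_mem (hV.mem_nhds hz') (hO'.mem_nhds hzO'))
  exact ⟨U, hU, U', hU', fun a ha => (hUs ha).1, fun a ha => (hUs' ha).1,
    hd.mono (fun a ha => (hUs ha).2) fun a ha => (hUs' ha).2, hzS U hU hzU, hzS' U' hU' hzU'⟩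

theorem limitPoints_subset_preimage [TopologicalSpace Z] {X : Type*} [TopologicalSpace X]
    [T3Space X] (hB : TopologicalSpace.IsTopologicalBasis B) {p : Z → X} (hp : Continuous p)
    {x : X} (hx : ∀ U ∈ S, x ∈ closure (p '' U)) : limitPoints B S ⊆ p ⁻¹' {x} := by
  intro z hz
  by_contra hne
  obtain ⟨N, ⟨hN, hNcl⟩, hNs⟩ := (closed_nhds_basis (p z)).mem_iff.1
    (isOpen_compl_singleton.mem_nhds hne : ({x}ᶜ : Set X) ∈ 𝓝 (p z))
  obtain ⟨U, hU, hzU, hUs⟩ := hB.mem_nhds_iff.1 (hp.continuousAt.preimage_mem_nhds hN)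
  exact hNs (closure_minimal (Set.image_subset_iff.2 hUs) hNcl (hx U (hz U hU hzU))) rfl

variable [MetricSpace Z] [CompleteSpace Z]

theorem exists_forall_mem_of_closure_subset {W : ℕ → Set Z} (hne : ∀ n, (W n).Nonempty)
    (hcl : ∀ n, closure (W (n + 1)) ⊆ W n) {c : ℕ → Z}
    (hc : ∀ n, W n ⊆ Metric.ball (c n) (1 / ((n : ℝ) + 1))) : ∃ a, ∀ n, a ∈ W n := by
  have hanti : Antitone W := antitone_nat_of_succ_le fun n => subset_closure.trans (hcl n)
  have hball (n : ℕ) : closure (W n) ⊆ Metric.closedBall (c n) (1 / ((n : ℝ) + 1)) :=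
    closure_minimal ((hc n).trans Metric.ball_subset_closedBall) Metric.isClosed_closedBall
  have hdiam : Tendsto (fun n => Metric.diam (closure (W n))) atTop (𝓝 0) := by
    refine squeeze_zero (fun n => Metric.diam_nonneg) (fun n => ?_) (mul_zero (2 : ℝ) ▸
      (tendsto_one_div_add_atTop_nhds_zero_nat (𝕜 := ℝ)).const_mul 2)
    exact (Metric.diam_mono (hball n) Metric.isBounded_closedBall).trans
      (Metric.diam_closedBall Nat.one_div_pos_of_nat.le)
  obtain ⟨a, ha⟩ := Metric.nonempty_iInter_of_nonempty_biInter
    (fun n => isClosed_closure) (fun n => Metric.isBounded_closedBall.subset (hball n))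
    (fun N => (hne N).mono (Set.subset_iInter₂ fun n hn => (hanti hn).trans subset_closure)) hdiam
  exact ⟨a, fun n => hcl n (Set.mem_iInter.1 ha (n + 1))⟩

theorem limitPoints_inter_nonempty (hB : TopologicalSpace.IsTopologicalBasis B)
    (hne : ∀ U ∈ S, U.Nonempty) (hup : ∀ V ∈ S, ∀ U ∈ B, V ⊆ U → U ∈ S)
    (hrefine : ∀ V ∈ S, ∀ ε > 0, ∃ U ∈ S, closure U ⊆ V ∧ ∃ z, U ⊆ Metric.ball z ε)
    {V : Set Z} (hV : V ∈ S) : (limitPoints B S ∩ V).Nonempty := by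
  have hstep (n : ℕ) (V : S) : ∃ U : S, closure U.1 ⊆ V ∧
      ∃ z, U.1 ⊆ Metric.ball z (1 / ((n : ℝ) + 1)) := by
    obtain ⟨U, hU, hUV, hUz⟩ := hrefine V V.2 (1 / ((n : ℝ) + 1)) (by positivity)
    exact ⟨⟨U, hU⟩, hUV, hUz⟩
  choose next hcl z hz using hstep
  let W : ℕ → S := fun n => Nat.rec (next 0 ⟨V, hV⟩) (fun n U => next (n + 1) U) n
  have hWball (n : ℕ) : ∃ c, (W n).1 ⊆ Metric.ball c (1 / ((n : ℝ) + 1)) := by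
    cases n with
    | zero => exact ⟨_, hz 0 _⟩
    | succ n => exact ⟨_, hz (n + 1) (W n)⟩
  choose c hc using hWball
  obtain ⟨a, ha⟩ := exists_forall_mem_of_closure_subset (fun n => hne _ (W n).2)
    (fun n => hcl (n + 1) (W n)) hc
  refine ⟨a, fun U hU haU => ?_, hcl 0 ⟨V, hV⟩ (subset_closure (ha 0))⟩
  obtain ⟨ε, hε, hεU⟩ := Metric.isOpen_iff.1 (hB.isOpen hU) a haU
  obtain ⟨n, hn⟩ := exists_nat_one_div_lt (half_pos hε)
  refine hup (W n).1 (W n).2 U hU fun b hb => hεU (Metric.mem_ball.2 ?_)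
  have hca := Metric.mem_ball.1 (hc n (ha n))
  have hcb := Metric.mem_ball.1 (hc n hb)
  exact (dist_triangle_right b a (c n)).trans_lt (by linarith)

theorem not_countable_limitPoints (hB : TopologicalSpace.IsTopologicalBasis B)
    (hS : S.Nonempty) (hne : ∀ U ∈ S, U.Nonempty) (hup : ∀ V ∈ S, ∀ U ∈ B, V ⊆ U → U ∈ S)
    (hrefine : ∀ V ∈ S, ∀ ε > 0, ∃ U ∈ S, closure U ⊆ V ∧ ∃ z, U ⊆ Metric.ball z ε)
    (hsplit : ∀ V ∈ S, ∃ U ∈ S, ∃ U' ∈ S, U ⊆ V ∧ U' ⊆ V ∧ Disjoint U U') :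
    ¬ (limitPoints B S).Countable := by
  have hmeet {V : Set Z} (hV : V ∈ S) := limitPoints_inter_nonempty hB hne hup hrefine hV
  have hperf : Perfect (limitPoints B S) := by
    refine ⟨isClosed_limitPoints fun _ => hB.isOpen, fun z hz => accPt_iff_nhds.2 fun N hN => ?_⟩
    obtain ⟨V, hV, hzV, hVN⟩ := hB.mem_nhds_iff.1 hN
    obtain ⟨U, hU, U', hU', hUV, hUV', hd⟩ := hsplit V (hz V hV hzV)
    obtain ⟨a, haL, ha⟩ := hmeet hU
    obtain ⟨b, hbL, hb⟩ := hmeet hU'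
    by_cases haz : a = z
    · exact ⟨b, ⟨hVN (hUV' hb), hbL⟩, fun hbz => Set.disjoint_left.1 hd ha (haz ▸ hbz ▸ hb)⟩
    · exact ⟨a, ⟨hVN (hUV ha), haL⟩, haz⟩
  obtain ⟨V, hV⟩ := hS
  obtain ⟨f, hfL, -, hf⟩ := hperf.exists_nat_bool_injection
    ((hmeet hV).mono Set.inter_subset_left)
  have huncount : Uncountable (ℕ → Bool) := 
    Cardinal.aleph0_lt_mk_iff.1 (by simp [Cardinal.aleph0_lt_continuum])
  intro hcount
  have : Countable (Set.range f) := (hcount.mono hfL).to_subtype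
  exact not_countable (Set.rangeFactorization_injective.2 hf).countable

end LimitPoints

section Uniformization

variable {X Z : Type*} [MeasurableSpace X] [MeasurableSpace Z] {μ : Measure X}

/-- `W` is covered, over almost every point, by countably many graphs of measurable functions. -/
def AECovered (μ : Measure X) (W : Set (X × Z)) : Prop :=
  ∃ F : Set (X → Z), F.Countable ∧ (∀ f ∈ F, Measurable f) ∧
    ∀ᵐ x ∂μ, ∀ z, (x, z) ∈ W → ∃ f ∈ F, f x = z

theorem AECovered.mono {W W' : Set (X × Z)} (h : AECovered μ W') (hs : W ⊆ W') :
    AECovered μ W := by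
  obtain ⟨F, hF, hm, hc⟩ := h
  exact ⟨F, hF, hm, hc.mono fun x hx z hz => hx z (hs hz)⟩

theorem AECovered.iUnion {ι : Type*} [Countable ι] {W : ι → Set (X × Z)}
    (h : ∀ i, AECovered μ (W i)) : AECovered μ (⋃ i, W i) := by
  choose F hF hm hc using h
  refine ⟨⋃ i, F i, Set.countable_iUnion hF, fun f hf => ?_, ?_⟩
  · obtain ⟨i, hi⟩ := Set.mem_iUnion.1 hf
    exact hm i f hi
  · filter_upwards [ae_all_iff.2 hc] with x hx z hz
    obtain ⟨i, hi⟩ := Set.mem_iUnion.1 hz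
    obtain ⟨f, hf, hfx⟩ := hx i z hi
    exact ⟨f, Set.mem_iUnion.2 ⟨i, hf⟩, hfx⟩

theorem AECovered.union {W W' : Set (X × Z)} (h : AECovered μ W) (h' : AECovered μ W') :
    AECovered μ (W ∪ W') := by
  rw [Set.union_eq_iUnion]
  exact AECovered.iUnion fun b => by cases b <;> assumption

theorem aecovered_of_ae_notMem {W : Set (X × Z)} (h : ∀ᵐ x ∂μ, ∀ z, (x, z) ∉ W) :
    AECovered μ W :=
  ⟨∅, Set.countable_empty, by simp, h.mono fun x hx z hz => absurd hz (hx z)⟩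

theorem aecovered_of_injOn_fst [StandardBorelSpace X] [StandardBorelSpace Z]
    {W : Set (X × Z)} (hW : MeasurableSet W) (hinj : Set.InjOn Prod.fst W) : AECovered μ W := by
  rcases W.eq_empty_or_nonempty with rfl | ⟨w₀, -⟩
  · exact aecovered_of_ae_notMem (by simp)
  have : StandardBorelSpace W := hW.standardBorel
  obtain ⟨f, hf, hfW⟩ := ((measurable_fst.comp measurable_subtype_coe).measurableEmbedding
    (Set.injOn_iff_injective.1 hinj)).exists_measurable_extend
      (measurable_snd.comp measurable_subtype_coe) fun _ => ⟨w₀.2⟩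
  exact ⟨{f}, Set.countable_singleton f, by simpa using hf,
    ae_of_all _ fun x z hz => ⟨f, rfl, congrFun hfW ⟨(x, z), hz⟩⟩⟩

/-- The part over `E` of the graph of `p : Z → X`, restricted to `V` and transposed. -/
def graphPart (p : Z → X) (V : Set Z) (E : Set X) : Set (X × Z) :=
  {w | w.1 ∈ E ∧ w.2 ∈ V ∧ p w.2 = w.1}

/-- `S` is the part of `X` over which the graph of `p` on `V` is hereditarily uncovered: it is
covered over `Sᶜ`, and over no non-null subset of `S`. -/
structure IsUncoveredPart (μ : Measure X) (p : Z → X) (V : Set Z) (S : Set X) : Prop where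
  measurableSet : MeasurableSet S
  aecovered_compl : AECovered μ (graphPart p V Sᶜ)
  ae_notMem : ∀ E, MeasurableSet E → AECovered μ (graphPart p V E) → ∀ᵐ x ∂μ, x ∈ S → x ∉ E

theorem exists_isUncoveredPart (μ : Measure X) [IsFiniteMeasure μ] (p : Z → X) (V : Set Z) :
    ∃ S, IsUncoveredPart μ p V S := by
  obtain ⟨A, ⟨hA, hAc⟩, hmax⟩ := exists_ae_maximal μ
    (fun E => MeasurableSet E ∧ AECovered μ (graphPart p V E)) (A₀ := ∅)
    ⟨.empty, aecovered_of_ae_notMem (by simp [graphPart])⟩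
    (fun A _ h => ⟨.iUnion fun n => (h n).1,
      (AECovered.iUnion fun n => (h n).2).mono fun w hw => by
        obtain ⟨n, hn⟩ := Set.mem_iUnion.1 hw.1
        exact Set.mem_iUnion.2 ⟨n, hn, hw.2⟩⟩)
  refine ⟨Aᶜ, hA.compl, by rwa [compl_compl], fun E hE hEc => ?_⟩
  have hle : μ (A ∪ E) ≤ μ A :=
    hmax (A ∪ E) ⟨hA.union hE, (hAc.union hEc).mono fun w hw =>
      hw.1.imp (fun h => ⟨h, hw.2⟩) (fun h => ⟨h, hw.2⟩)⟩ Set.subset_union_left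
  have hae : (A ∪ E : Set X) ≤ᵐ[μ] A :=
    (ae_eq_of_subset_of_measure_ge Set.subset_union_left hle hA.nullMeasurableSet
      (measure_ne_top μ _)).symm.le
  filter_upwards [hae] with x hx hxA hxE using hxA (hx (Or.inr hxE))

namespace IsUncoveredPart

variable {p : Z → X} {U V : Set Z} {S T : Set X}

theorem ae_mem_mono (hS : IsUncoveredPart μ p V S) (hT : IsUncoveredPart μ p U T) (hVU : V ⊆ U) :
    ∀ᵐ x ∂μ, x ∈ S → x ∈ T := by
  filter_upwards [hS.ae_notMem Tᶜ hT.measurableSet.compl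
    (hT.aecovered_compl.mono fun w hw => ⟨hw.1, hVU hw.2.1, hw.2.2⟩)] with x hx h
  simpa using hx h

theorem ae_mem_closure [TopologicalSpace X] [OpensMeasurableSpace X]
    (hS : IsUncoveredPart μ p V S) : ∀ᵐ x ∂μ, x ∈ S → x ∈ closure (p '' V) := by
  filter_upwards [hS.ae_notMem (closure (p '' V))ᶜ isClosed_closure.measurableSet.compl
    (aecovered_of_ae_notMem (ae_of_all _ fun x z hz => hz.1 (subset_closure
      ⟨z, hz.2.1, hz.2.2⟩)))] with x hx h
  simpa using hx h

theorem ae_exists_mem_of_subset_iUnion {ι : Type*} [Countable ι] {U : ι → Set Z} {T : ι → Set X}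
    (hS : IsUncoveredPart μ p V S) (hT : ∀ i, IsUncoveredPart μ p (U i) (T i))
    (hVU : V ⊆ ⋃ i, U i) : ∀ᵐ x ∂μ, x ∈ S → ∃ i, x ∈ T i := by
  have hcov : AECovered μ (graphPart p V (⋂ i, (T i)ᶜ)) := by
    refine (AECovered.iUnion fun i => (hT i).aecovered_compl).mono ?_
    rintro ⟨x, z⟩ ⟨hx, hz, hpz⟩
    obtain ⟨i, hi⟩ := Set.mem_iUnion.1 (hVU hz)
    exact Set.mem_iUnion.2 ⟨i, Set.mem_iInter.1 hx i, hi, hpz⟩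
  filter_upwards [hS.ae_notMem _ (.iInter fun i => (hT i).measurableSet.compl) hcov] with x hx h
  simpa using hx h

theorem ae_exists_disjoint [StandardBorelSpace X] [StandardBorelSpace Z] [TopologicalSpace Z]
    [OpensMeasurableSpace Z] [T2Space Z] {B : Set (Set Z)}
    (hB : TopologicalSpace.IsTopologicalBasis B) (hBc : B.Countable) {S : Set Z → Set X}
    (hS : ∀ U ∈ B, IsUncoveredPart μ p U (S U)) (hV : V ∈ B) :
    ∀ᵐ x ∂μ, x ∈ S V →
      ∃ U ∈ B, ∃ U' ∈ B, U ⊆ V ∧ U' ⊆ V ∧ Disjoint U U' ∧ x ∈ S U ∧ x ∈ S U' := by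
  have : Countable B := hBc.to_subtype
  let I := {U : B × B // U.1.1 ⊆ V ∧ U.2.1 ⊆ V ∧ Disjoint U.1.1 U.2.1}
  let E : Set X := ⋂ U : I, (S U.1.1 ∩ S U.1.2)ᶜ
  have hSm (U : B) : MeasurableSet (S U) := (hS U U.2).measurableSet
  have hBm (U : B) : MeasurableSet (U : Set Z) := (hB.isOpen U.2).measurableSet
  have hE : MeasurableSet E := .iInter fun U => ((hSm U.1.1).inter (hSm U.1.2)).compl
  -- Over `E` the limit points in `V` form a partial graph; the other points of `V` are covered.
  let W : Set (X × Z) := {w | w.1 ∈ E ∧ w.2 ∈ V ∧ w.2 ∈ limitPoints B {U | w.1 ∈ S U}}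
  have hW : MeasurableSet W := by
    refine (measurable_fst hE).inter ((measurable_snd (hBm ⟨V, hV⟩)).inter ?_)
    suffices MeasurableSet {w : X × Z | ∀ U ∈ B, w.2 ∈ U → w.1 ∈ S U} from this
    simp only [Set.ofPred_forall]
    exact .biInter hBc fun U hU => (measurable_snd (hBm ⟨U, hU⟩)).imp (measurable_fst (hSm ⟨U, hU⟩))
  have hinj : Set.InjOn Prod.fst W := by
    rintro ⟨x, z⟩ ⟨hx, hz, hzS⟩ ⟨x', z'⟩ ⟨-, hz', hzS'⟩ (rfl : x = x')
    by_contra hne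
    obtain ⟨U, hU, U', hU', hUV, hUV', hd, hxU⟩ := exists_disjoint_of_mem_limitPoints hB
      (hB.isOpen hV) hz hz' hzS hzS' fun h => hne (Prod.ext rfl h)
    exact Set.mem_iInter.1 hx ⟨(⟨U, hU⟩, ⟨U', hU'⟩), hUV, hUV', hd⟩ hxU
  have hcov : AECovered μ (graphPart p V E) := by
    refine ((aecovered_of_injOn_fst hW hinj).union
      (AECovered.iUnion fun U : B => (hS U U.2).aecovered_compl)).mono ?_
    rintro ⟨x, z⟩ ⟨hx, hz, hpz⟩
    refine or_iff_not_imp_right.2 fun h => ⟨hx, hz, fun U hU hzU => ?_⟩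
    by_contra hxU
    exact h (Set.mem_iUnion.2 ⟨⟨U, hU⟩, hxU, hzU, hpz⟩)
  filter_upwards [(hS V hV).ae_notMem E hE hcov] with x hx h
  obtain ⟨U, hU⟩ : ∃ U : I, x ∈ S U.1.1 ∩ S U.1.2 := by simpa [E] using hx h
  exact ⟨_, U.1.1.2, _, U.1.2.2, U.2.1, U.2.2.1, U.2.2.2, hU.1, hU.2⟩

end IsUncoveredPart

theorem ae_exists_closure_subset [MetricSpace Z] {p : Z → X} {B : Set (Set Z)}
    (hB : TopologicalSpace.IsTopologicalBasis B) (hBc : B.Countable) {S : Set Z → Set X}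
    (hS : ∀ U ∈ B, IsUncoveredPart μ p U (S U)) {V : Set Z} (hV : V ∈ B) {ε : ℝ} (hε : 0 < ε) :
    ∀ᵐ x ∂μ, x ∈ S V → ∃ U ∈ B, closure U ⊆ V ∧ (∃ z, U ⊆ Metric.ball z ε) ∧ x ∈ S U := by
  have : Countable B := hBc.to_subtype
  let I := {U : B // closure U.1 ⊆ V ∧ ∃ z, U.1 ⊆ Metric.ball z ε}
  have hVI : V ⊆ ⋃ U : I, U.1.1 := by
    intro z hz
    obtain ⟨N, ⟨hN, hNcl⟩, hNs⟩ := (closed_nhds_basis z).mem_iff.1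
      (inter_mem ((hB.isOpen hV).mem_nhds hz) (Metric.ball_mem_nhds z hε))
    obtain ⟨U, hU, hzU, hUN⟩ := hB.mem_nhds_iff.1 hN
    exact Set.mem_iUnion.2 ⟨⟨⟨U, hU⟩, fun a ha => (hNs (closure_minimal hUN hNcl ha)).1,
      z, fun a ha => (hNs (hUN ha)).2⟩, hzU⟩
  filter_upwards [(hS V hV).ae_exists_mem_of_subset_iUnion (fun U : I => hS U.1 U.1.2) hVI]
    with x hx h
  obtain ⟨U, hU⟩ := hx h
  exact ⟨U.1, U.1.2, U.2.1, U.2.2, hU⟩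

theorem ae_notMem_of_isUncoveredPart [StandardBorelSpace X] [StandardBorelSpace Z]
    [TopologicalSpace Z] [PolishSpace Z] [BorelSpace Z] [TopologicalSpace X] [T3Space X]
    [OpensMeasurableSpace X] {p : Z → X} (hp : Continuous p) (hfib : ∀ x, (p ⁻¹' {x}).Countable)
    {B : Set (Set Z)} (hB : TopologicalSpace.IsTopologicalBasis B) (hBc : B.Countable)
    {S : Set Z → Set X} (hS : ∀ U ∈ B, IsUncoveredPart μ p U (S U)) :
    ∀ᵐ x ∂μ, ∀ V ∈ B, x ∉ S V := by
  let := TopologicalSpace.upgradeIsCompletelyMetrizable Z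
  have hup : ∀ᵐ x ∂μ, ∀ V ∈ B, ∀ U ∈ B, V ⊆ U → x ∈ S V → x ∈ S U := by
    simp only [ae_ball_iff hBc]
    exact fun V hV U hU =>
      eventually_imp_distrib_left.2 fun hVU => (hS V hV).ae_mem_mono (hS U hU) hVU
  have hclos : ∀ᵐ x ∂μ, ∀ V ∈ B, x ∈ S V → x ∈ closure (p '' V) :=
    (ae_ball_iff hBc).2 fun V hV => (hS V hV).ae_mem_closure
  have hrefine : ∀ᵐ x ∂μ, ∀ V ∈ B, ∀ n : ℕ, x ∈ S V → ∃ U ∈ B, closure U ⊆ V ∧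
      (∃ z, U ⊆ Metric.ball z (1 / ((n : ℝ) + 1))) ∧ x ∈ S U :=
    (ae_ball_iff hBc).2 fun V hV => ae_all_iff.2 fun n =>
      ae_exists_closure_subset hB hBc hS hV Nat.one_div_pos_of_nat
  have hsplit := (ae_ball_iff hBc).2 fun V hV =>
    IsUncoveredPart.ae_exists_disjoint hB hBc hS hV
  filter_upwards [hup, hclos, hrefine, hsplit] with x hup hclos hrefine hsplit V hV hxV
  refine not_countable_limitPoints (S := {U ∈ B | x ∈ S U}) hB ⟨V, hV, hxV⟩ ?_ ?_ ?_ ?_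
    ((hfib x).mono (limitPoints_subset_preimage hB hp fun U hU => hclos U hU.1 hU.2))
  · exact fun U hU => (closure_nonempty_iff.1 ⟨x, hclos U hU.1 hU.2⟩).of_image
  · exact fun V hV U hU hVU => ⟨hU, hup V hV.1 U hU hVU hV.2⟩
  · intro V hV ε hε
    obtain ⟨n, hn⟩ := exists_nat_one_div_lt hε
    obtain ⟨U, hU, hUV, ⟨z, hz⟩, hxU⟩ := hrefine V hV.1 n hV.2
    exact ⟨U, ⟨hU, hxU⟩, hUV, z, hz.trans (Metric.ball_subset_ball hn.le)⟩
  · intro V hV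
    obtain ⟨U, hU, U', hU', hUV, hUV', hd, hxU, hxU'⟩ := hsplit V hV.1 hV.2
    exact ⟨U, ⟨hU, hxU⟩, U', ⟨hU', hxU'⟩, hUV, hUV', hd⟩

theorem aecovered_of_continuous [StandardBorelSpace X] [StandardBorelSpace Z]
    [TopologicalSpace Z] [PolishSpace Z] [BorelSpace Z] [TopologicalSpace X] [T3Space X]
    [OpensMeasurableSpace X] [IsFiniteMeasure μ] {p : Z → X} (hp : Continuous p)
    (hfib : ∀ x, (p ⁻¹' {x}).Countable) : AECovered μ {w : X × Z | p w.2 = w.1} := by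
  obtain ⟨B, hBc, -, hB⟩ := TopologicalSpace.exists_countable_basis Z
  have : Countable B := hBc.to_subtype
  choose S hS using exists_isUncoveredPart μ p
  have hnull := ae_notMem_of_isUncoveredPart hp hfib hB hBc fun U _ => hS U
  refine ((AECovered.iUnion fun V : B => (hS V).aecovered_compl).union
    (W' := {w : X × Z | ∃ V ∈ B, w.1 ∈ S V})
    (aecovered_of_ae_notMem (hnull.mono fun x hx z ⟨V, hV, h⟩ => hx V hV h))).mono ?_
  rintro ⟨x, z⟩ hz
  obtain ⟨U, hU, hzU, -⟩ := hB.mem_nhds_iff.1 (univ_mem : Set.univ ∈ 𝓝 z)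
  by_cases h : x ∈ S U
  · exact Or.inr ⟨U, hU, h⟩
  · exact Or.inl (Set.mem_iUnion.2 ⟨⟨U, hU⟩, h, hzU, hz⟩)

theorem aecovered_of_measurable [StandardBorelSpace X] [StandardBorelSpace Z] [IsFiniteMeasure μ]
    {p : Z → X} (hp : Measurable p) (hfib : ∀ x, (p ⁻¹' {x}).Countable) :
    AECovered μ {w : X × Z | p w.2 = w.1} := by
  let := upgradeStandardBorel X
  let uZ := upgradeStandardBorel Z
  obtain ⟨t', ht', hc, hpol⟩ := hp.exists_continuous
  have hb : @BorelSpace Z t' _ := by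
    refine @BorelSpace.mk Z t' _ ?_
    rw [eq_borel_upgradeStandardBorel Z,
      @borel_eq_borel_of_le Z t' uZ.toTopologicalSpace hpol uZ.toPolishSpace ht']
  exact @aecovered_of_continuous X Z _ _ μ _ _ t' hpol hb _ _ _ _ p hc hfib

end Uniformization

section Distortion

variable {X : Type*} [MeasurableSpace X] {μ : Measure X} {K L : ℝ≥0}

/-- Taking preimages under `T` multiplies measures by at most `K`. -/
def DistortionLE (μ : Measure X) (K : ℝ≥0) (T : X → X) : Prop :=
  ∀ E, MeasurableSet E → μ (T ⁻¹' E) ≤ K * μ E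

theorem distortionLE_id (μ : Measure X) : DistortionLE μ 1 id := fun E _ => by simp

theorem DistortionLE.comp {S T : X → X} (hS : DistortionLE μ K S) (hT : DistortionLE μ L T)
    (hSm : Measurable S) : DistortionLE μ (L * K) (S ∘ T) := fun E hE =>
  calc μ (T ⁻¹' (S ⁻¹' E)) ≤ L * μ (S ⁻¹' E) := hT _ (hSm hE)
    _ ≤ L * (K * μ E) := by gcongr; exact hS E hE
    _ = ↑(L * K) * μ E := by rw [ENNReal.coe_mul, mul_assoc]

theorem DistortionLE.quasiMeasurePreserving {T : X → X} (h : DistortionLE μ K T)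
    (hT : Measurable T) : Measure.QuasiMeasurePreserving T μ μ := by
  refine ⟨hT, Measure.AbsolutelyContinuous.mk fun E hE h0 => ?_⟩
  rw [Measure.map_apply hT hE]
  simpa [h0] using h E hE

theorem isNonsingularAut_of_distortionLE {θ : X ≃ᵐ X} (h : DistortionLE μ K θ)
    (h' : DistortionLE μ L θ.symm) : IsNonsingularAut μ θ :=
  ⟨h.quasiMeasurePreserving θ.measurable, h'.quasiMeasurePreserving θ.symm.measurable⟩

theorem DistortionLE.ae_rnDeriv_comap_le [IsFiniteMeasure μ] {θ : X ≃ᵐ X}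
    (h : DistortionLE μ L θ.symm) : ∀ᵐ x ∂μ, (μ.comap θ).rnDeriv μ x ≤ L := by
  refine ae_le_of_forall_setLIntegral_le_of_sigmaFinite (Measure.measurable_rnDeriv _ _)
    fun E hE _ => ?_
  calc ∫⁻ x in E, (μ.comap θ).rnDeriv μ x ∂μ ≤ μ.comap θ E := Measure.setLIntegral_rnDeriv_le E
    _ = μ (θ.symm ⁻¹' E) := by rw [← θ.map_symm, θ.symm.map_apply]
    _ ≤ L * μ E := h E hE
    _ = ∫⁻ _ in E, L ∂μ := (setLIntegral_const _ _).symm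

theorem DistortionLE.ae_one_le_mul_rnDeriv_comap [IsFiniteMeasure μ] {θ : X ≃ᵐ X}
    (h : DistortionLE μ K θ) (h' : DistortionLE μ L θ.symm) :
    ∀ᵐ x ∂μ, 1 ≤ K * (μ.comap θ).rnDeriv μ x := by
  have hac : μ.map θ.symm ≪ μ :=
    (h'.quasiMeasurePreserving θ.symm.measurable).absolutelyContinuous
  rw [← θ.map_symm]
  refine ae_le_of_forall_setLIntegral_le_of_sigmaFinite measurable_const fun E hE _ => ?_
  calc ∫⁻ _ in E, 1 ∂μ = μ (θ ⁻¹' (θ.symm ⁻¹' E)) := by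
        rw [setLIntegral_one, ← Set.preimage_comp, θ.symm_comp_self, Set.preimage_id]
    _ ≤ K * μ (θ.symm ⁻¹' E) := h _ (θ.symm.measurable hE)
    _ = K * ∫⁻ x in E, (μ.map θ.symm).rnDeriv μ x ∂μ := by
        rw [Measure.setLIntegral_rnDeriv hac, θ.symm.map_apply]
    _ = ∫⁻ x in E, K * (μ.map θ.symm).rnDeriv μ x ∂μ :=
        (lintegral_const_mul _ (Measure.measurable_rnDeriv _ _)).symm

theorem isBoundedAut_of_distortionLE [IsFiniteMeasure μ] {θ : X ≃ᵐ X} (h : DistortionLE μ K θ)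
    (h' : DistortionLE μ L θ.symm) : IsBoundedAut μ θ := by
  refine ⟨isNonsingularAut_of_distortionLE h h', max (Real.log L) (Real.log K), ?_⟩
  filter_upwards [h'.ae_rnDeriv_comap_le, h.ae_one_le_mul_rnDeriv_comap h'] with x hup hlow
  lift (μ.comap θ).rnDeriv μ x to ℝ≥0 using ne_top_of_le_ne_top ENNReal.coe_ne_top hup with d
  have hup' : d ≤ L := by exact_mod_cast hup
  have hlow' : 1 ≤ K * d := by exact_mod_cast hlow
  have hne : K * d ≠ 0 := (zero_lt_one.trans_le hlow').ne'
  have hK : (K : ℝ) ≠ 0 := NNReal.coe_ne_zero.2 (left_ne_zero_of_mul hne)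
  have hd : (d : ℝ) ≠ 0 := NNReal.coe_ne_zero.2 (right_ne_zero_of_mul hne)
  rw [ENNReal.coe_toReal, abs_le']
  constructor
  · exact (Real.log_le_log (d.coe_nonneg.lt_of_ne' hd) hup').trans (le_max_left _ _)
  · have : 0 ≤ Real.log (K * d) := Real.log_nonneg (by exact_mod_cast hlow')
    rw [Real.log_mul hK hd] at this
    linarith [le_max_right (Real.log L) (Real.log K)]

end Distortion

section Involutions

variable {X : Type*} {f : X → X} {A : Set X}

open Classical in
/-- The map that exchanges `x` and `f x` for `x ∈ A`, and fixes the points outside `A ∪ f '' A`.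
It is an involution when `f` is injective on `A` and maps `A` into its complement. -/
noncomputable def swapAlong (f : X → X) (A : Set X) : X → X :=
  A.piecewise f (Function.extend (A.domRestrict f) Subtype.val id)

theorem swapAlong_of_mem {x : X} (hx : x ∈ A) : swapAlong f A x = f x := by
  classical exact Set.piecewise_eq_of_mem _ _ _ hx

theorem swapAlong_apply (hinj : Set.InjOn f A) (hdisj : ∀ x ∈ A, f x ∉ A) {x : X} (hx : x ∈ A) :
    swapAlong f A (f x) = x := by
  classical
  exact (Set.piecewise_eq_of_notMem _ _ _ (hdisj x hx)).trans
    (hinj.injective.extend_apply Subtype.val id ⟨x, hx⟩)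

theorem swapAlong_of_notMem {x : X} (hx : x ∉ A) (hfx : x ∉ f '' A) : swapAlong f A x = x := by
  classical
  exact (Set.piecewise_eq_of_notMem _ _ _ hx).trans
    (Function.extend_apply' _ _ _ fun ⟨a, ha⟩ => hfx ⟨a, a.2, ha⟩)

theorem involutive_swapAlong (hinj : Set.InjOn f A) (hdisj : ∀ x ∈ A, f x ∉ A) :
    Function.Involutive (swapAlong f A) := by
  intro x
  by_cases hx : x ∈ A
  · rw [swapAlong_of_mem hx, swapAlong_apply hinj hdisj hx]
  by_cases hfx : x ∈ f '' A
  · obtain ⟨y, hy, rfl⟩ := hfx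
    rw [swapAlong_apply hinj hdisj hy, swapAlong_of_mem hy]
  · rw [swapAlong_of_notMem hx hfx, swapAlong_of_notMem hx hfx]

theorem swapAlong_preimage (hinj : Set.InjOn f A) (hdisj : ∀ x ∈ A, f x ∉ A) (Q : Set X) :
    swapAlong f A ⁻¹' Q = (A ∩ f ⁻¹' Q) ∪ f '' (A ∩ Q) ∪ (Q \ (A ∪ f '' A)) := by
  ext x
  rw [Set.mem_preimage]
  by_cases hx : x ∈ A
  · have : x ∉ f '' (A ∩ Q) := by
      rintro ⟨y, hy, rfl⟩
      exact hdisj y hy.1 hx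
    simp [swapAlong_of_mem hx, hx, this]
  by_cases hfx : x ∈ f '' A
  · obtain ⟨y, hy, rfl⟩ := hfx
    have : f y ∈ f '' (A ∩ Q) ↔ y ∈ Q := by
      refine ⟨?_, fun h => ⟨y, ⟨hy, h⟩, rfl⟩⟩
      rintro ⟨z, hz, hzy⟩
      exact hinj hz.1 hy hzy ▸ hz.2
    simp [swapAlong_apply hinj hdisj hy, hx, this, Set.mem_image_of_mem f hy]
  · have : x ∉ f '' (A ∩ Q) := fun h => hfx (Set.image_mono Set.inter_subset_left h)
    simp only [swapAlong_of_notMem hx hfx, Set.mem_union, Set.mem_inter_iff, Set.mem_sdiff, hx,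
      hfx, this, false_and, or_self, not_false_eq_true, and_true, false_or]

theorem swapAlong_eq_or (hinj : Set.InjOn f A) (hdisj : ∀ x ∈ A, f x ∉ A) (x : X) :
    swapAlong f A x = x ∨ (x ∈ A ∧ swapAlong f A x = f x) ∨
      (swapAlong f A x ∈ A ∧ f (swapAlong f A x) = x) := by
  by_cases hx : x ∈ A
  · exact .inr (.inl ⟨hx, swapAlong_of_mem hx⟩)
  by_cases hfx : x ∈ f '' A
  · obtain ⟨y, hy, rfl⟩ := hfx
    rw [swapAlong_apply hinj hdisj hy]
    exact .inr (.inr ⟨hy, rfl⟩)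
  · exact .inl (swapAlong_of_notMem hx hfx)

variable [MeasurableSpace X]

theorem exists_involution [StandardBorelSpace X] (hf : Measurable f) (hA : MeasurableSet A)
    (hinj : Set.InjOn f A) (hdisj : ∀ x ∈ A, f x ∉ A) :
    ∃ θ : X ≃ᵐ X, (∀ x, θ (θ x) = x) ∧ (∀ x ∈ A, θ x = f x) ∧
      ∀ x, θ x = x ∨ (x ∈ A ∧ θ x = f x) ∨ (θ x ∈ A ∧ f (θ x) = x) := by
  have himg : ∀ Q ⊆ A, MeasurableSet Q → MeasurableSet (f '' Q) := fun Q hQA hQ =>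
    hQ.image_of_measurable_injOn hf (hinj.mono hQA)
  have hmeas : Measurable (swapAlong f A) := fun Q hQ => by
    rw [swapAlong_preimage hinj hdisj]
    exact ((hA.inter (hf hQ)).union (himg _ Set.inter_subset_left (hA.inter hQ))).union
      (hQ.diff (hA.union (himg A subset_rfl hA)))
  exact ⟨MeasurableEquiv.ofInvolutive _ (involutive_swapAlong hinj hdisj) hmeas,
    involutive_swapAlong hinj hdisj, fun x => swapAlong_of_mem, swapAlong_eq_or hinj hdisj⟩

theorem exists_involution_eqOn {θ : X ≃ᵐ X} (hθ : ∀ x, θ (θ x) = x) {Q : Set X}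
    (hQ : MeasurableSet Q) (hQθ : ∀ x ∈ Q, θ x ∈ Q) :
    ∃ τ : X ≃ᵐ X, (∀ x, τ (τ x) = x) ∧ (∀ x ∈ Q, τ x = θ x) ∧ ∀ x ∉ Q, τ x = x := by
  classical
  have hin : ∀ x ∈ Q, Q.piecewise θ id x = θ x := fun x => Set.piecewise_eq_of_mem _ _ _
  have hout : ∀ x ∉ Q, Q.piecewise θ id x = x := fun x => Set.piecewise_eq_of_notMem _ _ _
  have hinv : Function.Involutive (Q.piecewise θ id) := fun x => by
    by_cases hx : x ∈ Q
    · rw [hin x hx, hin _ (hQθ x hx), hθ]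
    · rw [hout x hx, hout x hx]
  exact ⟨MeasurableEquiv.ofInvolutive _ hinv (θ.measurable.piecewise hQ measurable_id), hinv,
    hin, hout⟩

theorem distortionLE_of_rnDeriv_map_le {μ : Measure X} [IsFiniteMeasure μ] {θ τ : X ≃ᵐ X}
    (hns : Measure.QuasiMeasurePreserving θ μ μ) {Q : Set X} (hQθ : ∀ x ∈ Q, θ x ∈ Q) {k : ℝ≥0}
    (hk : ∀ x ∈ Q, (μ.map θ).rnDeriv μ x ≤ k) (hin : ∀ x ∈ Q, τ x = θ x)
    (hout : ∀ x ∉ Q, τ x = x) : DistortionLE μ (k + 1) τ := by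
  intro E _
  have hsub : τ ⁻¹' E ⊆ θ ⁻¹' (E ∩ Q) ∪ E := fun x (hx : τ x ∈ E) => by
    by_cases h : x ∈ Q
    · exact .inl ⟨hin x h ▸ hx, hQθ x h⟩
    · exact .inr (hout x h ▸ hx)
  calc μ (τ ⁻¹' E) ≤ μ (θ ⁻¹' (E ∩ Q)) + μ E := (measure_mono hsub).trans (measure_union_le _ _)
    _ = ∫⁻ x in E ∩ Q, (μ.map θ).rnDeriv μ x ∂μ + μ E := by
        rw [← θ.map_apply, ← Measure.setLIntegral_rnDeriv hns.absolutelyContinuous]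
    _ ≤ ∫⁻ _ in E ∩ Q, k ∂μ + μ E := by
        gcongr 1
        exact setLIntegral_mono measurable_const fun x hx => hk x hx.2
    _ ≤ k * μ E + μ E := by
        rw [setLIntegral_const]
        gcongr
        exact Set.inter_subset_left
    _ = ↑(k + 1) * μ E := by rw [ENNReal.coe_add, ENNReal.coe_one, add_mul, one_mul]

theorem exists_bounded_involutions {μ : Measure X} [IsFiniteMeasure μ] {θ : X ≃ᵐ X}
    (hθ : ∀ x, θ (θ x) = x) (hns : Measure.QuasiMeasurePreserving θ μ μ) :
    ∃ τ : ℕ → X ≃ᵐ X, (∀ k x, τ k (τ k x) = x) ∧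
      (∀ k, ∃ K : ℝ≥0, DistortionLE μ K (τ k)) ∧
      (∀ k x, τ k x = x ∨ τ k x = θ x) ∧ ∀ᵐ x ∂μ, ∃ k, τ k x = θ x := by
  let D := (μ.map θ).rnDeriv μ
  have hD : Measurable D := Measure.measurable_rnDeriv _ _
  let Q : ℕ → Set X := fun k => {x | D x ≤ k ∧ D (θ x) ≤ k}
  have hQ : ∀ k, MeasurableSet (Q k) := fun k =>
    (measurableSet_le hD measurable_const).inter
      (measurableSet_le (hD.comp θ.measurable) measurable_const)
  have hQθ : ∀ k, ∀ x ∈ Q k, θ x ∈ Q k := fun k x hx => ⟨hx.2, (hθ x).symm ▸ hx.1⟩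
  choose τ hinv hin hout using fun k => exists_involution_eqOn hθ (hQ k) (hQθ k)
  refine ⟨τ, hinv, fun k => ⟨k + 1, ?_⟩, fun k x => ?_, ?_⟩
  · exact distortionLE_of_rnDeriv_map_le hns (hQθ k) (fun x hx => by simpa using hx.1) (hin k)
      (hout k)
  · by_cases hx : x ∈ Q k
    · exact .inr (hin k x hx)
    · exact .inl (hout k x hx)
  · have hfin : ∀ᵐ x ∂μ, D x < ∞ := Measure.rnDeriv_lt_top _ _
    filter_upwards [hfin, hns.ae hfin] with x hx hTx
    obtain ⟨k, hk⟩ := ENNReal.exists_nat_gt (max_lt hx hTx).ne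
    exact ⟨k, hin k x ⟨(le_max_left _ _).trans hk.le, (le_max_right _ _).trans hk.le⟩⟩

end Involutions

section FeldmanMoore

variable {X : Type*} [MeasurableSpace X] {R : Setoid X} {μ : Measure X}

/-- An action with bounded distortion whose orbits are almost all the classes of `R`. -/
structure IsGeneratingAction (R : Setoid X) (μ : Measure X) (G : Type*) [Group G]
    [MulAction G X] : Prop where
  rel : ∀ (g : G) (x : X), R x (g • x)
  bounded : ∀ g : G, ∃ K : ℝ≥0, DistortionLE μ K (g • · : X → X)
  exhausts : ∀ᵐ x ∂μ, ∀ y, R x y → ∃ g : G, g • x = y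

theorem IsCountableNonsingular.ae_forall_rel (hR : IsCountableNonsingular R μ) {P : X → Prop}
    (h : ∀ᵐ x ∂μ, P x) : ∀ᵐ x ∂μ, ∀ y, R x y → P y := by
  refine measure_mono_null (fun x hx => ?_) (hR.nonsingular {x | ¬ P x} h)
  obtain ⟨y, hxy, hy⟩ : ∃ y, R x y ∧ ¬ P y := by simpa using hx
  exact ⟨y, hy, R.symm hxy⟩

theorem IsCountableNonsingular.quasiMeasurePreserving (hR : IsCountableNonsingular R μ) {T : X → X}
    (hT : Measurable T) (hRT : ∀ x, R x (T x)) : Measure.QuasiMeasurePreserving T μ μ := by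
  refine ⟨hT, Measure.AbsolutelyContinuous.mk fun E hE h0 => ?_⟩
  rw [Measure.map_apply hT hE]
  refine measure_mono_null (fun x hx => ?_) (hR.nonsingular E h0)
  exact ⟨T x, hx, R.symm (hRT x)⟩

variable [StandardBorelSpace X] [IsFiniteMeasure μ]

theorem IsCountableNonsingular.exists_seq_ae_forall_rel (hR : IsCountableNonsingular R μ) :
    ∃ f : ℕ → X → X, (∀ n, Measurable (f n)) ∧ ∀ᵐ x ∂μ, ∀ y, R x y → ∃ n, f n x = y := by
  let Z := {w : X × X // R w.1 w.2}
  have : StandardBorelSpace Z := hR.measurableSet.standardBorel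
  have hfib : ∀ x, ((fun z : Z => z.1.1) ⁻¹' {x}).Countable := fun x => by
    refine Set.Countable.mono (s₂ := Subtype.val ⁻¹' ((x, ·) '' {y | R x y})) ?_
      (((hR.countable_class x).image _).preimage Subtype.val_injective)
    rintro ⟨⟨a, b⟩, h⟩ (rfl : a = x)
    exact ⟨b, h, rfl⟩
  obtain ⟨F, hFc, hFm, hF⟩ : AECovered μ {w : X × Z | w.2.1.1 = w.1} :=
    aecovered_of_measurable (measurable_fst.comp measurable_subtype_coe) hfib
  rcases F.eq_empty_or_nonempty with rfl | hne
  · refine ⟨fun _ => id, fun _ => measurable_id, hF.mono fun x hx y hxy => ?_⟩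
    obtain ⟨f, hf, -⟩ := hx ⟨(x, y), hxy⟩ rfl
    exact absurd hf (Set.notMem_empty f)
  · obtain ⟨e, rfl⟩ := hFc.exists_eq_range hne
    refine ⟨fun n x => (e n x).1.2, fun n => ?_, hF.mono fun x hx y hxy => ?_⟩
    · exact (measurable_snd.comp measurable_subtype_coe).comp (hFm (e n) (Set.mem_range_self n))
    · obtain ⟨-, ⟨n, rfl⟩, hfx⟩ := hx ⟨(x, y), hxy⟩ rfl
      exact ⟨n, congrArg (fun z : Z => z.1.2) hfx⟩

theorem exists_generating_involutions (hR : IsCountableNonsingular R μ) :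
    ∃ θ : ℕ × ℕ × ℕ → X ≃ᵐ X, (∀ i x, θ i (θ i x) = x) ∧ (∀ i x, R x (θ i x)) ∧
      ∀ᵐ x ∂μ, ∀ y, R x y → y = x ∨ ∃ i, θ i x = y := by
  obtain ⟨f, hfm, hf⟩ := hR.exists_seq_ae_forall_rel
  obtain ⟨S, hSm, hS⟩ := exists_seq_separating X (p := MeasurableSet) MeasurableSet.empty Set.univ
  -- On `A (n, m, k)` the map `f n` has the left inverse `f m`, and it takes `S k` to `(S k)ᶜ`.
  let A : ℕ × ℕ × ℕ → Set X := fun i =>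
    {x | R x (f i.1 x) ∧ f i.2.1 (f i.1 x) = x ∧ x ∈ S i.2.2 ∧ f i.1 x ∉ S i.2.2}
  have hA : ∀ i, MeasurableSet (A i) := fun i =>
    ((measurable_id.prodMk (hfm i.1)) hR.measurableSet).inter
      ((measurableSet_eq_fun ((hfm i.2.1).comp (hfm i.1)) measurable_id).inter
        ((hSm i.2.2).inter ((hfm i.1) (hSm i.2.2).compl)))
  have hinj : ∀ i, Set.InjOn (f i.1) (A i) := fun i x hx y hy hxy => by
    rw [← hx.2.1, ← hy.2.1, hxy]
  choose θ hθinv hθA hθor using fun i => exists_involution (hfm i.1) (hA i) (hinj i)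
    fun x hx h => hx.2.2.2 h.2.2.1
  refine ⟨θ, hθinv, fun i x => ?_, ?_⟩
  · rcases hθor i x with h | ⟨hx, h⟩ | ⟨hx, h⟩
    · rw [h]
    · exact h ▸ hx.1
    · exact R.symm (by simpa only [h] using hx.1)
  filter_upwards [hf, hR.ae_forall_rel hf] with x hfx hfy y hxy
  refine or_iff_not_imp_left.2 fun hne => ?_
  obtain ⟨n, hn⟩ := hfx y hxy
  obtain ⟨m, hm⟩ := hfy y hxy x (R.symm hxy)
  obtain ⟨k, hk⟩ : ∃ k, ¬ (x ∈ S k ↔ y ∈ S k) := by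
    by_contra! h
    exact hne (hS x trivial y trivial h).symm
  by_cases hx : x ∈ S k
  · have hy : y ∉ S k := fun hy => hk ⟨fun _ => hy, fun _ => hx⟩
    have : θ (n, m, k) x = f n x :=
      hθA (n, m, k) x ⟨by rwa [hn], by rw [hn, hm], hx, by rwa [hn]⟩
    exact ⟨(n, m, k), this.trans hn⟩
  · have hy : y ∈ S k := by_contra fun hy => hk ⟨fun h => absurd h hx, fun h => absurd h hy⟩
    have : θ (m, n, k) y = f m y :=
      hθA (m, n, k) y ⟨by rw [hm]; exact R.symm hxy, by rw [hm, hn], hy, by rwa [hm]⟩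
    exact ⟨(m, n, k), by rw [← hm, ← this, hθinv]⟩

theorem exists_generating_bounded_involutions (hR : IsCountableNonsingular R μ) :
    ∃ θ : (ℕ × ℕ × ℕ) × ℕ → X ≃ᵐ X, (∀ i x, θ i (θ i x) = x) ∧ (∀ i x, R x (θ i x)) ∧
      (∀ i, ∃ K : ℝ≥0, DistortionLE μ K (θ i)) ∧
      ∀ᵐ x ∂μ, ∀ y, R x y → y = x ∨ ∃ i, θ i x = y := by
  obtain ⟨θ, hθinv, hθR, hθ⟩ := exists_generating_involutions hR
  choose τ hτinv hτbdd hτor hτ using fun i => exists_bounded_involutions (hθinv i)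
    (hR.quasiMeasurePreserving (θ i).measurable (hθR i))
  refine ⟨fun i => τ i.1 i.2, fun i => hτinv i.1 i.2, fun i x => ?_, fun i => hτbdd i.1 i.2, ?_⟩
  · rcases hτor i.1 i.2 x with h | h
    · rw [h]
    · exact h ▸ hθR i.1 x
  · filter_upwards [hθ, ae_all_iff.2 hτ] with x hx hτx y hxy
    refine (hx y hxy).imp_right ?_
    rintro ⟨i, hi⟩
    obtain ⟨k, hk⟩ := hτx i
    exact ⟨(i, k), hk.trans hi⟩

theorem exists_generating_action (hR : IsCountableNonsingular R μ) :
    ∃ (G : Type) (_ : Group G) (_ : Countable G) (_ : MulAction G X)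
      (_ : MeasurableConstSMul G X), IsGeneratingAction R μ G := by
  obtain ⟨θ, hθinv, hθR, hθbdd, hθ⟩ := exists_generating_bounded_involutions hR
  let ι := (ℕ × ℕ × ℕ) × ℕ
  let act : MulAction (FreeGroup ι) X :=
    MulAction.compHom X (FreeGroup.lift fun i => (θ i).toEquiv : FreeGroup ι →* Equiv.Perm X)
  have hof : ∀ i (x : X), (FreeGroup.of i : FreeGroup ι) • x = θ i x := fun i x =>
    congrArg (fun e : Equiv.Perm X => e x) (FreeGroup.lift_apply_of ..)
  have hinv : ∀ i (x : X), (FreeGroup.of i : FreeGroup ι)⁻¹ • x = θ i x := fun i x => by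
    rw [inv_smul_eq_iff, hof, hθinv]
  have key : ∀ g : FreeGroup ι, Measurable (g • · : X → X) ∧ (∀ x : X, R x (g • x)) ∧
      ∃ K : ℝ≥0, DistortionLE μ K (g • · : X → X) := by
    intro g
    induction g using FreeGroup.induction_on with
    | C1 => simpa only [one_smul] using ⟨measurable_id, R.refl, 1, distortionLE_id μ⟩
    | of i => simpa only [hof] using ⟨(θ i).measurable, hθR i, hθbdd i⟩
    | inv_of i _ => simpa only [hinv] using ⟨(θ i).measurable, hθR i, hθbdd i⟩
    | mul g h hg hh =>
      obtain ⟨hgm, hgR, K, hK⟩ := hg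
      obtain ⟨hhm, hhR, L, hL⟩ := hh
      simpa only [mul_smul] using
        ⟨hgm.comp hhm, fun x => R.trans (hhR x) (hgR _), L * K, hK.comp hL hgm⟩
  refine ⟨FreeGroup ι, inferInstance, inferInstance, act, ⟨fun g => (key g).1⟩,
    fun g => (key g).2.1, fun g => (key g).2.2, ?_⟩
  filter_upwards [hθ] with x hx y hxy
  rcases hx y hxy with rfl | ⟨i, hi⟩
  · exact ⟨1, one_smul _ _⟩
  · exact ⟨FreeGroup.of i, (hof i x).trans hi⟩

end FeldmanMoore

section Moved

variable {X : Type*}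

/-- The points that `T` moves into or out of `B`. -/
def moved (T : X → X) (B : Set X) : Set X := {x | ¬ (T x ∈ B ↔ x ∈ B)}

theorem moved_eq_symmDiff (T : X → X) (B : Set X) : moved T B = (T ⁻¹' B) ∆ B := by
  ext x
  simp only [moved, Set.mem_ofPred_eq, Set.mem_symmDiff, Set.mem_preimage]
  tauto

theorem measurableSet_moved [MeasurableSpace X] {T : X → X} (hT : Measurable T) {B : Set X}
    (hB : MeasurableSet B) : MeasurableSet (moved T B) := by
  rw [moved_eq_symmDiff]
  exact (hT hB).symmDiff hB

end Moved

section Cocycle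

variable {X : Type*} [MeasurableSpace X] {G : Type*} [Group G] [MulAction G X] {μ : Measure X}

/-- `c` is a measurable cocycle that represents the logarithm of the Radon–Nikodym derivatives of
the action. -/
structure IsLogDeriv (μ : Measure X) (c : G → X → ℝ) : Prop where
  measurable : ∀ g, Measurable (c g)
  mul : ∀ g h x, c (h * g) x = c h (g • x) + c g x
  lintegral : ∀ (g : G) (f : X → ℝ≥0∞), Measurable f →
    ∫⁻ x, f (g • x) * ENNReal.ofReal (Real.exp (c g x)) ∂μ = ∫⁻ x, f x ∂μ

namespace IsLogDeriv

variable {c : G → X → ℝ}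

theorem one (hc : IsLogDeriv μ c) (x : X) : c 1 x = 0 := by
  simpa using hc.mul 1 1 x

theorem inv (hc : IsLogDeriv μ c) (g : G) (x : X) : c g⁻¹ (g • x) = -c g x := by
  have := hc.mul g g⁻¹ x
  rw [inv_mul_cancel, hc.one] at this
  linarith

theorem mul_inv (hc : IsLogDeriv μ c) (g h : G) (x : X) :
    c (h * g⁻¹) (g • x) = c h x - c g x := by
  have := hc.mul g (h * g⁻¹) x
  rw [inv_mul_cancel_right] at this
  linarith

theorem measure_preimage_inv_le [MeasurableConstSMul G X] (hc : IsLogDeriv μ c) {g : G} {E : Set X}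
    (hE : MeasurableSet E) {K : ℝ} (hK : ∀ x ∈ E, c g x ≤ K) :
    μ ((g⁻¹ • · : X → X) ⁻¹' E) ≤ ENNReal.ofReal (Real.exp K) * μ E := by
  have hE' : MeasurableSet ((g⁻¹ • · : X → X) ⁻¹' E) := measurable_const_smul g⁻¹ hE
  have h := hc.lintegral g (((g⁻¹ • · : X → X) ⁻¹' E).indicator 1) (measurable_one.indicator hE')
  rw [lintegral_indicator_one hE'] at h
  rw [← h, ← setLIntegral_const, ← lintegral_indicator hE]
  refine lintegral_mono fun x => ?_
  by_cases hx : x ∈ E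
  · have : g • x ∈ (g⁻¹ • · : X → X) ⁻¹' E := by simpa using hx
    rw [Set.indicator_of_mem this, Set.indicator_of_mem hx, Pi.one_apply, one_mul]
    exact ENNReal.ofReal_le_ofReal (Real.exp_le_exp.2 (hK x hx))
  · have : g • x ∉ (g⁻¹ • · : X → X) ⁻¹' E := by simpa using hx
    rw [Set.indicator_of_notMem this, zero_mul]
    exact zero_le

theorem measure_preimage_le [MeasurableConstSMul G X] (hc : IsLogDeriv μ c) {g : G} {E : Set X}
    (hE : MeasurableSet E) {K : ℝ} (hK : ∀ x, g • x ∈ E → -c g x ≤ K) :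
    μ ((g • · : X → X) ⁻¹' E) ≤ ENNReal.ofReal (Real.exp K) * μ E := by
  have := hc.measure_preimage_inv_le (g := g⁻¹) hE (K := K) fun x hx => by
    have h := hc.inv g (g⁻¹ • x)
    rw [smul_inv_smul] at h
    exact h ▸ hK _ (by rwa [smul_inv_smul])
  rwa [inv_inv] at this

end IsLogDeriv

/-- The Radon–Nikodym derivative of `g` at `x`; it is a cocycle up to null sets only. -/
noncomputable def smulDeriv (μ : Measure X) (g : G) : X → ℝ≥0∞ :=
  (μ.map (g⁻¹ • · : X → X)).rnDeriv μ

@[fun_prop]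
theorem measurable_smulDeriv (g : G) : Measurable (smulDeriv μ g) :=
  Measure.measurable_rnDeriv _ _

theorem smulDeriv_lt_top [IsFiniteMeasure μ] (g : G) : ∀ᵐ x ∂μ, smulDeriv μ g x < ∞ :=
  Measure.rnDeriv_lt_top _ _

variable [MeasurableConstSMul G X]

theorem absolutelyContinuous_map_inv_smul
    (hns : ∀ g : G, Measure.QuasiMeasurePreserving (g • · : X → X) μ μ) (g : G) :
    μ ≪ μ.map (g⁻¹ • · : X → X) := by
  refine Measure.AbsolutelyContinuous.mk fun E hE h0 => ?_
  rw [Measure.map_apply (measurable_const_smul g⁻¹) hE] at h0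
  simpa [← Set.preimage_comp, Function.comp_def] using (hns g).preimage_null h0

theorem exists_cocycle_of_ae [Countable G] {l : G → X → ℝ} (hl : ∀ g, Measurable (l g))
    (hmul : ∀ g h, ∀ᵐ x ∂μ, l (h * g) x = l h (g • x) + l g x) :
    ∃ c : G → X → ℝ, (∀ g, Measurable (c g)) ∧ (∀ g h x, c (h * g) x = c h (g • x) + c g x) ∧
      ∀ g, c g =ᵐ[μ] l g := by
  let X₀ : Set X := {x | ∀ g h, l (h * g) x = l h (g • x) + l g x}
  have hX₀m : MeasurableSet X₀ := by
    simp only [X₀, Set.ofPred_forall]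
    exact .iInter fun g => .iInter fun h =>
      measurableSet_eq_fun (hl _) (((hl h).comp (measurable_const_smul g)).add (hl g))
  have hX₀ : ∀ᵐ x ∂μ, x ∈ X₀ := by simpa only [X₀, Set.mem_ofPred_eq, ae_all_iff] using hmul
  have hinv : ∀ (k : G), ∀ x ∈ X₀, k • x ∈ X₀ := fun k x hx g h => by
    have hkhg := hx k (h * g)
    have hgkh := hx (g * k) h
    have hkg := hx k g
    rw [mul_assoc] at hkhg
    rw [mul_smul] at hgkh
    linarith
  refine ⟨fun g => X₀.indicator (l g), fun g => (hl g).indicator hX₀m, fun g h x => ?_,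
    fun g => hX₀.mono fun x hx => Set.indicator_of_mem hx _⟩
  by_cases hx : x ∈ X₀
  · simp only [Set.indicator_of_mem hx, Set.indicator_of_mem (hinv g x hx)]
    exact hx g h
  · have hgx : g • x ∉ X₀ := fun h => hx (by simpa using hinv g⁻¹ _ h)
    simp only [Set.indicator_of_notMem hx, Set.indicator_of_notMem hgx, add_zero]

variable [IsFiniteMeasure μ]

theorem smulDeriv_pos (hns : ∀ g : G, Measure.QuasiMeasurePreserving (g • · : X → X) μ μ) (g : G) :
    ∀ᵐ x ∂μ, 0 < smulDeriv μ g x :=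
  (absolutelyContinuous_map_inv_smul hns g).ae_le
    (Measure.rnDeriv_pos (hns g⁻¹).absolutelyContinuous)

theorem lintegral_smulDeriv (hns : ∀ g : G, Measure.QuasiMeasurePreserving (g • · : X → X) μ μ)
    (g : G) {f : X → ℝ≥0∞} (hf : Measurable f) :
    ∫⁻ x, f (g • x) * smulDeriv μ g x ∂μ = ∫⁻ x, f x ∂μ := by
  have hfg : Measurable fun x => f (g • x) := hf.comp (measurable_const_smul g)
  calc ∫⁻ x, f (g • x) * smulDeriv μ g x ∂μ
      = ∫⁻ x, (μ.map (g⁻¹ • · : X → X)).rnDeriv μ x * f (g • x) ∂μ := by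
        simp only [mul_comm, smulDeriv]
    _ = ∫⁻ x, f (g • x) ∂(μ.map (g⁻¹ • · : X → X)) :=
        lintegral_rnDeriv_mul (hns g⁻¹).absolutelyContinuous hfg.aemeasurable
    _ = ∫⁻ x, f x ∂μ := by
        rw [lintegral_map hfg (measurable_const_smul g⁻¹)]
        simp only [smul_inv_smul]

theorem setLIntegral_smulDeriv_mul
    (hns : ∀ g : G, Measure.QuasiMeasurePreserving (g • · : X → X) μ μ) (g : G) {f : X → ℝ≥0∞}
    (hf : Measurable f) {E : Set X} (hE : MeasurableSet E) :
    ∫⁻ x in E, f (g • x) * smulDeriv μ g x ∂μ =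
      ∫⁻ x, E.indicator 1 (g⁻¹ • x : X) * f x ∂μ := by
  have hm : Measurable fun x : X => E.indicator (1 : X → ℝ≥0∞) (g⁻¹ • x) * f x :=
    ((measurable_one.indicator hE).comp (measurable_const_smul g⁻¹)).mul hf
  rw [← lintegral_smulDeriv hns g hm, ← lintegral_indicator hE]
  congr 1 with x
  by_cases hx : x ∈ E <;> simp [hx]

theorem smulDeriv_mul (hns : ∀ g : G, Measure.QuasiMeasurePreserving (g • · : X → X) μ μ)
    (g h : G) : ∀ᵐ x ∂μ, smulDeriv μ (h * g) x = smulDeriv μ h (g • x) * smulDeriv μ g x := by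
  refine ae_eq_of_forall_setLIntegral_eq_of_sigmaFinite (by fun_prop)
    (((measurable_smulDeriv h).comp (measurable_const_smul g)).mul (measurable_smulDeriv g))
    fun E hE _ => ?_
  have hEg : Measurable fun x : X => E.indicator (1 : X → ℝ≥0∞) ((h * g)⁻¹ • x) :=
    (measurable_one.indicator hE).comp (measurable_const_smul _)
  calc ∫⁻ x in E, smulDeriv μ (h * g) x ∂μ
      = ∫⁻ x in E, 1 * smulDeriv μ (h * g) x ∂μ := by simp only [one_mul]
    _ = ∫⁻ x, E.indicator 1 ((h * g)⁻¹ • x : X) * 1 ∂μ :=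
        setLIntegral_smulDeriv_mul hns (h * g) measurable_const hE
    _ = ∫⁻ x, E.indicator 1 ((h * g)⁻¹ • (h • x) : X) * smulDeriv μ h x ∂μ := by
        simp only [mul_one]
        exact (lintegral_smulDeriv hns h hEg).symm
    _ = ∫⁻ x, E.indicator 1 (g⁻¹ • x : X) * smulDeriv μ h x ∂μ := by
        simp only [mul_inv_rev, mul_smul, inv_smul_smul]
    _ = ∫⁻ x in E, smulDeriv μ h (g • x) * smulDeriv μ g x ∂μ :=
        (setLIntegral_smulDeriv_mul hns g (measurable_smulDeriv h) hE).symm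

theorem exists_isLogDeriv [Countable G] (μ : Measure X) [IsFiniteMeasure μ]
    (hns : ∀ g : G, Measure.QuasiMeasurePreserving (g • · : X → X) μ μ) :
    ∃ c : G → X → ℝ, IsLogDeriv μ c := by
  have hmul (g h : G) : ∀ᵐ x ∂μ, Real.log (smulDeriv μ (h * g) x).toReal =
      Real.log (smulDeriv μ h (g • x)).toReal + Real.log (smulDeriv μ g x).toReal := by
    filter_upwards [smulDeriv_mul hns g h, smulDeriv_lt_top g, smulDeriv_pos hns g,
      (hns g).ae (smulDeriv_lt_top h), (hns g).ae (smulDeriv_pos hns h)]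
      with x hx gtop gpos htop hpos
    rw [hx, ENNReal.toReal_mul]
    exact Real.log_mul (ENNReal.toReal_pos hpos.ne' htop.ne).ne'
      (ENNReal.toReal_pos gpos.ne' gtop.ne).ne'
  obtain ⟨c, hcm, hc, hcl⟩ := exists_cocycle_of_ae
    (fun g => Real.measurable_log.comp (measurable_smulDeriv g).ennreal_toReal) hmul
  refine ⟨c, hcm, hc, fun g f hf => ?_⟩
  rw [← lintegral_smulDeriv hns g hf]
  refine lintegral_congr_ae ?_
  filter_upwards [hcl g, smulDeriv_lt_top g, smulDeriv_pos hns g] with x hx htop hpos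
  rw [hx, Function.comp_apply, Real.exp_log (ENNReal.toReal_pos hpos.ne' htop.ne),
    ENNReal.ofReal_toReal htop.ne]

end Cocycle

section Ergodicity

variable {X : Type*} [MeasurableSpace X] {R : Setoid X} {μ : Measure X}

theorem IsStronglyErgodic.null_or_conull [IsProbabilityMeasure μ] (hSE : IsStronglyErgodic R μ)
    {A : Set X} (hA : MeasurableSet A) (hinv : ∀ g ∈ fullGroup R μ, μ (A ∆ (g '' A)) = 0) :
    (∀ᵐ x ∂μ, x ∉ A) ∨ ∀ᵐ x ∂μ, x ∈ A := by
  have h0 : μ A * (1 - μ A) = 0 := tendsto_nhds_unique tendsto_const_nhds <|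
    hSE (fun _ => A) (fun _ => hA) fun g hg => by simp only [hinv g hg, tendsto_const_nhds]
  refine (mul_eq_zero.1 h0).imp measure_eq_zero_iff_ae_notMem.1 fun h => ?_
  exact (mem_ae_iff_prob_eq_one hA).2 (prob_le_one.antisymm (tsub_eq_zero_iff_le.1 h))

theorem IsStronglyErgodic.isErgodic [IsProbabilityMeasure μ] (hSE : IsStronglyErgodic R μ) :
    IsErgodic R μ := by
  intro f hf hinv
  obtain ⟨f', hf', hff'⟩ := hf.aestronglyMeasurable
  have hf'm : Measurable f' := hf'.measurable
  have hf'inv (U : Set ℂ) : ∀ g ∈ fullGroup R μ, μ ((f' ⁻¹' U) ∆ (g '' (f' ⁻¹' U))) = 0 := by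
    intro g hg
    have hgf' : ∀ᵐ x ∂μ, f' (g x) = f' x := by
      filter_upwards [hinv, hg.2, hff', hg.1.1.ae hff'] with x hx hgx hfx hfgx
      rw [← hfx, ← hfgx, hx _ hgx]
    rw [measure_eq_zero_iff_ae_notMem]
    filter_upwards [hg.1.2.ae hgf'] with y hy
    rw [g.apply_symm_apply] at hy
    rw [Set.mem_symmDiff, g.image_eq_preimage_symm]
    simp only [Set.mem_preimage, hy]
    tauto
  obtain ⟨a, ha⟩ := Filter.exists_eventuallyEq_const_of_forall_separating (l := ae μ) (f := f')
    MeasurableSet fun U hU => (hSE.null_or_conull (hf'm hU) (hf'inv U)).symm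
  exact ⟨a, hff'.trans ha⟩

variable {G : Type*} [Group G] [MulAction G X]

namespace IsGeneratingAction

theorem null_or_conull (hG : IsGeneratingAction R μ G) (herg : IsErgodic R μ)
    {A : Set X} (hA : MeasurableSet A) (hinv : ∀ᵐ x ∂μ, ∀ g : G, g • x ∈ A ↔ x ∈ A) :
    (∀ᵐ x ∂μ, x ∉ A) ∨ ∀ᵐ x ∂μ, x ∈ A := by
  classical
  obtain ⟨a, ha⟩ := herg (A.indicator fun _ => 1) ((memLp_top_const (1 : ℂ)).indicator hA) <| by
    filter_upwards [hinv, hG.exhausts] with x hAx hexh y hxy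
    obtain ⟨g, rfl⟩ := hexh y hxy
    simp only [Set.indicator_apply, hAx g]
  by_cases ha1 : a = 1
  · refine .inr (ha.mono fun x hx => by_contra fun hxA => ?_)
    rw [Set.indicator_of_notMem hxA, ha1] at hx
    exact zero_ne_one hx
  · refine .inl (ha.mono fun x hx hxA => ha1 ?_)
    rw [Set.indicator_of_mem hxA] at hx
    exact hx.symm

variable [MeasurableConstSMul G X]

theorem quasiMeasurePreserving (hG : IsGeneratingAction R μ G) (g : G) :
    Measure.QuasiMeasurePreserving (g • · : X → X) μ μ := by
  obtain ⟨K, hK⟩ := hG.bounded g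
  exact hK.quasiMeasurePreserving (measurable_const_smul g)

variable [Countable G]

theorem ae_forall_smul (hG : IsGeneratingAction R μ G) {P : X → Prop} (h : ∀ᵐ x ∂μ, P x) :
    ∀ᵐ x ∂μ, ∀ g : G, P (g • x) :=
  ae_all_iff.2 fun g => (hG.quasiMeasurePreserving g).ae h

theorem ae_exists_smul_mem (hG : IsGeneratingAction R μ G) (herg : IsErgodic R μ) {A : Set X}
    (hA : MeasurableSet A) (h0 : μ A ≠ 0) : ∀ᵐ x ∂μ, ∃ g : G, g • x ∈ A := by
  have hm : MeasurableSet {x | ∃ g : G, g • x ∈ A} := by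
    rw [Set.ofPred_exists]
    exact .iUnion fun g => measurable_const_smul g hA
  refine (hG.null_or_conull herg hm (ae_of_all _ fun x g => ⟨?_, ?_⟩)).resolve_left fun h => h0 ?_
  · rintro ⟨k, hk⟩
    exact ⟨k * g, by rwa [mul_smul]⟩
  · rintro ⟨k, hk⟩
    exact ⟨k * g⁻¹, by rwa [mul_smul, inv_smul_smul]⟩
  · exact measure_mono_null (fun x hx => not_not.2 ⟨1, by rwa [one_smul]⟩) h

theorem exists_smul_inter (hG : IsGeneratingAction R μ G) (herg : IsErgodic R μ) {A B : Set X}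
    (hB : MeasurableSet B) (hA0 : μ A ≠ 0) (hB0 : μ B ≠ 0) :
    ∃ g : G, μ {x | x ∈ A ∧ g • x ∈ B} ≠ 0 := by
  by_contra! h
  refine hA0 (measure_eq_zero_iff_ae_notMem.2 ?_)
  filter_upwards [hG.ae_exists_smul_mem herg hB hB0,
    measure_eq_zero_iff_ae_notMem.1 (measure_iUnion_null h)] with x ⟨g, hg⟩ hx hxA
  exact hx (Set.mem_iUnion.2 ⟨g, hxA, hg⟩)

theorem tendsto_measure_forall_smul_ne [StandardBorelSpace X] [IsFiniteMeasure μ]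
    (hG : IsGeneratingAction R μ G) {T : X → X} (hT : Measurable T) (hRT : ∀ᵐ x ∂μ, R x (T x)) :
    Tendsto (fun F : Finset G => μ {x | ∀ g ∈ F, g • x ≠ T x}) atTop (𝓝 0) := by
  have hm (F : Finset G) : MeasurableSet {x | ∀ g ∈ F, g • x ≠ T x} := by
    simp only [Set.ofPred_forall]
    exact .iInter fun g => .iInter fun _ =>
      (measurableSet_eq_fun (measurable_const_smul g) hT).compl
  have hnull : μ (⋂ F : Finset G, {x | ∀ g ∈ F, g • x ≠ T x}) = 0 := by
    rw [measure_eq_zero_iff_ae_notMem]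
    filter_upwards [hRT, hG.exhausts] with x hRx hx hmem
    obtain ⟨g, hg⟩ := hx _ hRx
    exact Set.mem_iInter.1 hmem {g} g (Finset.mem_singleton_self g) hg
  rw [← hnull]
  exact tendsto_measure_iInter_atTop (fun F => (hm F).nullMeasurableSet)
    (fun F F' hF x hx g hg => hx g (hF hg)) ⟨∅, measure_ne_top _ _⟩

theorem tendsto_measure_symmDiff_image [StandardBorelSpace X] [IsFiniteMeasure μ]
    (hG : IsGeneratingAction R μ G) {B : ℕ → Set X}
    (hB : ∀ g : G, Tendsto (fun n => μ (moved (g • · : X → X) (B n))) atTop (𝓝 0))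
    {θ : X ≃ᵐ X} (hθ : θ ∈ fullGroup R μ) :
    Tendsto (fun n => μ (B n ∆ (θ '' B n))) atTop (𝓝 0) := by
  have hRθ : ∀ᵐ x ∂μ, R x (θ.symm x) := (hθ.1.2.ae hθ.2).mono fun x hx =>
    R.symm (by rwa [θ.apply_symm_apply] at hx)
  refine ENNReal.tendsto_nhds_zero.2 fun ε hε => ?_
  have hε2 : 0 < ε / 2 := ENNReal.half_pos hε.ne'
  obtain ⟨F, hF⟩ := (ENNReal.tendsto_nhds_zero.1
    (hG.tendsto_measure_forall_smul_ne θ.symm.measurable hRθ) _ hε2).exists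
  have hsum : Tendsto (fun n => ∑ g ∈ F, μ (moved (g • · : X → X) (B n))) atTop (𝓝 0) := by
    simpa using tendsto_finsetSum F fun g _ => hB g
  filter_upwards [ENNReal.tendsto_nhds_zero.1 hsum _ hε2] with n hn
  have hsub : B n ∆ (θ '' B n) ⊆
      {x | ∀ g ∈ F, g • x ≠ θ.symm x} ∪ ⋃ g ∈ F, moved (g • · : X → X) (B n) := by
    intro y hy
    refine or_iff_not_imp_left.2 fun hyF => ?_
    obtain ⟨g, hg, hgy⟩ : ∃ g ∈ F, g • y = θ.symm y := by simpa using hyF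
    rw [Set.mem_symmDiff, θ.image_eq_preimage_symm, Set.mem_preimage] at hy
    refine Set.mem_biUnion hg ?_
    simp only [moved, Set.mem_ofPred_eq, hgy]
    tauto
  calc μ (B n ∆ (θ '' B n))
      ≤ μ {x | ∀ g ∈ F, g • x ≠ θ.symm x} + ∑ g ∈ F, μ (moved (g • · : X → X) (B n)) :=
        (measure_mono hsub).trans ((measure_union_le _ _).trans
          (add_le_add_right (measure_biUnion_finset_le _ _) _))
    _ ≤ ε / 2 + ε / 2 := add_le_add hF hn
    _ = ε := ENNReal.add_halves ε

theorem exists_finset_of_isStronglyErgodic [StandardBorelSpace X] [IsFiniteMeasure μ]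
    (hG : IsGeneratingAction R μ G) (hSE : IsStronglyErgodic R μ) {δ : ℝ≥0∞} (hδ : 0 < δ) :
    ∃ (F : Finset G) (ε : ℝ≥0), 0 < ε ∧ ∀ B, MeasurableSet B →
      (∀ g ∈ F, μ (moved (g • · : X → X) B) ≤ ε) → μ B * (1 - μ B) < δ := by
  classical
  obtain ⟨e, he⟩ := exists_surjective_nat G
  obtain ⟨u, -, hupos, hu⟩ := exists_seq_strictAnti_tendsto (0 : ℝ≥0)
  by_contra! hcon
  choose B hBm hB hBδ using fun n : ℕ => hcon ((Finset.range n).image e) (u n) (hupos n)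
  have hBg : ∀ g : G, Tendsto (fun n => μ (moved (g • · : X → X) (B n))) atTop (𝓝 0) := by
    intro g
    obtain ⟨i, rfl⟩ := he g
    refine tendsto_of_tendsto_of_tendsto_of_le_of_le' tendsto_const_nhds
      (ENNReal.tendsto_coe.2 hu) (Eventually.of_forall fun _ => zero_le) ?_
    filter_upwards [eventually_gt_atTop i] with n hn
    exact hB n _ (Finset.mem_image_of_mem e (Finset.mem_range.2 hn))
  have hlim := hSE B hBm fun θ hθ => hG.tendsto_measure_symmDiff_image hBg hθ
  exact hδ.not_ge (ge_of_tendsto' hlim hBδ)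

end IsGeneratingAction

end Ergodicity

section FirstHit

variable {X : Type*} {G : Type*} [Group G] [MulAction G X]

/-- The `x` such that `(x, e n • x) ∈ W`, and `n` is the first index at which `e` takes `x` to
`e n • x`. -/
def firstHit (e : ℕ → G) (W : Set (X × X)) (n : ℕ) : Set X :=
  {x | (∀ m < n, e m • x ≠ e n • x) ∧ (x, e n • x) ∈ W}

theorem eq_of_mem_firstHit {e : ℕ → G} {W : Set (X × X)} {x : X} {m n : ℕ}
    (hm : x ∈ firstHit e W m) (hn : x ∈ firstHit e W n) (h : e m • x = e n • x) : m = n := by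
  rcases lt_trichotomy m n with hlt | heq | hgt
  · exact absurd h (hn.1 m hlt)
  · exact heq
  · exact absurd h.symm (hm.1 n hgt)

theorem exists_mem_firstHit {e : ℕ → G} (he : Function.Surjective e) {W : Set (X × X)} {x : X}
    {g : G} (hg : (x, g • x) ∈ W) : ∃ n, x ∈ firstHit e W n ∧ e n • x = g • x := by
  classical
  have hex : ∃ n, e n • x = g • x := (he g).imp fun n hn => by rw [hn]
  have hfind := Nat.find_spec hex
  exact ⟨Nat.find hex, ⟨fun m hm h => Nat.find_min hex hm (h.trans hfind), by rwa [hfind]⟩, hfind⟩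

end FirstHit

section ReturnSup

variable {X : Type*} {G : Type*} [Group G] [MulAction G X] {c : G → X → ℝ}

/-- The supremum of `exp (c g x)` over the `g` that take `x` into `W`. It exhibits `c` as a
coboundary wherever it is finite and nonzero. -/
noncomputable def returnSup (c : G → X → ℝ) (W : Set X) (x : X) : ℝ≥0∞ :=
  ⨆ g : G, ((g • · : X → X) ⁻¹' W).indicator (fun x => ENNReal.ofReal (Real.exp (c g x))) x

theorem returnSup_smul_mul (hmul : ∀ g h x, c (h * g) x = c h (g • x) + c g x) (W : Set X)
    (k : G) (x : X) :
    returnSup c W (k • x) * ENNReal.ofReal (Real.exp (c k x)) = returnSup c W x := by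
  simp only [returnSup, ENNReal.iSup_mul]
  refine Equiv.iSup_congr (Equiv.mulRight k) fun g => ?_
  by_cases hx : g • k • x ∈ W
  · simp [hx, mul_smul, hmul, Real.exp_add, ENNReal.ofReal_mul (Real.exp_pos _).le]
  · simp [hx, mul_smul]

theorem returnSup_ne_zero {W : Set X} {x : X} {g : G} (hg : g • x ∈ W) : returnSup c W x ≠ 0 := by
  intro h0
  have hexp := ENNReal.iSup_eq_zero.1 h0 g
  rw [Set.indicator_of_mem (by exact hg), ENNReal.ofReal_eq_zero] at hexp
  exact (Real.exp_pos _).not_ge hexp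

theorem returnSup_ne_top {W : Set X} {x : X} {N : ℝ} (hN : ∀ g : G, g • x ∈ W → c g x ≤ N) :
    returnSup c W x ≠ ∞ := by
  refine ne_top_of_le_ne_top (ENNReal.ofReal_ne_top (r := Real.exp N)) (iSup_le fun g => ?_)
  exact Set.indicator_apply_le' (fun hx => ENNReal.ofReal_le_ofReal (Real.exp_le_exp.2 (hN g hx)))
    fun _ => zero_le

end ReturnSup

section Invariant

variable {X : Type*} [MeasurableSpace X] {ν : Measure X}

theorem lintegral_encard_eq_tsum {S : ℕ → Set X} (hS : ∀ n, MeasurableSet (S n)) :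
    ∫⁻ x, (({n | x ∈ S n}.encard : ℕ∞) : ℝ≥0∞) ∂ν = ∑' n, ν (S n) := by
  have hcount (x : X) : (({n | x ∈ S n}.encard : ℕ∞) : ℝ≥0∞) = ∑' n, (S n).indicator 1 x := by
    rw [← ENNReal.tsum_set_one, tsum_subtype {n | x ∈ S n} fun _ => (1 : ℝ≥0∞)]
    rfl
  simp only [hcount]
  rw [lintegral_tsum fun n => (measurable_one.indicator (hS n)).aemeasurable]
  exact tsum_congr fun n => lintegral_indicator_one (hS n)

theorem lintegral_encard_eq_measure {Y : Type*} {E : Set X} (hE : MeasurableSet E) {a : X → Y} :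
    ∫⁻ x, (({y | y = a x ∧ x ∈ E}.encard : ℕ∞) : ℝ≥0∞) ∂ν = ν E := by
  rw [← lintegral_indicator_one hE]
  congr 1 with x
  by_cases hx : x ∈ E <;> simp [hx]

variable {R : Setoid X} {μ : Measure X} {G : Type*} [Group G] [MulAction G X]

section Count

variable [StandardBorelSpace X] [MeasurableConstSMul G X] {e : ℕ → G} {W : Set (X × X)}

theorem measurableSet_firstHit (hW : MeasurableSet W) (n : ℕ) :
    MeasurableSet (firstHit e W n) := by
  refine MeasurableSet.inter (s₁ := {x | ∀ m < n, e m • x ≠ e n • x}) ?_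
    ((measurable_id.prodMk (measurable_const_smul (e n))) hW)
  simp only [Set.ofPred_forall]
  exact .iInter fun m => .iInter fun _ => (measurableSet_eq_fun (measurable_const_smul (e m))
    (measurable_const_smul (e n))).compl

namespace IsGeneratingAction

theorem leftCount_eq_tsum (hG : IsGeneratingAction R μ G) (hν : ν ≪ μ)
    (he : Function.Surjective e) (hW : MeasurableSet W) (hWR : ∀ p ∈ W, R p.1 p.2) :
    leftCount ν W = ∑' n, ν (firstHit e W n) := by
  rw [← lintegral_encard_eq_tsum (measurableSet_firstHit hW)]
  refine lintegral_congr_ae (hν.ae_le ?_)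
  filter_upwards [hG.exhausts] with x hx
  have himg : {y | (x, y) ∈ W} = (e · • x) '' {n | x ∈ firstHit e W n} := by
    refine Set.Subset.antisymm (fun y hy => ?_) ?_
    · obtain ⟨g, rfl⟩ := hx y (hWR _ hy)
      exact exists_mem_firstHit he hy
    · rintro _ ⟨n, hn, rfl⟩
      exact hn.2
  have hinj : Set.InjOn (e · • x) {n | x ∈ firstHit e W n} := fun n hn m hm h =>
    eq_of_mem_firstHit hn hm h
  rw [himg, hinj.encard_image]

theorem rightCount_eq_tsum (hG : IsGeneratingAction R μ G) (hν : ν ≪ μ)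
    (he : Function.Surjective e) (hW : MeasurableSet W) (hWR : ∀ p ∈ W, R p.1 p.2) :
    rightCount ν W = ∑' n, ν (((e n)⁻¹ • · : X → X) ⁻¹' firstHit e W n) := by
  rw [← lintegral_encard_eq_tsum fun n =>
    measurable_const_smul (e n)⁻¹ (measurableSet_firstHit hW n)]
  refine lintegral_congr_ae (hν.ae_le ?_)
  filter_upwards [hG.exhausts] with y hy
  have himg : {x | (x, y) ∈ W} =
      (fun n => (e n)⁻¹ • y) '' {n | (e n)⁻¹ • y ∈ firstHit e W n} := by
    refine Set.Subset.antisymm (fun x hx => ?_) ?_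
    · obtain ⟨g, rfl⟩ := hy x (R.symm (hWR _ hx))
      have hx' : (g • y, g⁻¹ • g • y) ∈ W := by rwa [inv_smul_smul]
      obtain ⟨n, hn, hng⟩ := exists_mem_firstHit he hx'
      have hny : (e n)⁻¹ • y = g • y := by rw [inv_smul_eq_iff, hng, inv_smul_smul]
      exact ⟨n, by rwa [Set.mem_ofPred_eq, hny], hny⟩
    · rintro _ ⟨n, hn, rfl⟩
      have := hn.2
      rwa [smul_inv_smul] at this
  have hinj : Set.InjOn (fun n => (e n)⁻¹ • y) {n | (e n)⁻¹ • y ∈ firstHit e W n} := by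
    intro n hn m hm (h : (e n)⁻¹ • y = (e m)⁻¹ • y)
    refine eq_of_mem_firstHit hn (h ▸ hm) ?_
    rw [smul_inv_smul, h, smul_inv_smul]
  rw [himg, hinj.encard_image]
  rfl

theorem isInvariant [Countable G] (hG : IsGeneratingAction R μ G) (hν : ν ≪ μ)
    (hinv : ∀ (g : G) (E : Set X), MeasurableSet E → ν ((g • · : X → X) ⁻¹' E) = ν E) :
    IsInvariant R ν := by
  intro W hW hWR
  obtain ⟨e, he⟩ := exists_surjective_nat G
  rw [hG.leftCount_eq_tsum hν he hW hWR, hG.rightCount_eq_tsum hν he hW hWR]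
  exact tsum_congr fun n => (hinv _ _ (measurableSet_firstHit hW n)).symm

theorem measure_preimage_smul (hG : IsGeneratingAction R μ G) (hinv : IsInvariant R μ) (g : G)
    {E : Set X} (hE : MeasurableSet E) : μ ((g • · : X → X) ⁻¹' E) = μ E := by
  let W : Set (X × X) := {p | p.2 = g • p.1 ∧ p.2 ∈ E}
  have hl : leftCount μ W = μ ((g • · : X → X) ⁻¹' E) := by
    rw [← lintegral_encard_eq_measure (measurable_const_smul g hE) (a := (g • ·)), leftCount]
    refine lintegral_congr fun x => ?_
    congr! 4 with y
    exact and_congr_right fun (h : y = g • x) => by rw [Set.mem_preimage, ← h]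
  have hr : rightCount μ W = μ E := by
    rw [← lintegral_encard_eq_measure hE (a := (g⁻¹ • ·)), rightCount]
    refine lintegral_congr fun y => ?_
    congr! 4 with x
    exact and_congr_left' (by rw [eq_inv_smul_iff, eq_comm])
  rw [← hl, ← hr]
  exact hinv W ((measurableSet_eq_fun measurable_snd ((measurable_const_smul g).comp
    measurable_fst)).inter (measurable_snd hE)) fun p hp => hp.1 ▸ hG.rel g p.1

theorem isLogDeriv_zero (hG : IsGeneratingAction R μ G) (hinv : IsInvariant R μ) :
    IsLogDeriv μ fun (_ : G) (_ : X) => (0 : ℝ) := by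
  refine ⟨fun _ => measurable_const, fun _ _ _ => by simp, fun g f hf => ?_⟩
  have hmp : MeasurePreserving (g • · : X → X) μ μ := by
    refine ⟨measurable_const_smul g, Measure.ext fun E hE => ?_⟩
    rw [Measure.map_apply (measurable_const_smul g) hE, hG.measure_preimage_smul hinv g hE]
  simpa only [Real.exp_zero, ENNReal.ofReal_one, mul_one] using hmp.lintegral_comp hf

end IsGeneratingAction

end Count

section Coboundary

variable [MeasurableConstSMul G X] {c : G → X → ℝ}

theorem IsLogDeriv.withDensity_preimage_smul (hc : IsLogDeriv μ c) {h : X → ℝ≥0∞}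
    (hm : Measurable h)
    (hcob : ∀ (g : G) x, h (g • x) * ENNReal.ofReal (Real.exp (c g x)) = h x) (g : G) {E : Set X}
    (hE : MeasurableSet E) :
    μ.withDensity h ((g • · : X → X) ⁻¹' E) = μ.withDensity h E := by
  have hgE : MeasurableSet ((g • · : X → X) ⁻¹' E) := measurable_const_smul g hE
  rw [withDensity_apply _ hgE, withDensity_apply _ hE, ← lintegral_indicator hgE,
    ← lintegral_indicator hE, ← hc.lintegral g (E.indicator h) (hm.indicator hE)]
  congr 1 with x
  by_cases hx : g • x ∈ E <;> simp [hx, hcob]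

theorem IsTypeIII.not_isInvariant [NeZero μ] (hIII : IsTypeIII R μ) (hν : ν ∈ measureClass μ)
    (hinv : ∀ r : ℝ≥0∞, IsInvariant R (r • ν)) : False := by
  obtain ⟨herg, hI, hII, hIIi⟩ := hIII
  obtain ⟨hσ, hac, hac'⟩ := hν
  by_cases hmass : ν Set.univ = ∞
  · exact hIIi ⟨herg, hI, ν, ⟨hσ, hac, hac'⟩, hmass, by simpa using hinv 1⟩
  · have : IsFiniteMeasure ν := ⟨lt_top_iff_ne_top.2 hmass⟩
    have : NeZero ν := ⟨fun h => NeZero.ne μ (Measure.absolutelyContinuous_zero_iff.1 (h ▸ hac'))⟩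
    exact hII ⟨herg, hI, (ν Set.univ)⁻¹ • ν, ⟨inferInstance, hac.smul_left _,
      hac'.trans (Measure.absolutelyContinuous_smul (ENNReal.inv_ne_zero.2 hmass))⟩,
      inferInstance, hinv _⟩

theorem IsTypeIII.not_coboundary [StandardBorelSpace X] [IsProbabilityMeasure μ] [Countable G]
    (hIII : IsTypeIII R μ) (hG : IsGeneratingAction R μ G) (hc : IsLogDeriv μ c) {h : X → ℝ≥0∞}
    (hm : Measurable h) (hpos : ∀ᵐ x ∂μ, h x ≠ 0) (htop : ∀ᵐ x ∂μ, h x ≠ ∞) :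
    ¬ ∀ (g : G) x, h (g • x) * ENNReal.ofReal (Real.exp (c g x)) = h x := by
  intro hcob
  have hac : μ.withDensity h ≪ μ := withDensity_absolutelyContinuous _ _
  refine hIII.not_isInvariant ⟨SigmaFinite.withDensity_of_ne_top htop, hac,
    withDensity_absolutelyContinuous' hm.aemeasurable hpos⟩ fun r =>
    hG.isInvariant (hac.smul_left r) fun g E hE => ?_
  rw [Measure.smul_apply, Measure.smul_apply, hc.withDensity_preimage_smul hm hcob g hE]

variable [Countable G]

theorem measurable_returnSup (hc : ∀ g, Measurable (c g)) {W : Set X} (hW : MeasurableSet W) :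
    Measurable (returnSup c W) :=
  .iSup fun g => ((hc g).exp.ennreal_ofReal).indicator (measurable_const_smul g hW)

theorem IsGeneratingAction.ae_not_bddAbove_or_ae_bddAbove (hG : IsGeneratingAction R μ G)
    (herg : IsErgodic R μ) (hc : ∀ g, Measurable (c g))
    (hmul : ∀ g h x, c (h * g) x = c h (g • x) + c g x) {W : Set X} (hW : MeasurableSet W) :
    (∀ᵐ x ∂μ, ∀ N : ℝ, ∃ g : G, g • x ∈ W ∧ N < c g x) ∨
      ∀ᵐ x ∂μ, ∃ N : ℝ, ∀ g : G, g • x ∈ W → c g x ≤ N := by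
  let bdd : Set X := {x | ∃ N : ℕ, ∀ g : G, g • x ∈ W → c g x ≤ N}
  have hbdd : MeasurableSet bdd := by
    simp only [bdd, Set.ofPred_exists, Set.ofPred_forall]
    exact .iUnion fun N => .iInter fun g =>
      (measurable_const_smul g hW).imp (measurableSet_le (hc g) measurable_const)
  have hstep (k : G) (x : X) : x ∈ bdd → k • x ∈ bdd := by
    rintro ⟨N, hN⟩
    obtain ⟨M, hM⟩ := exists_nat_ge (N - c k x)
    refine ⟨M, fun g hg => ?_⟩
    have := hN (g * k) (by rwa [mul_smul])
    rw [hmul] at this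
    linarith
  refine (hG.null_or_conull herg hbdd (ae_of_all _ fun x k =>
    ⟨fun h => by simpa using hstep k⁻¹ _ h, hstep k x⟩)).imp (fun h => ?_) fun h => ?_
  · filter_upwards [h] with x hx N
    obtain ⟨M, hM⟩ := exists_nat_ge N
    obtain ⟨g, hg, hgM⟩ : ∃ g : G, g • x ∈ W ∧ M < c g x := by
      simp only [bdd, Set.mem_ofPred_eq] at hx
      push Not at hx
      exact hx M
    exact ⟨g, hg, hM.trans_lt hgM⟩
  · exact h.mono fun x ⟨N, hN⟩ => ⟨N, hN⟩

namespace IsTypeIII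

variable [StandardBorelSpace X] [IsProbabilityMeasure μ]

theorem ae_not_bddAbove (hIII : IsTypeIII R μ) (hG : IsGeneratingAction R μ G)
    (hc : IsLogDeriv μ c) {W : Set X} (hW : MeasurableSet W) (hW0 : μ W ≠ 0) :
    ∀ᵐ x ∂μ, ∀ N : ℝ, ∃ g : G, g • x ∈ W ∧ N < c g x := by
  refine (hG.ae_not_bddAbove_or_ae_bddAbove hIII.1 hc.measurable hc.mul hW).resolve_right
    fun hbdd => ?_
  exact hIII.not_coboundary hG hc (measurable_returnSup hc.measurable hW)
    ((hG.ae_exists_smul_mem hIII.1 hW hW0).mono fun x ⟨g, hg⟩ => returnSup_ne_zero hg)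
    (hbdd.mono fun x ⟨N, hN⟩ => returnSup_ne_top hN) (returnSup_smul_mul hc.mul W)

theorem ae_not_bddBelow (hIII : IsTypeIII R μ) (hG : IsGeneratingAction R μ G)
    (hc : IsLogDeriv μ c) {W : Set X} (hW : MeasurableSet W) (hW0 : μ W ≠ 0) :
    ∀ᵐ x ∂μ, ∀ N : ℝ, ∃ g : G, g • x ∈ W ∧ c g x < N := by
  have hneg (g : G) : Measurable fun x => -c g x := (hc.measurable g).neg
  have hmul (g h : G) (x : X) : -c (h * g) x = -c h (g • x) + -c g x := by rw [hc.mul, neg_add]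
  rcases hG.ae_not_bddAbove_or_ae_bddAbove hIII.1 hneg hmul hW with h | hbdd
  · filter_upwards [h] with x hx N
    exact (hx (-N)).imp fun g hg => ⟨hg.1, neg_lt_neg_iff.1 hg.2⟩
  refine absurd (fun g x => ?_) (hIII.not_coboundary hG hc
    (h := fun x => (returnSup (fun g x => -c g x) W x)⁻¹) (measurable_returnSup hneg hW).inv
    (hbdd.mono fun x ⟨N, hN⟩ => ENNReal.inv_ne_zero.2 (returnSup_ne_top hN))
    ((hG.ae_exists_smul_mem hIII.1 hW hW0).mono fun x ⟨g, hg⟩ =>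
      ENNReal.inv_ne_top.2 (returnSup_ne_zero hg)))
  have hexp : ENNReal.ofReal (Real.exp (c g x)) = (ENNReal.ofReal (Real.exp (-c g x)))⁻¹ := by
    rw [← ENNReal.ofReal_inv_of_pos (Real.exp_pos _), ← Real.exp_neg, neg_neg]
  rw [← returnSup_smul_mul hmul W g x, hexp,
    ENNReal.mul_inv (.inr ENNReal.ofReal_ne_top) (.inr (by simp [Real.exp_pos]))]

end IsTypeIII

end Coboundary

end Invariant

section Neighbourhood

variable {X : Type*} {G : Type*} [Group G] [MulAction G X]

/-- The points whose orbit meets `Y` at a place where the cocycle `c` is at most `K` in absolute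
value. -/
def nb (c : G → X → ℝ) (Y : Set X) (K : ℝ) : Set X := {x | ∃ g : G, g • x ∈ Y ∧ |c g x| ≤ K}

/-- No point of `W` in the orbit of `x` lies between `x` and `g • x` with respect to the order
that the cocycle `c` induces on the orbit. -/
def Linked (c : G → X → ℝ) (W : Set X) (g : G) (x : X) : Prop :=
  ∀ h : G, h • x ∈ W → c h x ∉ Set.uIcc 0 (c g x)

theorem nb_mono {c : G → X → ℝ} {Y Y' : Set X} {K K' : ℝ} (hY : Y ⊆ Y') (hK : K ≤ K') :
    nb c Y K ⊆ nb c Y' K' := fun _ ⟨g, hg, h⟩ => ⟨g, hY hg, h.trans hK⟩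

theorem linked_anti {c : G → X → ℝ} {W W' : Set X} (hW : W ⊆ W') {g : G} {x : X}
    (h : Linked c W' g x) : Linked c W g x := fun k hk => h k (hW hk)

theorem exists_of_not_linked {c : G → X → ℝ} {W : Set X} {g : G} {x : X} (hg : 0 ≤ c g x)
    (h : ¬ Linked c W g x) : ∃ k : G, k • x ∈ W ∧ 0 ≤ c k x ∧ c k x ≤ c g x := by
  simp only [Linked, not_forall, not_not, Set.uIcc_of_le hg, Set.mem_Icc] at h
  simpa only [exists_prop] using h

variable [MeasurableSpace X] {μ : Measure X} {c : G → X → ℝ}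

namespace IsLogDeriv

theorem smul_mem_nb (hc : IsLogDeriv μ c) {Y : Set X} {K : ℝ} {x : X} (hx : x ∈ nb c Y K)
    (k : G) : k • x ∈ nb c Y (K + |c k x|) := by
  obtain ⟨g, hg, h⟩ := hx
  refine ⟨g * k⁻¹, by rwa [mul_smul, inv_smul_smul], ?_⟩
  rw [hc.mul_inv]
  exact (abs_sub _ _).trans (by gcongr)

theorem lt_abs_of_smul_notMem_nb (hc : IsLogDeriv μ c) {Y : Set X} {K : ℝ} {x : X} (hx : x ∈ Y)
    {k : G} (hk : k • x ∉ nb c Y K) : K < |c k x| := by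
  by_contra! hle
  have hx0 : x ∈ nb c Y 0 := ⟨1, by rwa [one_smul], by rw [hc.one, abs_zero]⟩
  exact hk (nb_mono subset_rfl (by linarith) (hc.smul_mem_nb hx0 k))

variable {W : Set X}

theorem linked_inv (hc : IsLogDeriv μ c) {g : G} {x : X} (h : Linked c W g x) :
    Linked c W g⁻¹ (g • x) := by
  intro k hk hmem
  have hkg := h (k * g) (by rwa [mul_smul])
  rw [hc.mul, Set.mem_uIcc] at hkg
  rw [hc.inv, Set.mem_uIcc] at hmem
  grind

theorem linked_mul (hc : IsLogDeriv μ c) {g k : G} {x : X} (h : Linked c W g x)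
    (h' : Linked c W k (g • x)) : Linked c W (k * g) x := by
  intro l hl hmem
  have hlx := h l hl
  have hlgx := h' (l * g⁻¹) (by rwa [mul_smul, inv_smul_smul])
  rw [hc.mul_inv] at hlgx
  rw [hc.mul] at hmem
  rw [Set.mem_uIcc] at hlx hlgx hmem
  grind

theorem linked_mul_inv_iff (hc : IsLogDeriv μ c) {g k : G} {x : X} (h : Linked c W g x) :
    Linked c W (k * g⁻¹) (g • x) ↔ Linked c W k x := by
  refine ⟨fun h' => by simpa using hc.linked_mul h h', fun h' => ?_⟩
  exact hc.linked_mul (hc.linked_inv h) (by rwa [inv_smul_smul])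

variable [Countable G] [MeasurableConstSMul G X]

theorem measurableSet_nb (hc : IsLogDeriv μ c) {Y : Set X} (hY : MeasurableSet Y) (K : ℝ) :
    MeasurableSet (nb c Y K) := by
  simp only [nb, Set.ofPred_exists]
  exact .iUnion fun g => (measurable_const_smul g hY).inter
    (measurableSet_le (hc.measurable g).abs measurable_const)

theorem measurableSet_linked (hc : IsLogDeriv μ c) (hW : MeasurableSet W) (g : G) :
    MeasurableSet {x | Linked c W g x} := by
  simp only [Linked, Set.ofPred_forall]
  refine .iInter fun h => (measurable_const_smul h hW).imp (MeasurableSet.compl ?_)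
  exact (measurableSet_le (measurable_const.min (hc.measurable g)) (hc.measurable h)).inter
    (measurableSet_le (hc.measurable h) (measurable_const.max (hc.measurable g)))

end IsLogDeriv

/-- `B` is measurable and almost everywhere a union of classes of the relation on orbits that
relates `x` to `g • x` when `L g x`. -/
structure LInvariant (μ : Measure X) (L : G → X → Prop) (B : Set X) : Prop where
  measurableSet : MeasurableSet B
  ae_smul_mem_iff : ∀ᵐ x ∂μ, ∀ g, L g x → (g • x ∈ B ↔ x ∈ B)

namespace LInvariant

variable {L : G → X → Prop} {B C : Set X}

theorem empty : LInvariant μ L ∅ := ⟨.empty, by simp⟩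

theorem compl (h : LInvariant μ L B) : LInvariant μ L Bᶜ :=
  ⟨h.1.compl, h.2.mono fun _ hx g hg => not_congr (hx g hg)⟩

theorem iUnion {ι : Type*} [Countable ι] {B : ι → Set X} (h : ∀ i, LInvariant μ L (B i)) :
    LInvariant μ L (⋃ i, B i) := by
  refine ⟨.iUnion fun i => (h i).1, ?_⟩
  filter_upwards [ae_all_iff.2 fun i => (h i).2] with x hx g hg
  simp only [Set.mem_iUnion]
  exact exists_congr fun i => hx i g hg

theorem union (hB : LInvariant μ L B) (hC : LInvariant μ L C) : LInvariant μ L (B ∪ C) := by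
  rw [Set.union_eq_iUnion]
  exact .iUnion fun b => by cases b <;> assumption

end LInvariant

theorem exists_ergodic_component [IsProbabilityMeasure μ] {L : G → X → Prop} {δ : ℝ≥0∞}
    (hδ : 3 * δ ≤ 1) (h : ∀ B, LInvariant μ L B → μ B < δ ∨ μ Bᶜ < δ) :
    ∃ E, LInvariant μ L E ∧ μ Eᶜ < δ ∧
      ∀ B, LInvariant μ L B → μ (E ∩ B) = 0 ∨ μ (E ∩ Bᶜ) = 0 := by
  have hsmall {B : Set X} (hB : LInvariant μ L B) (hBδ : μ B ≤ δ + δ) : μ B < δ := by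
    refine (h B hB).resolve_right fun hBc => hδ.not_gt ?_
    calc 1 = μ B + μ Bᶜ := (prob_add_prob_compl hB.1).symm
      _ < δ + δ + δ := ENNReal.add_lt_add_of_le_of_lt (measure_ne_top μ B) hBδ hBc
      _ = 3 * δ := by ring
  -- The component is the complement of a maximal small invariant set.
  obtain ⟨N, ⟨hN, hNδ⟩, hmax⟩ := exists_ae_maximal μ (fun B => LInvariant μ L B ∧ μ B < δ)
    (A₀ := ∅) ⟨.empty, hsmall .empty (by simp)⟩ fun B hmono hB =>
      have hU := LInvariant.iUnion fun n => (hB n).1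
      ⟨hU, hsmall hU <| by
        rw [hmono.measure_iUnion]
        exact (iSup_le fun n => (hB n).2.le).trans le_self_add⟩
  have hnull {B : Set X} (hB : LInvariant μ L B) (hBδ : μ B < δ) : μ (Nᶜ ∩ B) = 0 := by
    have hNB := hmax _ ⟨hN.union hB, hsmall (hN.union hB)
      ((measure_union_le _ _).trans (add_le_add hNδ.le hBδ.le))⟩ Set.subset_union_left
    have hdiff := measure_sdiff Set.subset_union_left hN.1.nullMeasurableSet (measure_ne_top μ N)
      (s₁ := N ∪ B)
    rwa [tsub_eq_zero_iff_le.2 hNB, Set.union_sdiff_left, Set.sdiff_eq, Set.inter_comm] at hdiff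
  refine ⟨Nᶜ, hN.compl, by rwa [compl_compl], fun B hB => ?_⟩
  exact (h B hB).imp (hnull hB) (hnull hB.compl)

end Neighbourhood

section TypeThree

variable {X : Type*} [MeasurableSpace X] {G : Type*} [Group G] [MulAction G X] {R : Setoid X}
  {μ : Measure X} {c : G → X → ℝ} {W Q Y : Set X}

theorem IsLogDeriv.linked_compl_nb (hc : IsLogDeriv μ c) {g k : G} {x : X} {K : ℝ}
    (hk : k • x ∈ Y) (hK : |c k x| + |c g x| ≤ K) : Linked c (nb c Y K)ᶜ g x := by
  intro h hh hmem
  refine hh (nb_mono subset_rfl ?_ (hc.smul_mem_nb (K := |c k x|) ⟨k, hk, le_rfl⟩ h))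
  have : |c h x| ≤ |c g x| := by simpa using Set.abs_sub_left_of_mem_uIcc hmem
  linarith

/-- The points `x` for which some point of `Q` above `x`, in the order given by `c`, is not linked
to `x` and is at most `n` higher than some point of `Q` that is linked to `x`. -/
def gapLE (c : G → X → ℝ) (W Q : Set X) (n : ℝ) : Set X :=
  {x | ∃ g k : G, (g • x ∈ Q ∧ 0 < c g x ∧ ¬ Linked c W g x) ∧
    (Linked c W k x ∧ k • x ∈ Q) ∧ c g x ≤ c k x + n}

theorem IsLogDeriv.smul_mem_gapLE (hc : IsLogDeriv μ c) {n : ℝ} {l : G} {x : X}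
    (hl : Linked c W l x) (hx : x ∈ gapLE c W Q n) : l • x ∈ gapLE c W Q n := by
  obtain ⟨g, k, ⟨hgQ, hgpos, hgl⟩, ⟨hkl, hkQ⟩, hgk⟩ := hx
  obtain ⟨h, hhW, hh0, hhg⟩ := exists_of_not_linked hgpos.le hgl
  have hlt : c l x < c h x := by
    by_contra! hle
    exact hl h hhW (Set.mem_uIcc_of_le hh0 hle)
  refine ⟨g * l⁻¹, k * l⁻¹, ⟨by rwa [mul_smul, inv_smul_smul], ?_, ?_⟩,
    ⟨(hc.linked_mul_inv_iff hl).2 hkl, by rwa [mul_smul, inv_smul_smul]⟩, ?_⟩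
  · rw [hc.mul_inv]
    linarith
  · rwa [hc.linked_mul_inv_iff hl]
  · rw [hc.mul_inv, hc.mul_inv]
    linarith

theorem IsLogDeriv.lInvariant_gapLE [Countable G] [MeasurableConstSMul G X]
    (hc : IsLogDeriv μ c) (hW : MeasurableSet W) (hQ : MeasurableSet Q) (n : ℝ) :
    LInvariant μ (Linked c W) (gapLE c W Q n) := by
  refine ⟨?_, ae_of_all _ fun x l hl => ⟨fun h => ?_, hc.smul_mem_gapLE hl⟩⟩
  · simp only [gapLE, Set.ofPred_exists]
    refine .iUnion fun g => .iUnion fun k => .inter (.inter (measurable_const_smul g hQ) (.inter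
      (measurableSet_lt measurable_const (hc.measurable g))
      (hc.measurableSet_linked hW g).compl)) (.inter (.inter (hc.measurableSet_linked hW k)
      (measurable_const_smul k hQ))
      (measurableSet_le (hc.measurable g) ((hc.measurable k).add_const _)))
  · simpa using hc.smul_mem_gapLE (hc.linked_inv hl) h

theorem IsLogDeriv.exists_mem_gapLE (hc : IsLogDeriv μ c) {K : ℝ} (hK : 0 ≤ K) {x : X}
    (hxQ : x ∈ Q) (hxY : x ∈ Y)
    (hW : ∃ h : G, h • x ∈ (nb c Y K)ᶜ ∧ 0 < c h x)
    (hQ : ∀ N : ℝ, ∃ g : G, g • x ∈ Q ∧ N < c g x) :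
    ∃ n : ℕ, x ∈ gapLE c (nb c Y K)ᶜ Q n := by
  obtain ⟨h, hh, hh0⟩ := hW
  obtain ⟨g, hg, hgh⟩ := hQ (c h x)
  obtain ⟨n, hn⟩ := exists_nat_ge (c g x)
  refine ⟨n, g, 1, ⟨hg, hh0.trans hgh, fun hl => ?_⟩, ⟨fun l hl hmem => ?_, by rwa [one_smul]⟩, ?_⟩
  · exact hl h hh (Set.mem_uIcc_of_le hh0.le hgh.le)
  · rw [hc.one, Set.uIcc_self, Set.mem_singleton_iff] at hmem
    have := hc.lt_abs_of_smul_notMem_nb hxY hl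
    rw [hmem, abs_zero] at this
    exact this.not_ge hK
  · rwa [hc.one, zero_add]

/- Start from the highest point of `Q` below `x`, up to an error less than `1`. The next point of
`Q` above its component is more than `K ≥ 1` higher, hence above `x`, by at most `n`. -/
theorem IsLogDeriv.mem_nb_of_smul_mem_gapLE (hc : IsLogDeriv μ c) (hQY : Q ⊆ Y) {K : ℝ}
    (hK : 1 ≤ K) {n : ℝ} {x : X} (hgap : ∀ a : G, a • x ∈ Q → a • x ∈ gapLE c (nb c Y K)ᶜ Q n)
    (hbelow : ∃ a : G, a • x ∈ Q ∧ c a x < 0) (hx : x ∉ nb c Y K) : x ∈ nb c Y n := by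
  let P : Set ℝ := {t | ∃ a : G, a • x ∈ Q ∧ c a x = t ∧ t < 0}
  have hPne : P.Nonempty := hbelow.elim fun a ha => ⟨_, a, ha.1, rfl, ha.2⟩
  have hPb : BddAbove P := ⟨0, fun _ ⟨_, _, _, ht⟩ => ht.le⟩
  obtain ⟨_, ⟨a, haQ, rfl, ha0⟩, hat⟩ := exists_lt_of_lt_csSup hPne (sub_one_lt (sSup P))
  obtain ⟨g, k, ⟨hgQ, hgpos, hgl⟩, ⟨hkl, -⟩, hgk⟩ := hgap a haQ
  have hk0 : c k (a • x) < -c a x := by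
    by_contra! hle
    refine hkl a⁻¹ (by rwa [inv_smul_smul]) ?_
    rw [hc.inv]
    exact Set.mem_uIcc_of_le (by linarith) hle
  obtain ⟨h, hhW, hh0, hhg⟩ := exists_of_not_linked hgpos.le hgl
  have hKh : K < c h (a • x) := by
    simpa only [abs_of_nonneg hh0] using hc.lt_abs_of_smul_notMem_nb (hQY haQ) hhW
  have hga : c (g * a) x = c g (a • x) + c a x := hc.mul a g x
  have hga0 : 0 ≤ c (g * a) x := by
    by_contra! hlt
    have := le_csSup hPb (⟨g * a, by rwa [mul_smul], rfl, hlt⟩ : c (g * a) x ∈ P)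
    linarith
  refine ⟨g * a, by rw [mul_smul]; exact hQY hgQ, ?_⟩
  rw [abs_of_nonneg hga0]
  linarith

/-- All large sets have the same bounded neighbourhood: almost the whole space. -/
def HasUniformNb (μ : Measure X) (c : G → X → ℝ) : Prop :=
  ∃ (η : ℝ≥0∞) (K : ℕ), 0 < η ∧ ∀ Y, MeasurableSet Y → μ Yᶜ ≤ η → ∀ᵐ x ∂μ, x ∈ nb c Y K

variable [Countable G] [MeasurableConstSMul G X]

theorem tendsto_measure_not_linked [IsFiniteMeasure μ] (hG : IsGeneratingAction R μ G)
    (herg : IsErgodic R μ) (hc : IsLogDeriv μ c) (hY : MeasurableSet Y)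
    (hY0 : μ Y ≠ 0) (g : G) :
    Tendsto (fun n : ℕ => μ {x | Linked c (nb c Y n)ᶜ g x}ᶜ) atTop (𝓝 0) := by
  have hnull : μ (⋂ n : ℕ, {x | Linked c (nb c Y n)ᶜ g x}ᶜ) = 0 := by
    rw [measure_eq_zero_iff_ae_notMem]
    filter_upwards [hG.ae_exists_smul_mem herg hY hY0] with x ⟨k, hk⟩ hx
    obtain ⟨n, hn⟩ := exists_nat_ge (|c k x| + |c g x|)
    exact Set.mem_iInter.1 hx n (hc.linked_compl_nb hk hn)
  rw [← hnull]
  refine tendsto_measure_iInter_atTop (fun n => (hc.measurableSet_linked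
    (hc.measurableSet_nb hY _).compl g).compl.nullMeasurableSet) (fun n m hnm => ?_)
    ⟨0, measure_ne_top _ _⟩
  exact Set.compl_subset_compl.2 fun x => linked_anti <|
    Set.compl_subset_compl.2 (nb_mono subset_rfl (Nat.cast_le.2 hnm))

theorem measure_lt_or_measure_compl_lt [IsProbabilityMeasure μ] {B : Set X} (hB : MeasurableSet B)
    {δ : ℝ≥0∞} (h : μ B * (1 - μ B) < δ * δ) : μ B < δ ∨ μ Bᶜ < δ := by
  rw [← prob_compl_eq_one_sub hB] at h
  by_contra! hcon
  exact h.not_ge (mul_le_mul' hcon.1 hcon.2)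

variable [IsProbabilityMeasure μ]

theorem measure_ne_zero_of_measure_compl_le (hY : MeasurableSet Y) (h : μ Yᶜ ≤ 1 / 2) :
    μ Y ≠ 0 := fun h0 => by
  rw [(prob_compl_eq_one_iff hY).2 h0] at h
  norm_num at h

theorem IsGeneratingAction.hasUniformNb_zero (hG : IsGeneratingAction R μ G)
    (herg : IsErgodic R μ) : HasUniformNb μ fun (_ : G) (_ : X) => (0 : ℝ) := by
  refine ⟨1 / 2, 0, by simp, fun Y hY hY2 => ?_⟩
  filter_upwards [hG.ae_exists_smul_mem herg hY (measure_ne_zero_of_measure_compl_le hY hY2)]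
    with x ⟨g, hg⟩
  exact ⟨g, hg, by simp⟩

variable [StandardBorelSpace X]

theorem exists_linked_dichotomy (hG : IsGeneratingAction R μ G) (herg : IsErgodic R μ)
    (hSE : IsStronglyErgodic R μ) (hc : IsLogDeriv μ c) (hY : MeasurableSet Y)
    (hY0 : μ Y ≠ 0) {δ : ℝ≥0∞} (hδ : 0 < δ) :
    ∃ K : ℕ, 1 ≤ K ∧ ∀ B, LInvariant μ (Linked c (nb c Y K)ᶜ) B → μ B < δ ∨ μ Bᶜ < δ := by
  obtain ⟨F, ε, hε, hF⟩ := hG.exists_finset_of_isStronglyErgodic hSE (ENNReal.mul_pos hδ.ne' hδ.ne')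
  have hlim (g : G) : ∀ᶠ n : ℕ in atTop, μ {x | Linked c (nb c Y n)ᶜ g x}ᶜ ≤ ε :=
    ENNReal.tendsto_nhds_zero.1 (tendsto_measure_not_linked hG herg hc hY hY0 g) ε
      (ENNReal.coe_pos.2 hε)
  obtain ⟨K, hK1, hK⟩ := ((eventually_ge_atTop 1).and
    ((Finset.eventually_all F).2 fun g _ => hlim g)).exists
  refine ⟨K, hK1, fun B hB => measure_lt_or_measure_compl_lt hB.1 (hF B hB.1 fun g hg => ?_)⟩
  refine (measure_mono_ae ?_).trans (hK g hg)
  filter_upwards [hB.2] with x hx hmoved hl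
  exact hmoved (hx g hl)

theorem IsTypeIII.exists_ae_mem_nb_of_ergodic_component (hIII : IsTypeIII R μ)
    (hG : IsGeneratingAction R μ G) (hc : IsLogDeriv μ c) (hY : MeasurableSet Y) {K : ℕ}
    (hK : 1 ≤ K) {E : Set X} (hE : MeasurableSet E) (hEY : μ (E ∩ Y) ≠ 0)
    (hEerg : ∀ B, LInvariant μ (Linked c (nb c Y K)ᶜ) B → μ (E ∩ B) = 0 ∨ μ (E ∩ Bᶜ) = 0) :
    ∃ n : ℕ, ∀ᵐ x ∂μ, x ∈ nb c Y n := by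
  have hK' : (1 : ℝ) ≤ K := Nat.one_le_cast.2 hK
  have hQm : MeasurableSet (E ∩ Y) := hE.inter hY
  have hWm : MeasurableSet (nb c Y K)ᶜ := (hc.measurableSet_nb hY _).compl
  by_cases hW0 : μ (nb c Y K)ᶜ = 0
  · exact ⟨K, hW0⟩
  obtain ⟨n, hn⟩ : ∃ n : ℕ, μ (E ∩ (gapLE c (nb c Y K)ᶜ (E ∩ Y) n)ᶜ) = 0 := by
    by_contra! hne
    have hnull : μ (⋃ n : ℕ, E ∩ gapLE c (nb c Y K)ᶜ (E ∩ Y) n) = 0 := measure_iUnion_null fun n =>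
      (hEerg _ (hc.lInvariant_gapLE hWm hQm n)).resolve_right (hne n)
    refine hEY (measure_eq_zero_iff_ae_notMem.2 ?_)
    filter_upwards [measure_eq_zero_iff_ae_notMem.1 hnull, hIII.ae_not_bddAbove hG hc hWm hW0,
      hIII.ae_not_bddAbove hG hc hQm hEY] with x hx hxW hxQ hxEY
    obtain ⟨n, hn⟩ := hc.exists_mem_gapLE (by linarith) hxEY hxEY.2 (hxW 0) hxQ
    exact hx (Set.mem_iUnion.2 ⟨n, hxEY.1, hn⟩)
  have hgap : ∀ᵐ x ∂μ, x ∈ E ∩ Y → x ∈ gapLE c (nb c Y K)ᶜ (E ∩ Y) n :=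
    (measure_eq_zero_iff_ae_notMem.1 hn).mono fun x hx hxE =>
      by_contra fun hxn => hx ⟨hxE.1, hxn⟩
  refine ⟨max n K, ?_⟩
  filter_upwards [hG.ae_forall_smul hgap, hIII.ae_not_bddBelow hG hc hQm hEY] with x hx hbelow
  by_cases hxK : x ∈ nb c Y K
  · exact nb_mono subset_rfl (by simp) hxK
  · exact nb_mono subset_rfl (by simp)
      (hc.mem_nb_of_smul_mem_gapLE Set.inter_subset_right hK' hx (hbelow 0) hxK)

theorem IsTypeIII.exists_ae_mem_nb (hIII : IsTypeIII R μ) (hG : IsGeneratingAction R μ G)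
    (hSE : IsStronglyErgodic R μ) (hc : IsLogDeriv μ c) (hY : MeasurableSet Y) (hY0 : μ Y ≠ 0) :
    ∃ n : ℕ, ∀ᵐ x ∂μ, x ∈ nb c Y n := by
  have hδ : 3 * (μ Y / 3) ≤ 1 := by
    rw [ENNReal.mul_div_cancel (by simp) (by simp)]
    exact prob_le_one
  obtain ⟨K, hK1, hK⟩ := exists_linked_dichotomy hG hIII.1 hSE hc hY hY0
    (ENNReal.div_pos (b := 3) hY0 (by simp))
  obtain ⟨E, hE, hEY, hEerg⟩ := exists_ergodic_component hδ hK
  refine hIII.exists_ae_mem_nb_of_ergodic_component hG hc hY hK1 hE.1 (fun h0 => ?_) hEerg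
  refine hEY.not_ge ?_
  calc
    μ Y / 3 ≤ μ Y := ENNReal.div_le_of_le_mul <|
      le_mul_of_one_le_right zero_le (by norm_num : (1 : ℝ≥0∞) ≤ 3)
    _ ≤ μ (E ∩ Y) + μ Eᶜ := by
      refine (measure_mono fun x hx => ?_).trans (measure_union_le _ _)
      exact (em (x ∈ E)).imp (fun h => ⟨h, hx⟩) id
    _ = μ Eᶜ := by rw [h0, zero_add]

theorem IsTypeIII.hasUniformNb (hIII : IsTypeIII R μ) (hG : IsGeneratingAction R μ G)
    (hSE : IsStronglyErgodic R μ) (hc : IsLogDeriv μ c) : HasUniformNb μ c := by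
  by_contra hcon
  simp only [HasUniformNb] at hcon
  push Not at hcon
  obtain ⟨η, hη, hsum⟩ := ENNReal.exists_pos_sum_of_countable (ε := 1 / 2) (by simp) ℕ
  choose Y hYm hYη hY using fun n : ℕ => hcon (η n) n (ENNReal.coe_pos.2 (hη n))
  have hinter : μ (⋂ n, Y n)ᶜ ≤ 1 / 2 := by
    rw [Set.compl_iInter]
    exact (measure_iUnion_le _).trans ((ENNReal.tsum_le_tsum hYη).trans hsum.le)
  obtain ⟨n, hn⟩ := hIII.exists_ae_mem_nb hG hSE hc (.iInter hYm)
    (measure_ne_zero_of_measure_compl_le (.iInter hYm) hinter)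
  exact hY n (hn.mono fun x hx => not_not.2 <| nb_mono (Set.iInter_subset _ _) le_rfl hx)

end TypeThree

section Distortion

variable {X : Type*} [MeasurableSpace X] {μ : Measure X} {L : ℝ≥0} {T : X → X}

/-- The restriction of `DistortionLE μ L T` to the subsets of `Q`. -/
def DistortionLEOn (μ : Measure X) (L : ℝ≥0) (T : X → X) (Q : Set X) : Prop :=
  ∀ E ⊆ Q, MeasurableSet E → μ (T ⁻¹' E) ≤ L * μ E

theorem DistortionLEOn.union {A B : Set X} (hA : DistortionLEOn μ L T A)
    (hB : DistortionLEOn μ L T B) (hAm : MeasurableSet A) : DistortionLEOn μ L T (A ∪ B) := by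
  intro E hEQ hE
  calc μ (T ⁻¹' E) = μ (T ⁻¹' (E ∩ A) ∪ T ⁻¹' (E \ A)) := by
        rw [← Set.preimage_union, Set.inter_union_sdiff]
    _ ≤ L * μ (E ∩ A) + L * μ (E \ A) := (measure_union_le _ _).trans <| add_le_add
        (hA _ Set.inter_subset_right (hE.inter hAm))
        (hB _ (Set.sdiff_subset_iff.2 hEQ) (hE.diff hAm))
    _ = L * μ E := by rw [← mul_add, measure_inter_add_sdiff E hAm]

theorem DistortionLEOn.iUnion {Q : ℕ → Set X} (h : ∀ n, DistortionLEOn μ L T (Q n))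
    (hQ : ∀ n, MeasurableSet (Q n)) : DistortionLEOn μ L T (⋃ n, Q n) := by
  intro E hEQ hE
  have hEeq : E = ⋃ n, E ∩ disjointed Q n := by
    rw [← Set.inter_iUnion, iUnion_disjointed, Set.inter_eq_left.2 hEQ]
  have hm (n : ℕ) : MeasurableSet (E ∩ disjointed Q n) := hE.inter (.disjointed hQ n)
  calc μ (T ⁻¹' E) = μ (⋃ n, T ⁻¹' (E ∩ disjointed Q n)) := by rw [← Set.preimage_iUnion, ← hEeq]
    _ ≤ ∑' n, L * μ (E ∩ disjointed Q n) := (measure_iUnion_le _).trans <| ENNReal.tsum_le_tsum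
        fun n => h n _ (Set.inter_subset_right.trans (disjointed_subset Q n)) (hm n)
    _ = L * μ E := by
        rw [ENNReal.tsum_mul_left, ← measure_iUnion _ hm, ← hEeq]
        exact fun i j hij => (disjoint_disjointed Q hij).mono Set.inter_subset_right
          Set.inter_subset_right

end Distortion

section Matching

open scoped Pointwise

variable {X G : Type*} [Group G] [MulAction G X] {g : ℕ → G} {P : ℕ → Set X} {C Y : Set X}
  {c : G → X → ℝ} {K : ℝ≥0}

/-- The involution `θ` implements the matching given by `g` and `P`. -/
structure Implements (θ : X → X) (g : ℕ → G) (P : ℕ → Set X) : Prop where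
  involutive : ∀ x, θ (θ x) = x
  eq_smul : ∀ n, ∀ x ∈ P n, θ x = g n • x
  eq_self : ∀ x ∉ (⋃ n, P n) ∪ ⋃ n, g n • P n, θ x = x

theorem Implements.eq_inv_smul {θ : X → X} (hθ : Implements θ g P) {n : ℕ} {x : X}
    (hx : x ∈ g n • P n) : θ x = (g n)⁻¹ • x := by
  obtain ⟨y, hy, rfl⟩ := hx
  have := hθ.involutive y
  rwa [hθ.eq_smul n y hy, ← inv_smul_smul (g n) y, smul_inv_smul] at this

theorem Implements.exists_eq_smul {θ : X → X} (hθ : Implements θ g P) (x : X) :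
    ∃ k : G, θ x = k • x := by
  by_cases hx : x ∈ (⋃ n, P n) ∪ ⋃ n, g n • P n
  · obtain hx | hx := hx <;> obtain ⟨n, hn⟩ := Set.mem_iUnion.1 hx
    exacts [⟨g n, hθ.eq_smul n x hn⟩, ⟨(g n)⁻¹, hθ.eq_inv_smul hn⟩]
  · exact ⟨1, by rw [hθ.eq_self x hx, one_smul]⟩

/-- The greedy matching of points of `C` with points of `Y` at a distance at most `K`: the pair of
`x` and `g n • x` is added at stage `n` unless one of these points has been matched before. -/
def greedy (g : ℕ → G) (c : G → X → ℝ) (K : ℝ≥0) (C Y : Set X) (n : ℕ) : Set X :=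
  {x | x ∈ C ∧ g n • x ∈ Y ∧ |c (g n) x| ≤ K ∧
    ∀ m < n, x ∉ greedy g c K C Y m ∧ g n • x ∉ g m • greedy g c K C Y m}

theorem mem_greedy {n : ℕ} {x : X} : x ∈ greedy g c K C Y n ↔ x ∈ C ∧ g n • x ∈ Y ∧
    |c (g n) x| ≤ K ∧ ∀ m < n, x ∉ greedy g c K C Y m ∧ g n • x ∉ g m • greedy g c K C Y m := by
  rw [greedy, Set.mem_ofPred_eq]

theorem notMem_of_notMem_greedy {n : ℕ} {x : X} (hxC : x ∈ C)
    (hx : x ∉ ⋃ m, greedy g c K C Y m) (hK : |c (g n) x| ≤ K) :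
    g n • x ∉ Y \ ⋃ m, g m • greedy g c K C Y m := fun h =>
  hx (Set.mem_iUnion.2 ⟨n, mem_greedy.2 ⟨hxC, h.1, hK, fun m _ =>
    ⟨fun hm => hx (Set.mem_iUnion.2 ⟨m, hm⟩), fun hm => h.2 (Set.mem_iUnion.2 ⟨m, hm⟩)⟩⟩⟩)

variable [MeasurableSpace X]

/-- A matching of a part of `C` with a part of `Y`: the points of `P n` are sent by `g n` to
distinct points of `Y`. -/
structure IsMatching (g : ℕ → G) (P : ℕ → Set X) (C Y : Set X) : Prop where
  measurableSet : ∀ n, MeasurableSet (P n)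
  subset : ∀ n, P n ⊆ C
  smul_subset : ∀ n, g n • P n ⊆ Y
  disjoint : Pairwise (Function.onFun Disjoint P)
  disjoint_smul : Pairwise (Function.onFun Disjoint fun n => g n • P n)

theorem IsMatching.exists_implements [StandardBorelSpace X] [MeasurableConstSMul G X]
    (h : IsMatching g P C Y) (hCY : Disjoint C Y) : ∃ θ : X ≃ᵐ X, Implements θ g P := by
  obtain ⟨f, hfm, hf⟩ := exists_measurable_piecewise P h.measurableSet (fun n x => g n • x)
    (fun n => measurable_const_smul (g n)) fun i j hij x hx =>
      absurd hx.2 (Set.disjoint_left.1 (h.disjoint hij) hx.1)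
  have hfP : ∀ n, ∀ x ∈ P n, f x ∈ g n • P n := fun n x hx =>
    (hf n hx).symm ▸ Set.smul_mem_smul_set hx
  have hinj : Set.InjOn f (⋃ n, P n) := by
    intro x hx y hy hxy
    obtain ⟨n, hn⟩ := Set.mem_iUnion.1 hx
    obtain ⟨m, hm⟩ := Set.mem_iUnion.1 hy
    obtain rfl : n = m := by
      by_contra hnm
      exact Set.disjoint_left.1 (h.disjoint_smul hnm) (hfP n x hn) (hxy ▸ hfP m y hm)
    rw [hf n hn, hf n hm] at hxy
    exact smul_left_cancel _ hxy
  obtain ⟨θ, hinv, hθf, hcases⟩ := exists_involution hfm (.iUnion h.measurableSet) hinj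
    fun x hx hfx => by
      obtain ⟨n, hn⟩ := Set.mem_iUnion.1 hx
      exact Set.disjoint_left.1 hCY (Set.iUnion_subset h.subset hfx)
        (h.smul_subset n (hfP n x hn))
  refine ⟨θ, hinv, fun n x hx => (hθf x (Set.mem_iUnion.2 ⟨n, hx⟩)).trans (hf n hx),
    fun x hx => ?_⟩
  obtain hx' | ⟨hx', -⟩ | ⟨hx', hfx⟩ := hcases x
  · exact hx'
  · exact absurd (.inl hx') hx
  · obtain ⟨n, hn⟩ := Set.mem_iUnion.1 hx'
    exact absurd (.inr (Set.mem_iUnion.2 ⟨n, hfx ▸ hfP n _ hn⟩)) hx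

variable [MeasurableConstSMul G X] {μ : Measure X}

theorem IsLogDeriv.measure_smul_le (hc : IsLogDeriv μ c) {k : G} {E : Set X}
    (hE : MeasurableSet E) (hK : ∀ x ∈ E, |c k x| ≤ K) :
    μ (k • E) ≤ (Real.exp K).toNNReal * μ E := by
  rw [← Set.preimage_smul_inv]
  exact hc.measure_preimage_inv_le hE fun x hx => (abs_le.1 (hK x hx)).2

theorem IsMatching.distortionLE (h : IsMatching g P C Y) (hc : IsLogDeriv μ c)
    (hK : ∀ n, ∀ x ∈ P n, |c (g n) x| ≤ K) {θ : X → X} (hθ : Implements θ g P) :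
    DistortionLE μ (Real.exp K).toNNReal θ := by
  have hDm (n : ℕ) : MeasurableSet (g n • P n) := (h.measurableSet n).const_smul (g n)
  have hP (n : ℕ) : DistortionLEOn μ (Real.exp K).toNNReal θ (P n) := fun E hEP hE =>
    (measure_mono fun x (hx : θ x ∈ E) => Set.mem_smul_set.2
      ⟨θ x, hx, by rw [← hθ.eq_smul n _ (hEP hx), hθ.involutive]⟩).trans
      (hc.measure_smul_le hE fun x hx => hK n x (hEP hx))
  have hD (n : ℕ) : DistortionLEOn μ (Real.exp K).toNNReal θ (g n • P n) := fun E hED hE => by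
    have hsub : θ ⁻¹' E ⊆ (g n • · : X → X) ⁻¹' E := fun x (hx : θ x ∈ E) => by
      have := hθ.eq_inv_smul (hED hx)
      rw [hθ.involutive] at this
      rwa [Set.mem_preimage, this, smul_inv_smul]
    refine (measure_mono hsub).trans (hc.measure_preimage_le hE fun x hx => ?_)
    exact neg_le.1 (abs_le.1 (hK n x (Set.smul_mem_smul_set_iff.1 (hED hx)))).1
  have hrest : DistortionLEOn μ (Real.exp K).toNNReal θ ((⋃ n, P n) ∪ ⋃ n, g n • P n)ᶜ :=
    fun E hEQ _ => by
      have hsub : θ ⁻¹' E ⊆ E := fun x (hx : θ x ∈ E) => by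
        have := hθ.eq_self _ (hEQ hx)
        rw [hθ.involutive] at this
        rwa [this]
      refine (measure_mono hsub).trans (le_mul_of_one_le_left zero_le ?_)
      exact_mod_cast Real.one_le_toNNReal.2 (Real.one_le_exp K.2)
  have hall := ((DistortionLEOn.iUnion hP h.measurableSet).union (.iUnion hD hDm)
    (.iUnion h.measurableSet)).union hrest ((MeasurableSet.iUnion h.measurableSet).union
    (.iUnion hDm))
  rw [Set.union_compl_self] at hall
  exact fun E hE => hall E (Set.subset_univ E) hE

theorem IsMatching.measure_iUnion_smul_le (h : IsMatching g P C Y) (hc : IsLogDeriv μ c)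
    (hK : ∀ n, ∀ x ∈ P n, |c (g n) x| ≤ K) :
    μ (⋃ n, g n • P n) ≤ (Real.exp K).toNNReal * μ C :=
  calc μ (⋃ n, g n • P n) ≤ ∑' n, (Real.exp K).toNNReal * μ (P n) :=
        (measure_iUnion_le _).trans <| ENNReal.tsum_le_tsum fun n =>
          hc.measure_smul_le (h.measurableSet n) (hK n)
    _ = (Real.exp K).toNNReal * μ (⋃ n, P n) := by
        rw [ENNReal.tsum_mul_left, measure_iUnion h.disjoint h.measurableSet]
    _ ≤ (Real.exp K).toNNReal * μ C := by
        gcongr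
        exact Set.iUnion_subset h.subset

theorem measurableSet_greedy (hc : ∀ k, Measurable (c k)) (hC : MeasurableSet C)
    (hY : MeasurableSet Y) (n : ℕ) : MeasurableSet (greedy g c K C Y n) := by
  induction n using Nat.strong_induction_on with
  | h n ih =>
    have hnew : MeasurableSet {x | ∀ m < n, x ∉ greedy g c K C Y m ∧
        g n • x ∉ g m • greedy g c K C Y m} := by
      simp only [Set.ofPred_forall]
      exact .iInter fun m => .iInter fun hm => (ih m hm).compl.inter
        (measurable_const_smul (g n) ((ih m hm).const_smul (g m)).compl)
    rw [greedy]
    exact hC.inter (.inter (measurable_const_smul (g n) hY) (.inter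
      (measurableSet_le (hc _).abs measurable_const) hnew))

theorem isMatching_greedy (hc : ∀ k, Measurable (c k)) (hC : MeasurableSet C)
    (hY : MeasurableSet Y) : IsMatching g (greedy g c K C Y) C Y where
  measurableSet := measurableSet_greedy hc hC hY
  subset n x hx := (mem_greedy.1 hx).1
  smul_subset n := by
    rintro _ ⟨x, hx, rfl⟩
    exact (mem_greedy.1 hx).2.1
  disjoint := (pairwise_disjoint_on _).2 fun m n hmn => Set.disjoint_right.2 fun x hx =>
    ((mem_greedy.1 hx).2.2.2 m hmn).1
  disjoint_smul := (pairwise_disjoint_on _).2 fun m n hmn => Set.disjoint_right.2 <| by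
    rintro _ ⟨x, hx, rfl⟩
    exact ((mem_greedy.1 hx).2.2.2 m hmn).2

end Matching

section Packing

open scoped Pointwise

variable {X : Type*} [MeasurableSpace X] [StandardBorelSpace X] {G : Type*} [Group G]
  [MulAction G X] [Countable G] [MeasurableConstSMul G X] {R : Setoid X} {μ : Measure X}
  {c : G → X → ℝ} {η : ℝ≥0∞} {K : ℕ} {C : Set X}

theorem IsGeneratingAction.exists_involution_into (hG : IsGeneratingAction R μ G)
    (hc : IsLogDeriv μ c) (hη : ∀ Y, MeasurableSet Y → μ Yᶜ ≤ η → ∀ᵐ x ∂μ, x ∈ nb c Y K)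
    {Y : Set X} (hC : MeasurableSet C) (hY : MeasurableSet Y) (hCY : Disjoint C Y)
    (hsmall : μ Yᶜ + (Real.exp K).toNNReal * μ C ≤ η) :
    ∃ θ : X ≃ᵐ X, (∀ x, θ (θ x) = x) ∧ (∀ x, R x (θ x)) ∧
      DistortionLE μ (Real.exp K).toNNReal θ ∧ ∀ᵐ x ∂μ, x ∈ C → θ x ∈ Y := by
  obtain ⟨g, hg⟩ := exists_surjective_nat G
  let P : ℕ → Set X := greedy g c K C Y
  have hP : IsMatching g P C Y := isMatching_greedy hc.measurable hC hY
  have hK : ∀ n, ∀ x ∈ P n, |c (g n) x| ≤ (K : ℝ≥0) := fun n x hx => (mem_greedy.1 hx).2.2.1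
  obtain ⟨θ, hθ⟩ := hP.exists_implements hCY
  refine ⟨θ, hθ.involutive, fun x => ?_, by simpa using hP.distortionLE hc hK hθ, ?_⟩
  · obtain ⟨k, hk⟩ := hθ.exists_eq_smul x
    exact hk ▸ hG.rel k x
  have hDm : MeasurableSet (⋃ n, g n • P n) :=
    .iUnion fun n => (hP.measurableSet n).const_smul (g n)
  have hsmall' : μ (Y \ ⋃ n, g n • P n)ᶜ ≤ η := by
    rw [Set.sdiff_eq, Set.compl_inter, compl_compl]
    refine ((measure_union_le _ _).trans ?_).trans hsmall
    gcongr
    simpa using hP.measure_iUnion_smul_le hc hK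
  filter_upwards [hη _ (hY.diff hDm) hsmall'] with x ⟨k, hkY, hkK⟩ hxC
  obtain ⟨n, rfl⟩ := hg k
  have hx : x ∈ ⋃ m, P m := by
    by_contra hx
    exact notMem_of_notMem_greedy hxC hx (by simpa using hkK) hkY
  obtain ⟨m, hm⟩ := Set.mem_iUnion.1 hx
  exact hθ.eq_smul m x hm ▸ hP.smul_subset m (Set.smul_mem_smul_set hm)

theorem IsGeneratingAction.exists_disjoint_copies (hG : IsGeneratingAction R μ G)
    (hR : IsCountableNonsingular R μ) (hc : IsLogDeriv μ c)
    (hη : ∀ Y, MeasurableSet Y → μ Yᶜ ≤ η → ∀ᵐ x ∂μ, x ∈ nb c Y K) (hC : MeasurableSet C) (N : ℕ)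
    (hsmall : (1 + N * (Real.exp K).toNNReal) * μ C ≤ η) :
    ∃ θ : ℕ → X ≃ᵐ X, (∀ i < N, (∀ x, θ i (θ i x) = x) ∧ (∀ x, R x (θ i x)) ∧
      DistortionLE μ (Real.exp K).toNNReal (θ i)) ∧
      ∀ j < N, ∀ i < j, ∀ᵐ x ∂μ, ¬ (θ i x ∈ C ∧ θ j x ∈ C) := by
  induction N with
  | zero => exact ⟨fun _ => MeasurableEquiv.refl X, by simp, by simp⟩
  | succ N ih =>
    set L := (Real.exp K).toNNReal
    obtain ⟨θ, hθ, hdisj⟩ := ih (hsmall.trans' (by gcongr; simp))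
    let V : Set X := C ∪ ⋃ i ∈ Finset.range N, θ i ⁻¹' C
    have hV : MeasurableSet V :=
      hC.union (Finset.measurableSet_biUnion _ fun i _ => (θ i).measurable hC)
    have hcopies : μ (⋃ i ∈ Finset.range N, θ i ⁻¹' C) ≤ N * L * μ C :=
      calc _ ≤ ∑ i ∈ Finset.range N, μ (θ i ⁻¹' C) := measure_biUnion_finset_le _ _
        _ ≤ ∑ _i ∈ Finset.range N, L * μ C :=
          Finset.sum_le_sum fun i hi => (hθ i (Finset.mem_range.1 hi)).2.2 C hC
        _ = N * L * μ C := by simp [mul_assoc]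
    have hVsmall : μ Vᶜᶜ + L * μ C ≤ η := by
      refine hsmall.trans' ?_
      calc μ Vᶜᶜ + L * μ C ≤ μ C + N * L * μ C + L * μ C := by
            rw [compl_compl]
            gcongr
            exact (measure_union_le _ _).trans (by gcongr)
        _ = (1 + (N + 1 : ℕ) * L) * μ C := by push_cast; ring
    obtain ⟨τ, hτ, hτR, hτL, hτV⟩ := hG.exists_involution_into hc hη hC hV.compl
      (Set.disjoint_compl_right_iff_subset.2 Set.subset_union_left) hVsmall
    refine ⟨Function.update θ N τ, fun i hi => ?_, fun j hj i hij => ?_⟩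
    · obtain rfl | hiN := eq_or_ne i N
      · simpa using ⟨hτ, hτR, hτL⟩
      · simpa [hiN] using hθ i (by omega)
    have hiN : i ≠ N := by omega
    obtain rfl | hjN := eq_or_ne j N
    · simp only [Function.update_self, Function.update_of_ne hiN]
      filter_upwards [(hR.quasiMeasurePreserving τ.measurable hτR).ae hτV] with x hx h
      have hxV : x ∉ V := hτ x ▸ hx h.2
      exact hxV (.inr (Set.mem_biUnion (Finset.mem_range.2 hij) h.1))
    · simpa [hjN, hiN] using hdisj j (by omega) i hij

end Packing

section Mean

variable {X : Type*} [MeasurableSpace X] {R : Setoid X} {μ : Measure X}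

/-- The automorphisms of bounded distortion whose graph is contained in `R`. -/
def boundedGroup (R : Setoid X) (μ : Measure X) : Set (X ≃ᵐ X) :=
  {θ | (∀ x, R x (θ x)) ∧ ∃ K : ℝ≥0, DistortionLE μ K θ ∧ DistortionLE μ K θ.symm}

theorem mem_boundedGroup_of_involution {θ : X ≃ᵐ X} (h : ∀ x, θ (θ x) = x)
    (hRθ : ∀ x, R x (θ x)) {K : ℝ≥0} (hd : DistortionLE μ K θ) : θ ∈ boundedGroup R μ := by
  have hsymm : θ.symm = θ := MeasurableEquiv.ext <| funext fun x => by
    rw [MeasurableEquiv.symm_apply_eq, h]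
  exact ⟨hRθ, K, hd, by rwa [hsymm]⟩

theorem IsGeneratingAction.smul_mem_boundedGroup {G : Type*} [Group G] [MulAction G X]
    [MeasurableConstSMul G X] (hG : IsGeneratingAction R μ G) (g : G) :
    MeasurableEquiv.smul g ∈ boundedGroup R μ := by
  obtain ⟨K, hK⟩ := hG.bounded g
  obtain ⟨L, hL⟩ := hG.bounded g⁻¹
  refine ⟨fun x => hG.rel g x, max K L, fun E hE => ?_, fun E hE => ?_⟩
  · exact (hK E hE).trans (by gcongr; exact le_max_left _ _)
  · exact (hL E hE).trans (by gcongr; exact le_max_right _ _)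

/-- A finitely additive probability, vanishing on the null sets, that the bounded automorphisms
distort at most as much as they distort `μ`. -/
structure IsEquivariantMean (R : Setoid X) (μ : Measure X) (φ : Set X → ℝ) : Prop where
  nonneg : ∀ C, 0 ≤ φ C
  univ : φ Set.univ = 1
  union : ∀ C D, MeasurableSet C → MeasurableSet D → Disjoint C D → φ (C ∪ D) = φ C + φ D
  null : ∀ C, μ C = 0 → φ C = 0
  transport : ∀ T ∈ boundedGroup R μ, ∀ C, MeasurableSet C → ∀ L : ℝ≥0, DistortionLEOn μ L T C →
    φ (T ⁻¹' C) ≤ L * φ C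

namespace IsEquivariantMean

variable {φ : Set X → ℝ} {C D : Set X}

theorem inter_add_sdiff (hφ : IsEquivariantMean R μ φ) (hC : MeasurableSet C)
    (hD : MeasurableSet D) : φ (C ∩ D) + φ (C \ D) = φ C := by
  rw [← hφ.union _ _ (hC.inter hD) (hC.diff hD) Set.disjoint_sdiff_inter.symm,
    Set.inter_union_sdiff]

theorem le_one (hφ : IsEquivariantMean R μ φ) (hC : MeasurableSet C) : φ C ≤ 1 := by
  have h := hφ.inter_add_sdiff .univ hC
  rw [Set.univ_inter, hφ.univ] at h
  linarith [hφ.nonneg (Set.univ \ C)]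

theorem union_of_aedisjoint (hφ : IsEquivariantMean R μ φ) (hC : MeasurableSet C)
    (hD : MeasurableSet D) (h : AEDisjoint μ C D) : φ (C ∪ D) = φ C + φ D := by
  rw [← Set.union_sdiff_self, hφ.union _ _ hC (hD.diff hC) Set.disjoint_sdiff_right,
    ← hφ.inter_add_sdiff hD hC, Set.inter_comm, hφ.null _ h, zero_add]

theorem biUnion_range (hφ : IsEquivariantMean R μ φ) {C : ℕ → Set X}
    (hC : ∀ i, MeasurableSet (C i)) (N : ℕ) (hd : ∀ j < N, ∀ i < j, AEDisjoint μ (C i) (C j)) :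
    φ (⋃ i ∈ Finset.range N, C i) = ∑ i ∈ Finset.range N, φ (C i) := by
  induction N with
  | zero => simp [hφ.null ∅ measure_empty]
  | succ N ih =>
    have hdisj : AEDisjoint μ (C N) (⋃ i ∈ Finset.range N, C i) := by
      simp only [Finset.mem_range, AEDisjoint.iUnion_right_iff]
      exact fun i hi => (hd N N.lt_succ_self i hi).symm
    rw [Finset.range_add_one, Finset.set_biUnion_insert, Finset.sum_insert Finset.notMem_range_self,
      hφ.union_of_aedisjoint (hC N) (Finset.measurableSet_biUnion _ fun i _ => hC i) hdisj,
      ih fun j hj => hd j (hj.trans N.lt_succ_self)]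

theorem nat_mul_le_of_disjoint_copies (hφ : IsEquivariantMean R μ φ) (hC : MeasurableSet C)
    {L : ℝ≥0} {N : ℕ} {θ : ℕ → X ≃ᵐ X}
    (hθ : ∀ i < N, (∀ x, θ i (θ i x) = x) ∧ (∀ x, R x (θ i x)) ∧ DistortionLE μ L (θ i))
    (hd : ∀ j < N, ∀ i < j, ∀ᵐ x ∂μ, ¬ (θ i x ∈ C ∧ θ j x ∈ C)) : N * φ C ≤ L := by
  have hm (i : ℕ) : MeasurableSet (θ i ⁻¹' C) := (θ i).measurable hC
  have hcopy : ∀ i < N, φ C ≤ L * φ (θ i ⁻¹' C) := by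
    intro i hi
    obtain ⟨hinv, hrel, hdist⟩ := hθ i hi
    have h := hφ.transport (θ i) (mem_boundedGroup_of_involution hinv hrel hdist) _ (hm i) L
      fun E _ hE => hdist E hE
    rwa [← Set.preimage_comp, show (θ i : X → X) ∘ θ i = id from funext hinv,
      Set.preimage_id] at h
  calc N * φ C = ∑ _i ∈ Finset.range N, φ C := by
        rw [Finset.sum_const, Finset.card_range, nsmul_eq_mul]
    _ ≤ ∑ i ∈ Finset.range N, L * φ (θ i ⁻¹' C) :=
        Finset.sum_le_sum fun i hi => hcopy i (Finset.mem_range.1 hi)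
    _ = L * φ (⋃ i ∈ Finset.range N, θ i ⁻¹' C) := by
        rw [← Finset.mul_sum, hφ.biUnion_range hm N fun j hj i hij =>
          measure_eq_zero_iff_ae_notMem.2 (hd j hj i hij)]
    _ ≤ L := mul_le_of_le_one_right L.2 <|
        hφ.le_one (Finset.measurableSet_biUnion _ fun i _ => hm i)

theorem exists_forall_le [StandardBorelSpace X] {G : Type*} [Group G] [MulAction G X] [Countable G]
    [MeasurableConstSMul G X] {c : G → X → ℝ} (hφ : IsEquivariantMean R μ φ)
    (hG : IsGeneratingAction R μ G) (hR : IsCountableNonsingular R μ) (hc : IsLogDeriv μ c)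
    (hnb : HasUniformNb μ c) {ε : ℝ} (hε : 0 < ε) :
    ∃ δ : ℝ≥0∞, 0 < δ ∧ ∀ C, MeasurableSet C → μ C ≤ δ → φ C ≤ ε := by
  obtain ⟨η, K, hη0, hη⟩ := hnb
  set L := (Real.exp K).toNNReal
  obtain ⟨N, hN⟩ := exists_nat_gt (L / ε)
  refine ⟨η / (1 + N * L), ENNReal.div_pos hη0.ne' (by finiteness), fun C hC hCη => ?_⟩
  obtain ⟨θ, hθ, hd⟩ := hG.exists_disjoint_copies hR hc hη hC N <|
    (mul_le_mul_right hCη _).trans ENNReal.mul_div_le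
  have hNφ : N * φ C ≤ N * ε :=
    (hφ.nat_mul_le_of_disjoint_copies hC hθ hd).trans ((div_lt_iff₀ hε).1 hN).le
  exact le_of_mul_le_mul_left hNφ (lt_of_le_of_lt (by positivity) hN)

theorem exists_measure [IsFiniteMeasure μ] (hφ : IsEquivariantMean R μ φ)
    (hac : ∀ ε : ℝ, 0 < ε → ∃ δ : ℝ≥0∞, 0 < δ ∧ ∀ C, MeasurableSet C → μ C ≤ δ → φ C ≤ ε) :
    ∃ ν : Measure X, ∀ C, MeasurableSet C → ν C = ENNReal.ofReal (φ C) := by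
  have hring : IsSetRing {C : Set X | MeasurableSet C} :=
    ⟨.empty, fun _ _ hC hD => hC.union hD, fun _ _ hC hD => hC.diff hD⟩
  let m : AddContent ℝ≥0∞ {C : Set X | MeasurableSet C} := hring.addContent_of_union
    (fun C => ENNReal.ofReal (φ C)) (by rw [hφ.null ∅ measure_empty, ENNReal.ofReal_zero])
    fun hC hD hCD => by
      rw [hφ.union _ _ hC hD hCD, ENNReal.ofReal_add (hφ.nonneg _) (hφ.nonneg _)]
  have htendsto ⦃s : ℕ → Set X⦄ (hs : ∀ n, MeasurableSet (s n)) (hanti : Antitone s)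
      (hs0 : ⋂ n, s n = ∅) : Tendsto (fun n => m (s n)) atTop (𝓝 0) := by
    have hμ : Tendsto (fun n => μ (s n)) atTop (𝓝 0) := by
      rw [← measure_empty (μ := μ), ← hs0]
      exact tendsto_measure_iInter_atTop (fun n => (hs n).nullMeasurableSet) hanti
        ⟨0, measure_ne_top _ _⟩
    have hφs : Tendsto (fun n => φ (s n)) atTop (𝓝 0) := by
      refine tendsto_order.2 ⟨fun a ha => .of_forall fun n => ha.trans_le (hφ.nonneg _),
        fun ε hε => ?_⟩
      obtain ⟨δ, hδ, hδφ⟩ := hac (ε / 2) (half_pos hε)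
      filter_upwards [ENNReal.tendsto_nhds_zero.1 hμ δ hδ] with n hn
      exact (hδφ _ (hs n) hn).trans_lt (half_lt_self hε)
    exact (ENNReal.tendsto_ofReal hφs).trans_eq (congrArg 𝓝 ENNReal.ofReal_zero)
  refine ⟨Measure.ofMeasurable (fun C _ => m C) addContent_empty fun f hf hd => ?_,
    fun C hC => Measure.ofMeasurable_apply C hC⟩
  exact addContent_iUnion_eq_sum_of_tendsto_zero hring m (fun C _ => ENNReal.ofReal_ne_top)
    htendsto hf (MeasurableSet.iUnion hf) hd

end IsEquivariantMean

end Mean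

section Uniqueness

variable {X : Type*} [MeasurableSpace X] {G : Type*} [Group G] [MulAction G X]
  [MeasurableConstSMul G X] {R : Setoid X} {μ ν : Measure X} {c : G → X → ℝ}

/-- `ν` is transported by the action of `G` at most as badly as `μ`, on each measurable set. -/
def IsDistortionDominated (G : Type*) [Group G] [MulAction G X] (μ ν : Measure X) : Prop :=
  ∀ (g : G) (C : Set X) (L : ℝ≥0), MeasurableSet C → DistortionLEOn μ L (g • · : X → X) C →
    ν ((g • · : X → X) ⁻¹' C) ≤ L * ν C

theorem IsLogDeriv.measure_eq_zero_of_oscillation_lt [IsFiniteMeasure ν] (hc : IsLogDeriv μ c)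
    (hν : IsDistortionDominated G μ ν) {g : G} {C : Set X} (hC : MeasurableSet C) {a b κ : ℝ}
    (hκ : b - a < κ) (hca : ∀ x ∈ C, a ≤ c g x) (hcb : ∀ x ∈ C, c g x ≤ b)
    (hlow : ν C ≤ ENNReal.ofReal (Real.exp (-κ)) * μ C)
    (hhigh : μ ((g⁻¹ • · : X → X) ⁻¹' C) ≤ ν ((g⁻¹ • · : X → X) ⁻¹' C)) : μ C = 0 := by
  set D : Set X := (g⁻¹ • · : X → X) ⁻¹' C with hD
  have hDC : (g • · : X → X) ⁻¹' D = C := by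
    rw [hD, ← Set.preimage_comp]
    exact (congrArg (· ⁻¹' C) (funext (inv_smul_smul g))).trans Set.preimage_id
  have hμCD : μ C ≤ ENNReal.ofReal (Real.exp (-a)) * μ D := by
    rw [← hDC]
    refine hc.measure_preimage_le (measurable_const_smul g⁻¹ hC) fun x hx => ?_
    exact neg_le_neg (hca x (hDC ▸ hx))
  have hνDC : ν D ≤ ENNReal.ofReal (Real.exp b) * ν C :=
    hν g⁻¹ C _ hC fun E hEC hE => hc.measure_preimage_inv_le hE fun x hx => hcb x (hEC hx)
  have hνD : ν D ≤ ENNReal.ofReal (Real.exp (b - κ - a)) * ν D := by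
    calc ν D ≤ ENNReal.ofReal (Real.exp b) * (ENNReal.ofReal (Real.exp (-κ)) *
          (ENNReal.ofReal (Real.exp (-a)) * ν D)) := hνDC.trans <| by
          gcongr
          exact hlow.trans <| by gcongr; exact hμCD.trans <| by gcongr
      _ = ENNReal.ofReal (Real.exp (b - κ - a)) * ν D := by
          rw [← mul_assoc, ← mul_assoc, ← ENNReal.ofReal_mul (Real.exp_pos _).le,
            ← ENNReal.ofReal_mul (by positivity), ← Real.exp_add, ← Real.exp_add, sub_eq_add_neg,
            sub_eq_add_neg]
  have hνD0 : ν D = 0 := by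
    by_contra hne
    have hlt : ENNReal.ofReal (Real.exp (b - κ - a)) < 1 :=
      ENNReal.ofReal_lt_one.2 (Real.exp_lt_one_iff.2 (by linarith))
    exact hνD.not_gt ((ENNReal.mul_lt_mul_left hne (measure_ne_top ν D) hlt).trans_eq (one_mul _))
  simpa [nonpos_iff_eq_zero.1 (hhigh.trans hνD0.le)] using hμCD

variable [IsProbabilityMeasure μ] [IsProbabilityMeasure ν]

theorem measure_rnDeriv_le_exp_eq_zero_or [Countable G] (hG : IsGeneratingAction R μ G)
    (herg : IsErgodic R μ) (hc : IsLogDeriv μ c) (hac : ν ≪ μ)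
    (hν : IsDistortionDominated G μ ν) {κ : ℝ} (hκ : 0 < κ) :
    μ {x | ν.rnDeriv μ x ≤ ENNReal.ofReal (Real.exp (-κ))} = 0 ∨ μ {x | 1 < ν.rnDeriv μ x} = 0 := by
  set h := ν.rnDeriv μ
  have hm : Measurable h := Measure.measurable_rnDeriv _ _
  have hset (C : Set X) : ∫⁻ x in C, h x ∂μ = ν C := Measure.setLIntegral_rnDeriv hac C
  have hlm : MeasurableSet {x | h x ≤ ENNReal.ofReal (Real.exp (-κ))} :=
    measurableSet_le hm measurable_const
  have hhm : MeasurableSet {x | 1 < h x} := measurableSet_lt measurable_const hm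
  by_contra! hne
  obtain ⟨g, hg⟩ := hG.exists_smul_inter herg hhm hne.1 hne.2
  /- If the cocycle were constant on a set `C` of points of low density which `g` maps to points of
  high density, then `g` would distort `μ` and `ν` by incompatible factors; so cut the cocycle into
  slabs of height `κ / 2`. -/
  let C : ℤ → Set X := fun j => {x | (h x ≤ ENNReal.ofReal (Real.exp (-κ)) ∧ 1 < h (g • x)) ∧
    (j * (κ / 2) ≤ c g x ∧ c g x ≤ (j + 1) * (κ / 2))}
  have hCm (j : ℤ) : MeasurableSet (C j) :=
    (hlm.inter (measurable_const_smul g hhm)).inter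
      ((measurableSet_le measurable_const (hc.measurable g)).inter
        (measurableSet_le (hc.measurable g) measurable_const))
  have hcover : {x | h x ≤ ENNReal.ofReal (Real.exp (-κ)) ∧ 1 < h (g • x)} ⊆ ⋃ j, C j :=
    fun x hx => Set.mem_iUnion.2 ⟨⌊c g x / (κ / 2)⌋, hx,
      (le_div_iff₀ (half_pos hκ)).1 (Int.floor_le _),
      (div_le_iff₀ (half_pos hκ)).1 (Int.lt_floor_add_one _).le⟩
  refine hg (measure_mono_null hcover (measure_iUnion_null fun j => ?_))
  refine hc.measure_eq_zero_of_oscillation_lt hν (hCm j) (κ := κ) (by linarith)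
    (fun x hx => hx.2.1) (fun x hx => hx.2.2) ?_ ?_
  · rw [← hset, ← setLIntegral_const]
    exact setLIntegral_mono measurable_const fun x hx => hx.1.1
  · rw [← hset, ← setLIntegral_one]
    refine setLIntegral_mono hm fun x hx => ?_
    have hgx : 1 < h (g • (g⁻¹ • x)) := hx.1.2
    exact (smul_inv_smul g x ▸ hgx).le

theorem IsDistortionDominated.eq [Countable G] (hν : IsDistortionDominated G μ ν)
    (hG : IsGeneratingAction R μ G) (herg : IsErgodic R μ) (hc : IsLogDeriv μ c) (hac : ν ≪ μ) :
    ν = μ := by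
  have hdensity : μ.withDensity (ν.rnDeriv μ) = ν := Measure.withDensity_rnDeriv_eq ν μ hac
  by_cases hhigh : μ {x | 1 < ν.rnDeriv μ x} = 0
  · refine Measure.eq_of_le_of_measure_univ_eq ?_ (by simp)
    calc ν = μ.withDensity (ν.rnDeriv μ) := hdensity.symm
      _ ≤ μ.withDensity 1 := withDensity_mono <|
          (measure_eq_zero_iff_ae_notMem.1 hhigh).mono fun x hx => not_lt.1 hx
      _ = μ := withDensity_one
  · refine (Measure.eq_of_le_of_measure_univ_eq ?_ (by simp)).symm
    have hexp (n : ℕ) :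
        ∀ᵐ x ∂μ, ¬ ν.rnDeriv μ x ≤ ENNReal.ofReal (Real.exp (-(1 / ((n : ℝ) + 1)))) :=
      measure_eq_zero_iff_ae_notMem.1 <|
        (measure_rnDeriv_le_exp_eq_zero_or hG herg hc hac hν (by positivity)).resolve_right hhigh
    have hge : ∀ᵐ x ∂μ, 1 ≤ ν.rnDeriv μ x := by
      filter_upwards [ae_all_iff.2 hexp] with x hx
      have hlim : Tendsto (fun n : ℕ => ENNReal.ofReal (Real.exp (-(1 / ((n : ℝ) + 1))))) atTop
          (𝓝 (ENNReal.ofReal (Real.exp (-0)))) :=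
        ENNReal.tendsto_ofReal ((Real.continuous_exp.tendsto _).comp
          tendsto_one_div_add_atTop_nhds_zero_nat.neg)
      rw [neg_zero, Real.exp_zero, ENNReal.ofReal_one] at hlim
      exact le_of_tendsto' hlim fun n => (not_le.1 (hx n)).le
    calc μ = μ.withDensity 1 := withDensity_one.symm
      _ ≤ μ.withDensity (ν.rnDeriv μ) := withDensity_mono hge
      _ = ν := hdensity

end Uniqueness

section Equidistribution

/-- The sets `D` and `B` are nearly independent for `μ`, relative to the size of `B`. -/
def NearlyIndep {X : Type*} [MeasurableSpace X] (μ : Measure X) (δ : ℝ) (D B : Set X) : Prop :=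
  |μ.real (D ∩ B) - μ.real D * μ.real B| ≤ δ * μ.real B

open ProbabilityTheory (cond cond_apply cond_absolutelyContinuous cond_isProbabilityMeasure)

variable {X : Type*} [MeasurableSpace X] {R : Setoid X} {μ : Measure X}

theorem real_cond (μ : Measure X) {B : Set X} (hB : MeasurableSet B) (C : Set X) :
    (cond μ B).real C = μ.real (B ∩ C) / μ.real B := by
  rw [measureReal_def, cond_apply hB, ENNReal.toReal_mul, ENNReal.toReal_inv, div_eq_inv_mul]
  rfl

theorem real_cond_preimage_le [IsFiniteMeasure μ] {T : X → X} {B C : Set X} (hB : MeasurableSet B)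
    (hC : MeasurableSet C) {L : ℝ≥0} (hTC : DistortionLEOn μ L T C) :
    (cond μ B).real (T ⁻¹' C) ≤ L * (cond μ B).real C + μ.real (moved T B) / μ.real B := by
  have hsub : B ∩ T ⁻¹' C ⊆ T ⁻¹' (B ∩ C) ∪ moved T B := by
    intro x hx
    by_cases h : T x ∈ B
    · exact Or.inl ⟨h, hx.2⟩
    · exact Or.inr fun hiff => h (hiff.2 hx.1)
  have hL : μ.real (T ⁻¹' (B ∩ C)) ≤ L * μ.real (B ∩ C) :=
    ENNReal.toReal_le_of_le_ofReal (by positivity) <| by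
      rw [ENNReal.ofReal_mul L.coe_nonneg, ENNReal.ofReal_coe_nnreal, ofReal_measureReal]
      exact hTC _ Set.inter_subset_right (hB.inter hC)
  rw [real_cond μ hB, real_cond μ hB, ← mul_div_assoc, ← add_div]
  gcongr
  calc μ.real (B ∩ T ⁻¹' C) ≤ μ.real (T ⁻¹' (B ∩ C)) + μ.real (moved T B) :=
        (measureReal_mono hsub).trans (measureReal_union_le _ _)
    _ ≤ L * μ.real (B ∩ C) + μ.real (moved T B) := by gcongr

variable {I : Type*} {l : Filter I} {B : I → Set X}

theorem isEquivariantMean_of_tendsto [IsFiniteMeasure μ] [NeBot l]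
    (hB : ∀ i, MeasurableSet (B i)) (hB0 : ∀ i, μ (B i) ≠ 0)
    (hinv : ∀ T ∈ boundedGroup R μ,
      Tendsto (fun i => μ.real (moved T (B i)) / μ.real (B i)) l (𝓝 0))
    {φ : Set X → ℝ} (hφ : ∀ C, Tendsto (fun i => (cond μ (B i)).real C) l (𝓝 (φ C))) :
    IsEquivariantMean R μ φ where
  nonneg C := ge_of_tendsto' (hφ C) fun _ => measureReal_nonneg
  univ := tendsto_nhds_unique (hφ Set.univ) <| tendsto_const_nhds.congr fun i =>
    have := cond_isProbabilityMeasure (hB0 i)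
    probReal_univ.symm
  union C D _ hD hCD := tendsto_nhds_unique (hφ (C ∪ D)) <| ((hφ C).add (hφ D)).congr fun i =>
    (measureReal_union hCD hD).symm
  null C hC := tendsto_nhds_unique (hφ C) <| tendsto_const_nhds.congr fun i => by
    rw [measureReal_def, cond_absolutelyContinuous hC, ENNReal.toReal_zero]
  transport T hT C hC L hTC := by
    have h := ((hφ C).const_mul (L : ℝ)).add (hinv T hT)
    rw [add_zero] at h
    exact le_of_tendsto_of_tendsto' (hφ _) h fun i => real_cond_preimage_le (hB i) hC hTC

theorem exists_tendsto_real (U : Ultrafilter I) (ν : I → Measure X) (hν : ∀ i C, (ν i).real C ≤ 1) :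
    ∃ φ : Set X → ℝ, ∀ C, Tendsto (fun i => (ν i).real C) U (𝓝 (φ C)) := by
  have hlim (C : Set X) : ∃ a, Tendsto (fun i => (ν i).real C) U (𝓝 a) := by
    obtain ⟨a, -, ha⟩ := (isCompact_Icc (a := (0 : ℝ)) (b := 1)).ultrafilter_le_nhds'
      (U.map fun i => (ν i).real C)
      (U.mem_map.2 <| univ_mem' fun i => ⟨measureReal_nonneg, hν i C⟩)
    exact ⟨a, ha⟩
  choose φ hφ using hlim
  exact ⟨φ, hφ⟩

variable [IsProbabilityMeasure μ] [StandardBorelSpace X] {G : Type*} [Group G] [Countable G]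
  [MulAction G X] [MeasurableConstSMul G X] {c : G → X → ℝ}

theorem IsEquivariantMean.eq_measureReal {φ : Set X → ℝ} (hφ : IsEquivariantMean R μ φ)
    (hG : IsGeneratingAction R μ G) (hR : IsCountableNonsingular R μ) (herg : IsErgodic R μ)
    (hc : IsLogDeriv μ c) (hnb : HasUniformNb μ c) {A : Set X} (hA : MeasurableSet A) :
    φ A = μ.real A := by
  obtain ⟨ν, hν⟩ := hφ.exists_measure fun ε hε => hφ.exists_forall_le hG hR hc hnb hε
  have : IsProbabilityMeasure ν := ⟨by rw [hν _ .univ, hφ.univ, ENNReal.ofReal_one]⟩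
  have hac : ν ≪ μ := .mk fun C hC h0 => by rw [hν C hC, hφ.null C h0, ENNReal.ofReal_zero]
  have hdom : IsDistortionDominated G μ ν := fun g C L hC hL => by
    rw [hν _ (measurable_const_smul g hC), hν C hC, ← ENNReal.ofReal_coe_nnreal,
      ← ENNReal.ofReal_mul L.coe_nonneg]
    exact ENNReal.ofReal_le_ofReal (hφ.transport _ (hG.smul_mem_boundedGroup g) C hC L hL)
  rw [measureReal_def, ← hdom.eq hG herg hc hac, hν A hA, ENNReal.toReal_ofReal (hφ.nonneg A)]

theorem tendsto_real_cond (hG : IsGeneratingAction R μ G) (hR : IsCountableNonsingular R μ)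
    (herg : IsErgodic R μ) (hc : IsLogDeriv μ c) (hnb : HasUniformNb μ c)
    (hB : ∀ i, MeasurableSet (B i)) (hB0 : ∀ i, μ (B i) ≠ 0)
    (hinv : ∀ T ∈ boundedGroup R μ,
      Tendsto (fun i => μ.real (moved T (B i)) / μ.real (B i)) l (𝓝 0))
    {A : Set X} (hA : MeasurableSet A) :
    Tendsto (fun i => (cond μ (B i)).real A) l (𝓝 (μ.real A)) := by
  refine (tendsto_iff_ultrafilter _ _ _).2 fun U hU => ?_
  obtain ⟨φ, hφ⟩ := exists_tendsto_real U (fun i => cond μ (B i)) fun i C => measureReal_le_one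
  have hmean : IsEquivariantMean R μ φ :=
    isEquivariantMean_of_tendsto hB hB0 (fun T hT => (hinv T hT).mono_left hU) hφ
  exact hmean.eq_measureReal hG hR herg hc hnb hA ▸ hφ A

theorem IsGeneratingAction.exists_equidistribution (hG : IsGeneratingAction R μ G)
    (hR : IsCountableNonsingular R μ) (herg : IsErgodic R μ) (hc : IsLogDeriv μ c)
    (hnb : HasUniformNb μ c) {A : Set X} (hA : MeasurableSet A) {ε : ℝ} (hε : 0 < ε) :
    ∃ F : Finset (X ≃ᵐ X), ↑F ⊆ boundedGroup R μ ∧ ∃ ε' : ℝ, 0 < ε' ∧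
      ∀ B, MeasurableSet B → μ B ≠ 0 → (∀ θ ∈ F, μ.real (moved θ B) ≤ ε' * μ.real B) →
        NearlyIndep μ ε A B := by
  classical
  simp only [NearlyIndep]
  by_contra! hcon
  have hpos (n : ℕ) : (0 : ℝ) < 1 / ((n : ℝ) + 1) := by positivity
  choose B hB hB0 hBinv hBA using fun i : Finset (boundedGroup R μ) × ℕ =>
    hcon (i.1.map (Function.Embedding.subtype _)) (by simp) (1 / ((i.2 : ℝ) + 1)) (hpos i.2)
  have hBpos (i) : 0 < μ.real (B i) := ENNReal.toReal_pos (hB0 i) (measure_ne_top _ _)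
  have hinv : ∀ T ∈ boundedGroup R μ,
      Tendsto (fun i => μ.real (moved T (B i)) / μ.real (B i)) atTop (𝓝 0) := by
    intro T hT
    have hlim :
        Tendsto (fun i : Finset (boundedGroup R μ) × ℕ => 1 / ((i.2 : ℝ) + 1)) atTop (𝓝 0) :=
      tendsto_one_div_add_atTop_nhds_zero_nat.comp
        (prod_atTop_atTop_eq (α := Finset (boundedGroup R μ)) (β := ℕ) ▸ tendsto_snd)
    refine squeeze_zero' (.of_forall fun i => by positivity) ?_ hlim
    filter_upwards [eventually_ge_atTop ({⟨T, hT⟩}, 0)] with i hi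
    exact (div_le_iff₀ (hBpos i)).2 <| hBinv i T <|
      Finset.mem_map.2 ⟨⟨T, hT⟩, hi.1 (Finset.mem_singleton_self _), rfl⟩
  obtain ⟨i, hi⟩ := (Metric.tendsto_nhds.1
    (tendsto_real_cond hG hR herg hc hnb hB hB0 hinv hA) ε hε).exists
  refine (hBA i).not_ge ?_
  rw [Real.dist_eq, real_cond μ (hB i), div_sub' (hBpos i).ne', abs_div, abs_of_pos (hBpos i),
    div_lt_iff₀ (hBpos i), Set.inter_comm, mul_comm (μ.real (B i))] at hi
  exact hi.le

end Equidistribution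

section LevelSets

variable {X : Type*} [MeasurableSpace X] {μ : Measure X} [SFinite μ]

theorem measurableSet_moved_subgraph {u : X → ℝ} (hu : Measurable u) {T : X → X}
    (hT : Measurable T) :
    MeasurableSet (moved (Prod.map T id) {p : X × ℝ | p.2 < u p.1}) :=
  measurableSet_moved (hT.prodMap measurable_id)
    (measurableSet_lt measurable_snd (hu.comp measurable_fst))

/- Coarea formula: both sides are the measure of the set of all `(x, t)` with `t` between `u x` and
`u (T x)`. -/
theorem lintegral_enorm_comp_sub {u : X → ℝ} (hu : Measurable u) {T : X → X} (hT : Measurable T) :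
    ∫⁻ x, ‖u (T x) - u x‖ₑ ∂μ = ∫⁻ t, μ (moved T {x | t < u x}) := by
  have hS := measurableSet_moved_subgraph hu hT
  refine Eq.trans (lintegral_congr fun x => ?_)
    ((Measure.prod_apply (ν := volume) hS).symm.trans (Measure.prod_apply_symm hS))
  have hslice : Prod.mk x ⁻¹' moved (Prod.map T id) {p : X × ℝ | p.2 < u p.1} =
      Set.Ico (min (u (T x)) (u x)) (max (u (T x)) (u x)) := by
    ext t
    simp only [moved, Set.mem_preimage, Set.mem_ofPred_eq, Prod.map_apply, id, Set.mem_Ico]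
    grind
  rw [hslice, Real.volume_Ico, max_sub_min_eq_abs', Real.enorm_eq_ofReal_abs]

end LevelSets

section SquareNorm

variable {X : Type*} [MeasurableSpace X] {μ : Measure X} {E : Type*} [NormedAddCommGroup E]

theorem eLpNorm_two_sq (f : X → E) : eLpNorm f 2 μ ^ 2 = ∫⁻ x, ‖f x‖ₑ ^ 2 ∂μ := by
  have h := eLpNorm_nnreal_pow_eq_lintegral (f := f) (μ := μ) (p := 2) two_ne_zero
  simpa only [NNReal.coe_ofNat, ENNReal.rpow_ofNat, ENNReal.coe_ofNat] using h

end SquareNorm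

section Cheeger

variable {X : Type*} [MeasurableSpace X] {ι : Type*} [Fintype ι] {μ : Measure X} {ε : ℝ≥0}
  {T : ι → X → X}

/-- Expansion: every set of measure at most one half is displaced by a definite proportion of its
measure. -/
def HasExpansion (μ : Measure X) (ε : ℝ≥0) (T : ι → X → X) : Prop :=
  ∀ B, MeasurableSet B → μ B ≤ 1 / 2 → ε * μ B ≤ ∑ k, μ (moved (T k) B)

theorem HasExpansion.lintegral_enorm_le [SFinite μ] (h : HasExpansion μ ε T)
    (hT : ∀ k, Measurable (T k)) {u : X → ℝ} (hu : Measurable u) (hu₀ : ∀ x, 0 ≤ u x)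
    (hsupp : μ {x | 0 < u x} ≤ 1 / 2) :
    ε * ∫⁻ x, ‖u x‖ₑ ∂μ ≤ ∑ k, ∫⁻ x, ‖u (T k x) - u x‖ₑ ∂μ := by
  have hmeas k : Measurable fun t : ℝ => μ (moved (T k) {x | t < u x}) :=
    measurable_measure_prodMk_right (measurableSet_moved_subgraph hu (hT k))
  calc
    ε * ∫⁻ x, ‖u x‖ₑ ∂μ = ∫⁻ t in Set.Ioi 0, ε * μ {x | t < u x} := by
      simp only [Real.enorm_of_nonneg (hu₀ _)]
      rw [lintegral_eq_lintegral_meas_lt μ (ae_of_all _ hu₀) hu.aemeasurable,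
        lintegral_const_mul' _ _ ENNReal.coe_ne_top]
    _ ≤ ∫⁻ t in Set.Ioi 0, ∑ k, μ (moved (T k) {x | t < u x}) :=
      setLIntegral_mono' measurableSet_Ioi fun t ht =>
        h _ (measurableSet_lt measurable_const hu)
          ((measure_mono fun x (hx : t < u x) => ht.out.trans hx).trans hsupp)
    _ ≤ ∫⁻ t, ∑ k, μ (moved (T k) {x | t < u x}) := setLIntegral_le_lintegral _ _
    _ = ∑ k, ∫⁻ x, ‖u (T k x) - u x‖ₑ ∂μ := by
      rw [lintegral_finsetSum _ fun k _ => hmeas k]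
      simp only [lintegral_enorm_comp_sub hu (hT _)]

theorem enorm_sq_sub_sq_le {s : ℝ≥0} (hs : 0 < s) (a b : ℝ) :
    ‖a ^ 2 - b ^ 2‖ₑ ≤ (1 + s : ℝ≥0) * ‖a - b‖ₑ ^ 2 + (s⁻¹ : ℝ≥0) * ‖b‖ₑ ^ 2 := by
  suffices h : |a ^ 2 - b ^ 2| ≤ (1 + s) * |a - b| ^ 2 + (s : ℝ)⁻¹ * |b| ^ 2 by
    simp only [enorm_eq_nnnorm]
    norm_cast
  have hexpand (c : ℝ) : 0 ≤ s * (a - b) ^ 2 + 2 * (a - b) * c + (s : ℝ)⁻¹ * c ^ 2 := by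
    have : s * (a - b) ^ 2 + 2 * (a - b) * c + (s : ℝ)⁻¹ * c ^ 2 =
        (s : ℝ)⁻¹ * (s * (a - b) + c) ^ 2 := by
      have : (s : ℝ) ≠ 0 := by exact_mod_cast hs.ne'
      field_simp
      ring
    rw [this]
    positivity
  have hpos := hexpand b
  have hneg := hexpand (-b)
  rw [sq_abs, sq_abs, abs_le]
  constructor <;> nlinarith [sq_nonneg (a - b)]

theorem le_mul_of_mul_le_add_half_mul (hε : 0 < ε) {a b : ℝ≥0∞} (ha : a ≠ ∞)
    (h : ε * a ≤ b + (ε / 2 : ℝ≥0) * a) : a ≤ (2 / ε : ℝ≥0) * b := by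
  have hhalf : (ε / 2 : ℝ≥0) * a ≤ b := by
    refine ENNReal.le_of_add_le_add_right (a := (ε / 2 : ℝ≥0) * a)
      (ENNReal.mul_ne_top ENNReal.coe_ne_top ha) ?_
    rwa [← add_mul, ← ENNReal.coe_add, add_halves]
  calc
    a = (2 / ε : ℝ≥0) * ((ε / 2 : ℝ≥0) * a) := by
      rw [← mul_assoc, ← ENNReal.coe_mul, div_mul_div_cancel₀ hε.ne', div_self two_ne_zero,
        ENNReal.coe_one, one_mul]
    _ ≤ (2 / ε : ℝ≥0) * b := by gcongr

/-- The spectral gap constant that Cheeger's argument extracts from expansion by `ε` under `n`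
maps. -/
noncomputable def gapConst (n : ℕ) (ε : ℝ≥0) : ℝ≥0 := 2 / ε * (1 + 2 * (n + 1) / ε)

theorem gapConst_pos (n : ℕ) (hε : 0 < ε) : 0 < gapConst n ε := by
  unfold gapConst
  positivity

/- The `L¹` inequality is applied to `g ^ 2`; by Young's inequality at `s = 2 (n + 1) / ε`, at most
half of the left-hand side reappears on the right, where it is absorbed. -/
theorem HasExpansion.eLpNorm_sq_le_of_nonneg [SFinite μ] (h : HasExpansion μ ε T) (hε : 0 < ε)
    (hT : ∀ k, Measurable (T k)) {g : X → ℝ} (hg : Measurable g) (hgL : MemLp g 2 μ)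
    (hg₀ : ∀ x, 0 ≤ g x) (hsupp : μ {x | 0 < g x} ≤ 1 / 2) :
    eLpNorm g 2 μ ^ 2 ≤ gapConst (Fintype.card ι) ε *
      ∑ k, eLpNorm (fun x => g (T k x) - g x) 2 μ ^ 2 := by
  set n := Fintype.card ι with hn
  set J := eLpNorm g 2 μ ^ 2 with hJ
  set S := ∑ k, eLpNorm (fun x => g (T k x) - g x) 2 μ ^ 2
  set s : ℝ≥0 := 2 * (n + 1) / ε with hs
  have hJ_top : J ≠ ∞ := ENNReal.pow_ne_top hgL.2.ne
  have hyoung k : ∫⁻ x, ‖g (T k x) ^ 2 - g x ^ 2‖ₑ ∂μ ≤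
      (1 + s : ℝ≥0) * eLpNorm (fun x => g (T k x) - g x) 2 μ ^ 2 + (s⁻¹ : ℝ≥0) * J := by
    have hmeas : Measurable fun x => ‖g (T k x) - g x‖ₑ ^ 2 :=
      (((hg.comp (hT k)).sub hg).enorm).pow_const 2
    rw [hJ, eLpNorm_two_sq, eLpNorm_two_sq, ← lintegral_const_mul' _ _ ENNReal.coe_ne_top,
      ← lintegral_const_mul' _ _ ENNReal.coe_ne_top, ← lintegral_add_left (hmeas.const_mul _)]
    exact lintegral_mono fun x => enorm_sq_sub_sq_le (by positivity) _ _
  have hcoeff : n * s⁻¹ ≤ ε / 2 := by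
    rw [hs, inv_div, mul_div_assoc', div_le_div_iff₀ (by positivity) two_pos]
    nlinarith [mul_comm (n : ℝ≥0) ε]
  have habsorb : ε * J ≤ (1 + s : ℝ≥0) * S + (ε / 2 : ℝ≥0) * J := by
    calc
      ε * J ≤ ∑ k, ∫⁻ x, ‖g (T k x) ^ 2 - g x ^ 2‖ₑ ∂μ := by
        have := h.lintegral_enorm_le hT (hg.pow_const 2) (fun x => sq_nonneg (g x))
          (by simpa only [sq_pos_iff, (hg₀ _).lt_iff_ne'] using hsupp)
        simpa only [enorm_pow, ← eLpNorm_two_sq] using this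
      _ ≤ ∑ k, ((1 + s : ℝ≥0) * eLpNorm (fun x => g (T k x) - g x) 2 μ ^ 2 +
          (s⁻¹ : ℝ≥0) * J) := Finset.sum_le_sum fun k _ => hyoung k
      _ = (1 + s : ℝ≥0) * S + (n * s⁻¹ : ℝ≥0) * J := by
        rw [Finset.sum_add_distrib, ← Finset.mul_sum, Finset.sum_const, Finset.card_univ, ← hn,
          nsmul_eq_mul, ← mul_assoc, ENNReal.coe_mul, ENNReal.coe_natCast]
      _ ≤ (1 + s : ℝ≥0) * S + (ε / 2 : ℝ≥0) * J := by gcongr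
  rw [gapConst, ENNReal.coe_mul, mul_assoc]
  exact le_mul_of_mul_le_add_half_mul hε hJ_top habsorb

end Cheeger

section Median

theorem exists_median (ν : Measure ℝ) [IsProbabilityMeasure ν] :
    ∃ a, ν (Set.Ioi a) ≤ 1 / 2 ∧ ν (Set.Iio a) ≤ 1 / 2 := by
  let F := ProbabilityTheory.cdf ν
  have hbot : Tendsto F atBot (𝓝 0) := ProbabilityTheory.tendsto_cdf_atBot ν
  have htop : Tendsto F atTop (𝓝 1) := ProbabilityTheory.tendsto_cdf_atTop ν
  obtain ⟨t₀, ht₀⟩ := (htop.eventually_const_lt one_half_lt_one).exists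
  obtain ⟨s₀, hs₀⟩ := (hbot.eventually_lt_const one_half_pos).exists
  let S : Set ℝ := {t | 1 / 2 ≤ F t}
  have hbdd : BddBelow S := ⟨s₀, fun t ht => le_of_not_gt fun hts =>
    (hs₀.trans_le' (F.mono hts.le)).not_ge ht⟩
  have hright : 1 / 2 ≤ F (sInf S) := by
    refine ge_of_tendsto ((F.right_continuous (sInf S)).mono Set.Ioi_subset_Ici_self) ?_
    filter_upwards [self_mem_nhdsWithin] with t ht
    obtain ⟨s, hs, hst⟩ := exists_lt_of_csInf_lt ⟨t₀, ht₀.le⟩ ht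
    exact le_trans hs (F.mono hst.le)
  have hleft : Function.leftLim F (sInf S) ≤ 1 / 2 := by
    refine le_of_tendsto (F.mono.tendsto_leftLim (sInf S)) ?_
    filter_upwards [self_mem_nhdsWithin] with t ht
    exact (not_le.1 fun h => notMem_of_lt_csInf ht hbdd h).le
  have hhalf : ENNReal.ofReal (1 / 2) = 1 / 2 := by
    rw [ENNReal.ofReal_div_of_pos two_pos, ENNReal.ofReal_one, ENNReal.ofReal_ofNat]
  refine ⟨sInf S, ?_, ?_⟩
  · rw [← ProbabilityTheory.measure_cdf ν, StieltjesFunction.measure_Ioi _ htop, ← hhalf]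
    exact ENNReal.ofReal_le_ofReal (by linarith)
  · rw [← ProbabilityTheory.measure_cdf ν, StieltjesFunction.measure_Iio _ hbot, ← hhalf]
    exact ENNReal.ofReal_le_ofReal (by linarith)

end Median

section SquareNorm

variable {X : Type*} [MeasurableSpace X] {μ : Measure X}

theorem eLpNorm_sq_add_eLpNorm_sq {E F : Type*} [NormedAddCommGroup E] [NormedAddCommGroup F]
    {f : X → E} (hf : AEStronglyMeasurable f μ) (g : X → F) :
    eLpNorm f 2 μ ^ 2 + eLpNorm g 2 μ ^ 2 = ∫⁻ x, (‖f x‖ₑ ^ 2 + ‖g x‖ₑ ^ 2) ∂μ := by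
  rw [eLpNorm_two_sq, eLpNorm_two_sq, lintegral_add_left' (hf.enorm.pow_const 2)]

theorem enorm_posPart_sq_add_enorm_negPart_sq (a : ℝ) : ‖a⁺‖ₑ ^ 2 + ‖a⁻‖ₑ ^ 2 = ‖a‖ₑ ^ 2 := by
  rcases le_total 0 a with ha | ha
  · simp [posPart_of_nonneg ha, negPart_of_nonneg ha]
  · simp [posPart_of_nonpos ha, negPart_of_nonpos ha]

theorem enorm_posPart_sub_sq_add_enorm_negPart_sub_sq_le (a b : ℝ) :
    ‖a⁺ - b⁺‖ₑ ^ 2 + ‖a⁻ - b⁻‖ₑ ^ 2 ≤ ‖a - b‖ₑ ^ 2 := by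
  suffices h : |a⁺ - b⁺| ^ 2 + |a⁻ - b⁻| ^ 2 ≤ |a - b| ^ 2 by
    simp only [enorm_eq_nnnorm]
    norm_cast
  simp only [sq_abs, posPart_def, negPart_def]
  rcases le_total 0 a with ha | ha <;> rcases le_total 0 b with hb | hb <;>
    simp only [ha, hb, sup_of_le_left, sup_of_le_right, neg_nonneg, neg_nonpos] <;>
    nlinarith

theorem enorm_re_sq_add_enorm_im_sq (z : ℂ) : ‖z.re‖ₑ ^ 2 + ‖z.im‖ₑ ^ 2 = ‖z‖ₑ ^ 2 := by
  suffices h : |z.re| ^ 2 + |z.im| ^ 2 = ‖z‖ ^ 2 by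
    simp only [enorm_eq_nnnorm]
    norm_cast
    exact NNReal.eq (by simpa using h)
  rw [sq_abs, sq_abs, Complex.sq_norm, Complex.normSq_apply, sq, sq]

theorem eLpNorm_sub_integral_le [IsProbabilityMeasure μ] {f : X → ℂ} (hf : MemLp f 2 μ) (a : ℂ) :
    eLpNorm (fun x => f x - ∫ y, f y ∂μ) 2 μ ≤ 2 * eLpNorm (fun x => f x - a) 2 μ := by
  have hint : Integrable f μ := hf.integrable one_le_two
  have hsub : AEStronglyMeasurable (fun x => f x - a) μ := hf.1.sub aestronglyMeasurable_const
  have hmean : ‖a - ∫ y, f y ∂μ‖ₑ ≤ eLpNorm (fun x => f x - a) 2 μ :=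
    calc
      ‖a - ∫ y, f y ∂μ‖ₑ = ‖∫ y, (f y - a) ∂μ‖ₑ := by
        rw [integral_sub hint (integrable_const a), integral_const, probReal_univ, one_smul,
          ← enorm_neg, neg_sub]
      _ ≤ eLpNorm (fun x => f x - a) 1 μ :=
        (enorm_integral_le_lintegral_enorm _).trans_eq eLpNorm_one_eq_lintegral_enorm.symm
      _ ≤ eLpNorm (fun x => f x - a) 2 μ := eLpNorm_le_eLpNorm_of_exponent_le one_le_two hsub
  calc
    eLpNorm (fun x => f x - ∫ y, f y ∂μ) 2 μ
      = eLpNorm ((fun x => f x - a) + fun _ => a - ∫ y, f y ∂μ) 2 μ := by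
        congr 1
        ext x
        simp
    _ ≤ eLpNorm (fun x => f x - a) 2 μ + eLpNorm (fun _ => a - ∫ y, f y ∂μ) 2 μ :=
      eLpNorm_add_le hsub aestronglyMeasurable_const one_le_two
    _ ≤ 2 * eLpNorm (fun x => f x - a) 2 μ := by
      rw [two_mul, eLpNorm_const _ two_ne_zero (IsProbabilityMeasure.ne_zero μ), measure_univ,
        ENNReal.one_rpow, mul_one]
      gcongr

end SquareNorm

section Cheeger

variable {X : Type*} [MeasurableSpace X] {ι : Type*} [Fintype ι] {μ : Measure X} {ε : ℝ≥0}
  {T : ι → X → X}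

namespace HasExpansion

theorem eLpNorm_sq_le [SFinite μ] (h : HasExpansion μ ε T) (hε : 0 < ε)
    (hT : ∀ k, Measurable (T k)) {f : X → ℝ} (hf : Measurable f) (hfL : MemLp f 2 μ)
    (hpos : μ {x | 0 < f x} ≤ 1 / 2) (hneg : μ {x | f x < 0} ≤ 1 / 2) :
    eLpNorm f 2 μ ^ 2 ≤ gapConst (Fintype.card ι) ε *
      ∑ k, eLpNorm (fun x => f (T k x) - f x) 2 μ ^ 2 := by
  have hp : Measurable fun x => (f x)⁺ := hf.max measurable_const
  have hn : Measurable fun x => (f x)⁻ := hf.neg.max measurable_const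
  have hple := h.eLpNorm_sq_le_of_nonneg hε hT hp hfL.pos_part (fun x => posPart_nonneg _)
    (by simpa only [posPart_pos_iff] using hpos)
  have hnle := h.eLpNorm_sq_le_of_nonneg hε hT hn hfL.neg_part (fun x => negPart_nonneg _)
    (by simpa only [negPart_pos_iff] using hneg)
  calc
    eLpNorm f 2 μ ^ 2 = eLpNorm (fun x => (f x)⁺) 2 μ ^ 2 + eLpNorm (fun x => (f x)⁻) 2 μ ^ 2 := by
      rw [eLpNorm_sq_add_eLpNorm_sq hp.aestronglyMeasurable, eLpNorm_two_sq]
      simp only [enorm_posPart_sq_add_enorm_negPart_sq]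
    _ ≤ gapConst (Fintype.card ι) ε * ∑ k, (eLpNorm (fun x => (f (T k x))⁺ - (f x)⁺) 2 μ ^ 2 +
        eLpNorm (fun x => (f (T k x))⁻ - (f x)⁻) 2 μ ^ 2) := by
      rw [Finset.sum_add_distrib, mul_add]
      exact add_le_add hple hnle
    _ ≤ _ := by
      gcongr with k
      have hmeas : Measurable fun x => (f (T k x))⁺ - (f x)⁺ := (hp.comp (hT k)).sub hp
      rw [eLpNorm_sq_add_eLpNorm_sq hmeas.aestronglyMeasurable, eLpNorm_two_sq]
      exact lintegral_mono fun x => enorm_posPart_sub_sq_add_enorm_negPart_sub_sq_le _ _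

variable [IsProbabilityMeasure μ]

theorem exists_eLpNorm_sub_sq_le_real (h : HasExpansion μ ε T) (hε : 0 < ε)
    (hT : ∀ k, Measurable (T k)) {f : X → ℝ} (hf : Measurable f) (hfL : MemLp f 2 μ) :
    ∃ a, eLpNorm (fun x => f x - a) 2 μ ^ 2 ≤ gapConst (Fintype.card ι) ε *
      ∑ k, eLpNorm (fun x => f (T k x) - f x) 2 μ ^ 2 := by
  have := Measure.isProbabilityMeasure_map hf.aemeasurable (μ := μ)
  obtain ⟨a, hgt, hlt⟩ := exists_median (μ.map f)
  replace hgt : μ {x | a < f x} ≤ 1 / 2 := by rwa [Measure.map_apply hf measurableSet_Ioi] at hgt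
  replace hlt : μ {x | f x < a} ≤ 1 / 2 := by rwa [Measure.map_apply hf measurableSet_Iio] at hlt
  refine ⟨a, ?_⟩
  simpa only [sub_sub_sub_cancel_right] using
    h.eLpNorm_sq_le hε hT (hf.sub_const a) (hfL.sub (memLp_const a))
      (by simpa only [sub_pos]) (by simpa only [sub_neg])

theorem exists_eLpNorm_sub_sq_le_complex (h : HasExpansion μ ε T) (hε : 0 < ε)
    (hT : ∀ k, Measurable (T k)) {f : X → ℂ} (hf : Measurable f) (hfL : MemLp f 2 μ) :
    ∃ z, eLpNorm (fun x => f x - z) 2 μ ^ 2 ≤ gapConst (Fintype.card ι) ε *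
      ∑ k, eLpNorm (fun x => f (T k x) - f x) 2 μ ^ 2 := by
  have hsplit {g : X → ℂ} (hg : Measurable g) : eLpNorm g 2 μ ^ 2 =
      eLpNorm (fun x => (g x).re) 2 μ ^ 2 + eLpNorm (fun x => (g x).im) 2 μ ^ 2 := by
    have hre : Measurable fun x => (g x).re := Complex.measurable_re.comp hg
    rw [eLpNorm_sq_add_eLpNorm_sq hre.aestronglyMeasurable, eLpNorm_two_sq]
    simp only [enorm_re_sq_add_enorm_im_sq]
  obtain ⟨a, ha⟩ := h.exists_eLpNorm_sub_sq_le_real hε hT (Complex.measurable_re.comp hf) hfL.re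
  obtain ⟨b, hb⟩ := h.exists_eLpNorm_sub_sq_le_real hε hT (Complex.measurable_im.comp hf) hfL.im
  refine ⟨⟨a, b⟩, ?_⟩
  rw [hsplit (hf.sub_const _)]
  have hsum k := hsplit (g := fun x => f (T k x) - f x) ((hf.comp (hT k)).sub hf)
  simp only [hsum, Complex.sub_re, Complex.sub_im, Finset.sum_add_distrib, mul_add]
  exact add_le_add ha hb

theorem eLpNorm_sub_integral_sq_le (h : HasExpansion μ ε T) (hε : 0 < ε)
    (hT : ∀ k, Measure.QuasiMeasurePreserving (T k) μ μ) {f : X → ℂ} (hf : MemLp f 2 μ) :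
    eLpNorm (fun x => f x - ∫ y, f y ∂μ) 2 μ ^ 2 ≤ (4 * gapConst (Fintype.card ι) ε : ℝ≥0) *
      ∑ k, eLpNorm (fun x => f (T k x) - f x) 2 μ ^ 2 := by
  obtain ⟨f', hf', hff'⟩ := hf.1.aemeasurable
  obtain ⟨z, hz⟩ := h.exists_eLpNorm_sub_sq_le_complex hε (fun k => (hT k).measurable) hf'
    ((memLp_congr_ae hff').1 hf)
  have hsub : eLpNorm (fun x => f' x - z) 2 μ = eLpNorm (fun x => f x - z) 2 μ :=
    eLpNorm_congr_ae (hff'.symm.sub .rfl)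
  have hcomp k : eLpNorm (fun x => f' (T k x) - f' x) 2 μ =
      eLpNorm (fun x => f (T k x) - f x) 2 μ :=
    eLpNorm_congr_ae (((hT k).ae_eq_comp hff').symm.sub hff'.symm)
  simp only [hsub, hcomp] at hz
  calc
    eLpNorm (fun x => f x - ∫ y, f y ∂μ) 2 μ ^ 2 ≤ (2 * eLpNorm (fun x => f x - z) 2 μ) ^ 2 := by
      gcongr
      exact eLpNorm_sub_integral_le hf z
    _ = (4 : ℝ≥0) * eLpNorm (fun x => f x - z) 2 μ ^ 2 := by
      rw [mul_pow]
      norm_num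
    _ ≤ _ := by
      rw [ENNReal.coe_mul, mul_assoc]
      gcongr

end HasExpansion

end Cheeger

section Moved

variable {X : Type*} [MeasurableSpace X] {μ : Measure X}

theorem moved_iUnion_subset {Y : Type*} {T : Y → Y} {A : ℕ → Set Y} (hA : Monotone A) :
    moved T (⋃ n, A n) ⊆ ⋃ N, ⋂ n ≥ N, moved T (A n) := by
  intro x hx
  simp only [moved, Set.mem_ofPred_eq, Set.mem_iUnion, Set.mem_iInter] at hx ⊢
  by_cases hxA : ∃ n, x ∈ A n
  · obtain ⟨N, hN⟩ := hxA
    exact ⟨N, fun n hn hiff => hx ⟨fun _ => ⟨N, hN⟩, fun _ => ⟨n, hiff.2 (hA hn hN)⟩⟩⟩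
  · obtain ⟨N, hN⟩ : ∃ n, T x ∈ A n := by
      by_contra hTx
      exact hx ⟨fun h => absurd h hTx, fun h => absurd h hxA⟩
    exact ⟨N, fun n hn hiff => hxA ⟨n, hiff.1 (hA hn hN)⟩⟩

theorem measure_moved_iUnion_le {T : X → X} {A : ℕ → Set X} (hA : Monotone A) {b : ℝ≥0∞}
    (h : ∀ n, μ (moved T (A n)) ≤ b) : μ (moved T (⋃ n, A n)) ≤ b := by
  have hmono : Monotone fun N => ⋂ n ≥ N, moved T (A n) := fun _ _ hNM =>
    Set.biInter_subset_biInter_left fun _ hn => le_trans hNM hn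
  refine (measure_mono (moved_iUnion_subset hA)).trans ?_
  rw [hmono.measure_iUnion]
  exact iSup_le fun N => (measure_mono (Set.biInter_subset_of_mem le_rfl)).trans (h N)

theorem moved_union_subset {Y : Type*} (T : Y → Y) (A B : Set Y) :
    moved T (A ∪ B) ⊆ moved T B ∪ moved T A \ B := by
  intro x hx
  simp only [moved, Set.mem_union, Set.mem_sdiff, Set.mem_ofPred_eq] at hx ⊢
  tauto

theorem measureReal_moved_union_le [IsFiniteMeasure μ] (T : X → X) (A : Set X) {B : Set X}
    (hB : MeasurableSet B) :
    μ.real (moved T (A ∪ B)) ≤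
      μ.real (moved T B) + (μ.real (moved T A) - μ.real (moved T A ∩ B)) := by
  refine (measureReal_mono (moved_union_subset T A B)).trans
    ((measureReal_union_le _ _).trans_eq ?_)
  rw [← measureReal_inter_add_sdiff (μ := μ) (s := moved T A) hB, add_sub_cancel_left]

end Moved

section AlmostInvariant

variable {X : Type*} [MeasurableSpace X] {G : Type*} [SMul G X] {μ : Measure X} {F : Finset G}
  {ε δ : ℝ≥0} {A B : Set X}

/-- A measurable set that each element of `F` displaces by at most the proportion `ε` of its
measure. -/
structure IsAlmostInvariant (μ : Measure X) (F : Finset G) (ε : ℝ≥0) (A : Set X) : Prop where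
  measurableSet : MeasurableSet A
  measure_moved_le : ∀ g ∈ F, μ (moved (g • · : X → X) A) ≤ ε * μ A

theorem exists_maximal_isAlmostInvariant [IsFiniteMeasure μ] (F : Finset G) (ε : ℝ≥0)
    (r : ℝ≥0∞) : ∃ A, (IsAlmostInvariant μ F ε A ∧ μ A ≤ r) ∧
      ∀ B, IsAlmostInvariant μ F ε B ∧ μ B ≤ r → A ⊆ B → μ B ≤ μ A := by
  refine exists_ae_maximal μ (fun A => IsAlmostInvariant μ F ε A ∧ μ A ≤ r) (A₀ := ∅)
    ⟨⟨.empty, by simp [moved]⟩, by simp⟩ fun A hmono hA => ⟨⟨?_, fun g hg => ?_⟩, ?_⟩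
  · exact .iUnion fun n => (hA n).1.measurableSet
  · refine measure_moved_iUnion_le hmono fun n => ((hA n).1.measure_moved_le g hg).trans ?_
    gcongr
    exact Set.subset_iUnion A n
  · rw [hmono.measure_iUnion]
    exact iSup_le fun n => (hA n).2

variable [IsProbabilityMeasure μ]

theorem IsAlmostInvariant.measureReal_moved_le (hA : IsAlmostInvariant μ F ε A) {g : G}
    (hg : g ∈ F) : μ.real (moved (g • · : X → X) A) ≤ ε * μ.real A := by
  simpa [measureReal_def] using ENNReal.toReal_mono (by finiteness) (hA.measure_moved_le g hg)

/- Near independence makes the displacement of `A` outside `B` about `ε * μ A * (1 - μ B)`, which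
leaves room for the displacement of `B`, since `δ` is much smaller than `ε`. -/
theorem IsAlmostInvariant.union (hA : IsAlmostInvariant μ F ε A) (hB : IsAlmostInvariant μ F δ B)
    (hδε : δ ≤ ε / 4) (hδ : δ ≤ 1 / 4) (hAB : NearlyIndep μ δ A B)
    (hmoved : ∀ g ∈ F, NearlyIndep μ δ (moved (g • · : X → X) A) B) :
    IsAlmostInvariant μ F ε (A ∪ B) := by
  refine ⟨hA.measurableSet.union hB.measurableSet, fun g hg => ?_⟩
  suffices h : μ.real (moved (g • · : X → X) (A ∪ B)) ≤ ε * μ.real (A ∪ B) by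
    rw [← ofReal_measureReal, ← ofReal_measureReal (s := A ∪ B), ← ENNReal.ofReal_coe_nnreal,
      ← ENNReal.ofReal_mul ε.coe_nonneg]
    exact ENNReal.ofReal_le_ofReal h
  have hδε' : (δ : ℝ) ≤ ε / 4 := hδε
  have hδ' : (δ : ℝ) ≤ 1 / 4 := by exact_mod_cast hδ
  have hroom : 2 * δ * μ.real B ≤ ε * (1 - δ) * μ.real B := by
    refine mul_le_mul_of_nonneg_right ?_ measureReal_nonneg
    nlinarith [δ.coe_nonneg, ε.coe_nonneg, hδε', hδ']
  have hAinter : ε * (μ.real (A ∩ B) - μ.real A * μ.real B) ≤ ε * (δ * μ.real B) :=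
    mul_le_mul_of_nonneg_left (abs_le.1 hAB).2 ε.coe_nonneg
  have hAmoved : μ.real (moved (g • · : X → X) A) * (1 - μ.real B) ≤
      ε * μ.real A * (1 - μ.real B) :=
    mul_le_mul_of_nonneg_right (hA.measureReal_moved_le hg) (sub_nonneg.2 measureReal_le_one)
  have hunion := measureReal_union_add_inter (μ := μ) (s := A) hB.measurableSet
  have hunion' : ε * μ.real (A ∪ B) = ε * μ.real A + ε * μ.real B - ε * μ.real (A ∩ B) := by
    rw [← mul_add, ← hunion]
    ring
  linarith [measureReal_moved_union_le (μ := μ) (g • · : X → X) A hB.measurableSet,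
    hB.measureReal_moved_le hg, (abs_le.1 (hmoved g hg)).1]

end AlmostInvariant

section BoundedGroup

variable {X : Type*} [MeasurableSpace X] {R : Setoid X} {μ : Measure X} {θ : X ≃ᵐ X}

theorem symm_mem_boundedGroup (h : θ ∈ boundedGroup R μ) : θ.symm ∈ boundedGroup R μ := by
  obtain ⟨hRθ, K, hK, hK'⟩ := h
  refine ⟨fun x => R.symm ?_, K, hK', hK⟩
  simpa only [θ.apply_symm_apply] using hRθ (θ.symm x)

variable [IsFiniteMeasure μ]

theorem isBoundedAut_of_mem_boundedGroup (h : θ ∈ boundedGroup R μ) : IsBoundedAut μ θ := by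
  obtain ⟨-, K, hK, hK'⟩ := h
  exact isBoundedAut_of_distortionLE hK hK'

theorem mem_fullGroup_of_mem_boundedGroup (h : θ ∈ boundedGroup R μ) : θ ∈ fullGroup R μ :=
  ⟨(isBoundedAut_of_mem_boundedGroup h).1, ae_of_all _ h.1⟩

end BoundedGroup

section Expansion

variable {X : Type*} [MeasurableSpace X] {G : Type*} [SMul G X] {μ : Measure X} {F : Finset G}
  {ε δ : ℝ≥0} {A B : Set X}

theorem IsAlmostInvariant.mono (hB : IsAlmostInvariant μ F δ B) (hδε : δ ≤ ε) :
    IsAlmostInvariant μ F ε B :=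
  ⟨hB.measurableSet, fun g hg => (hB.measure_moved_le g hg).trans (by gcongr)⟩

theorem le_one_eighth_of_mul_one_sub_lt {p : ℝ≥0∞} (hp : p ≤ 1 / 2)
    (h : p * (1 - p) < 1 / 16) : p ≤ 1 / 8 := by
  have hhalf : (1 / 2 : ℝ≥0∞) ≤ 1 - p := by
    calc
      (1 / 2 : ℝ≥0∞) = 1 - 1 / 2 := by rw [one_div, ENNReal.one_sub_inv_two]
      _ ≤ 1 - p := tsub_le_tsub_left hp 1
  have h16 : (1 / 16 : ℝ≥0∞) = 1 / 8 * (1 / 2) := by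
    simp only [one_div]
    rw [← ENNReal.mul_inv (by simp) (by simp)]
    norm_num
  rw [h16] at h
  exact (ENNReal.mul_le_mul_iff_left (by simp) (by simp)).1
    ((mul_le_mul_right hhalf p).trans h.le)

variable [IsProbabilityMeasure μ]

theorem IsAlmostInvariant.measure_eq_zero_of_maximal
    (hgap : ∀ C, IsAlmostInvariant μ F ε C → μ C ≤ 1 / 2 → μ C ≤ 1 / 8)
    (hA : IsAlmostInvariant μ F ε A) (hA8 : μ A ≤ 1 / 8)
    (hmax : ∀ C, IsAlmostInvariant μ F ε C ∧ μ C ≤ 1 / 8 → A ⊆ C → μ C ≤ μ A)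
    (hB : IsAlmostInvariant μ F δ B) (hB2 : μ B ≤ 1 / 2)
    (hδε : δ ≤ ε / 4) (hδ : δ ≤ 1 / 4) (hAB : NearlyIndep μ δ A B)
    (hmoved : ∀ g ∈ F, NearlyIndep μ δ (moved (g • · : X → X) A) B) : μ B = 0 := by
  have hB8 : μ B ≤ 1 / 8 := hgap B (hB.mono (hδε.trans (div_le_self zero_le (by norm_num)))) hB2
  have hABinv := hA.union hB hδε hδ hAB hmoved
  have hAB2 : μ (A ∪ B) ≤ 1 / 2 := by
    refine (measure_union_le A B).trans ((add_le_add hA8 hB8).trans ?_)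
    rw [← ENNReal.toReal_le_toReal (by finiteness) (by finiteness),
      ENNReal.toReal_add (by finiteness) (by finiteness)]
    norm_num
  have hle : μ.real (A ∪ B) ≤ μ.real A := ENNReal.toReal_mono (measure_ne_top _ _)
    (hmax _ ⟨hABinv, hgap _ hABinv hAB2⟩ Set.subset_union_left)
  have hA8' : μ.real A ≤ 1 / 8 := by
    simpa [measureReal_def] using ENNReal.toReal_mono (by finiteness) hA8
  have hδ' : (δ : ℝ) ≤ 1 / 4 := by exact_mod_cast hδ
  have hinter : μ.real (A ∩ B) ≤ (1 / 8 + 1 / 4) * μ.real B := by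
    calc
      μ.real (A ∩ B) ≤ (μ.real A + δ) * μ.real B := by linarith [(abs_le.1 hAB).2]
      _ ≤ (1 / 8 + 1 / 4) * μ.real B := by gcongr
  have hB0 : μ.real B ≤ 0 := by
    linarith [measureReal_union_add_inter (μ := μ) (s := A) hB.measurableSet]
  exact (measureReal_eq_zero_iff).1 (hB0.antisymm measureReal_nonneg)

end Expansion

section SpectralGap

variable {X : Type*} [MeasurableSpace X] {R : Setoid X} {μ : Measure X}

/-- The mean-zero part of any square-integrable `f` is controlled in `L²` by the displacements
`f ∘ (θ k)⁻¹ - f`, with constant `κ`. -/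
def HasSpectralGap {ι : Type*} [Fintype ι] (μ : Measure X) (κ : ℝ≥0) (θ : ι → X ≃ᵐ X) : Prop :=
  ∀ f : X → ℂ, MemLp f 2 μ → eLpNorm (fun x => f x - ∫ y, f y ∂μ) 2 μ ^ 2 ≤
    (κ : ℝ≥0∞) * ∑ k, eLpNorm (fun x => f ((θ k).symm x) - f x) 2 μ ^ 2

variable [IsProbabilityMeasure μ] [StandardBorelSpace X]

namespace IsGeneratingAction

variable {G : Type*} [Group G] [Countable G] [MulAction G X] [MeasurableConstSMul G X]
  {c : G → X → ℝ}

theorem exists_equidistribution_finset (hG : IsGeneratingAction R μ G)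
    (hR : IsCountableNonsingular R μ) (herg : IsErgodic R μ) (hc : IsLogDeriv μ c)
    (hnb : HasUniformNb μ c) (t : Finset (Set X)) (ht : ∀ D ∈ t, MeasurableSet D) {ε : ℝ}
    (hε : 0 < ε) :
    ∃ F : Finset (X ≃ᵐ X), ↑F ⊆ boundedGroup R μ ∧ ∃ ε' : ℝ, 0 < ε' ∧
      ∀ B, MeasurableSet B → μ B ≠ 0 → (∀ θ ∈ F, μ.real (moved θ B) ≤ ε' * μ.real B) →
        ∀ D ∈ t, NearlyIndep μ ε D B := by
  classical
  induction t using Finset.induction_on with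
  | empty => exact ⟨∅, by simp, 1, one_pos, by simp⟩
  | insert D t _ ih =>
    obtain ⟨F, hF, e, he, h⟩ := ih fun D hD => ht D (Finset.mem_insert_of_mem hD)
    obtain ⟨F', hF', e', he', h'⟩ :=
      hG.exists_equidistribution hR herg hc hnb (ht D (Finset.mem_insert_self D t)) hε
    refine ⟨F ∪ F', by simp [hF, hF'], min e e', lt_min he he', fun B hB hB0 hBF => ?_⟩
    refine Finset.forall_mem_insert _ _ _ |>.2 ⟨h' B hB hB0 fun θ hθ => ?_,
      h B hB hB0 fun θ hθ => ?_⟩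
    · exact (hBF θ (Finset.mem_union_right _ hθ)).trans (by gcongr; exact min_le_right _ _)
    · exact (hBF θ (Finset.mem_union_left _ hθ)).trans (by gcongr; exact min_le_left _ _)

theorem exists_measure_le_of_isAlmostInvariant (hG : IsGeneratingAction R μ G)
    (hSE : IsStronglyErgodic R μ) :
    ∃ (F : Finset G) (ε : ℝ≥0), 0 < ε ∧
      ∀ B, IsAlmostInvariant μ F ε B → μ B ≤ 1 / 2 → μ B ≤ 1 / 8 := by
  obtain ⟨F, ε, hε, hF⟩ := hG.exists_finset_of_isStronglyErgodic hSE (δ := 1 / 16) (by simp)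
  refine ⟨F, ε, hε, fun B hB hB2 => le_one_eighth_of_mul_one_sub_lt hB2 ?_⟩
  exact hF B hB.measurableSet fun g hg =>
    (hB.measure_moved_le g hg).trans (mul_le_of_le_one_right zero_le prob_le_one)

/- Fix a maximal almost invariant set `A` of measure at most `1 / 8`. A non-null set `B` violating
the expansion would be nearly independent of `A` and of its displacements, so `A ∪ B` would be a
larger such set. -/
theorem exists_forall_moved_le_imp_measure_eq_zero (hG : IsGeneratingAction R μ G)
    (hR : IsCountableNonsingular R μ) (hSE : IsStronglyErgodic R μ) (hc : IsLogDeriv μ c)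
    (hnb : HasUniformNb μ c) :
    ∃ F : Finset (X ≃ᵐ X), ↑F ⊆ boundedGroup R μ ∧ ∃ ε : ℝ≥0, 0 < ε ∧
      ∀ B, MeasurableSet B → μ B ≤ 1 / 2 → (∀ θ ∈ F, μ (moved θ B) ≤ ε * μ B) → μ B = 0 := by
  classical
  obtain ⟨F₀, ε₀, hε₀, hgap⟩ := hG.exists_measure_le_of_isAlmostInvariant hSE
  obtain ⟨A, ⟨hA, hA8⟩, hmax⟩ := exists_maximal_isAlmostInvariant (μ := μ) F₀ ε₀ (1 / 8)
  set δ : ℝ≥0 := min (ε₀ / 4) (1 / 4)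
  have hδ : 0 < δ := lt_min (by positivity) (by norm_num)
  obtain ⟨F₁, hF₁, e, he, hindep⟩ := hG.exists_equidistribution_finset hR hSE.isErgodic hc hnb
    (insert A (F₀.image fun g => moved (g • · : X → X) A)) (by
      simpa [hA.measurableSet] using fun g _ =>
        measurableSet_moved (measurable_const_smul g) hA.measurableSet) (NNReal.coe_pos.2 hδ)
  lift e to ℝ≥0 using he.le
  refine ⟨F₀.image MeasurableEquiv.smul ∪ F₁, ?_, min δ e, lt_min hδ (NNReal.coe_pos.1 he),
    fun B hB hB2 hBF => by_contra fun hB0 => hB0 ?_⟩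
  · rw [Finset.coe_union, Finset.coe_image]
    exact Set.union_subset (Set.image_subset_iff.2 fun g _ => hG.smul_mem_boundedGroup g) hF₁
  have hBinv : IsAlmostInvariant μ F₀ δ B := by
    refine ⟨hB, fun g hg => ?_⟩
    exact (hBF (.smul g) (Finset.mem_union_left _ (Finset.mem_image_of_mem _ hg))).trans
      (by gcongr; exact min_le_left _ _)
  have hBindep := hindep B hB hB0 fun θ hθ => by
    have hle : μ (moved θ B) ≤ e * μ B := (hBF θ (Finset.mem_union_right _ hθ)).trans
      (by gcongr; exact min_le_right _ _)
    simpa [measureReal_def] using ENNReal.toReal_mono (by finiteness) hle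
  exact hA.measure_eq_zero_of_maximal hgap hA8 hmax hBinv hB2 (min_le_left _ _) (min_le_right _ _)
    (hBindep A (Finset.mem_insert_self _ _)) fun g hg =>
      hBindep _ (Finset.mem_insert_of_mem (Finset.mem_image_of_mem _ hg))

theorem exists_hasExpansion (hG : IsGeneratingAction R μ G) (hR : IsCountableNonsingular R μ)
    (hSE : IsStronglyErgodic R μ) (hc : IsLogDeriv μ c) (hnb : HasUniformNb μ c) :
    ∃ F : Finset (X ≃ᵐ X), ↑F ⊆ boundedGroup R μ ∧ ∃ ε : ℝ≥0, 0 < ε ∧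
      HasExpansion μ ε fun θ : F => (θ : X → X) := by
  obtain ⟨F, hF, ε, hε, h⟩ := hG.exists_forall_moved_le_imp_measure_eq_zero hR hSE hc hnb
  refine ⟨F, hF, ε, hε, fun B hB hB2 => ?_⟩
  by_contra! hlt
  have hB0 : μ B = 0 := h B hB hB2 fun θ hθ => le_trans
    (Finset.single_le_sum (f := fun θ : F => μ (moved θ B)) (fun _ _ => zero_le)
      (Finset.mem_univ ⟨θ, hθ⟩)) hlt.le
  simp [hB0] at hlt

theorem exists_hasSpectralGap (hG : IsGeneratingAction R μ G) (hR : IsCountableNonsingular R μ)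
    (hSE : IsStronglyErgodic R μ) (hc : IsLogDeriv μ c) (hnb : HasUniformNb μ c) :
    ∃ κ : ℝ≥0, 0 < κ ∧ ∃ (n : ℕ) (θ : Fin n → X ≃ᵐ X),
      (∀ k, θ k ∈ fullGroup R μ ∧ IsBoundedAut μ (θ k)) ∧ HasSpectralGap μ κ θ := by
  obtain ⟨F, hF, ε, hε, hexp⟩ := hG.exists_hasExpansion hR hSE hc hnb
  have hθ (θ : F) : θ.1.symm ∈ boundedGroup R μ := symm_mem_boundedGroup (hF θ.2)
  refine ⟨4 * gapConst (Fintype.card F) ε, mul_pos four_pos (gapConst_pos _ hε), F.card,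
    fun k => (F.equivFin.symm k).1.symm, fun k => ⟨mem_fullGroup_of_mem_boundedGroup (hθ _),
      isBoundedAut_of_mem_boundedGroup (hθ _)⟩, fun f hf => ?_⟩
  refine (hexp.eLpNorm_sub_integral_sq_le hε
    (fun θ => (isBoundedAut_of_mem_boundedGroup (hθ θ)).1.2) hf).trans_eq ?_
  congr 1
  exact (F.equivFin.symm.sum_comp fun θ : F =>
    eLpNorm (fun x => f (θ.1 x) - f x) 2 μ ^ 2).symm

end IsGeneratingAction

theorem IsStronglyErgodic.exists_hasSpectralGap (hSE : IsStronglyErgodic R μ)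
    (hR : IsCountableNonsingular R μ) (htype : IsInvariant R μ ∨ IsTypeIII R μ) :
    ∃ κ : ℝ≥0, 0 < κ ∧ ∃ (n : ℕ) (θ : Fin n → X ≃ᵐ X),
      (∀ k, θ k ∈ fullGroup R μ ∧ IsBoundedAut μ (θ k)) ∧ HasSpectralGap μ κ θ := by
  obtain ⟨G, _, _, _, _, hG⟩ := exists_generating_action hR
  rcases htype with hinv | hIII
  · exact hG.exists_hasSpectralGap hR hSE (hG.isLogDeriv_zero hinv)
      (hG.hasUniformNb_zero hSE.isErgodic)
  · obtain ⟨c, hc⟩ := exists_isLogDeriv (G := G) μ hG.quasiMeasurePreserving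
    exact hG.exists_hasSpectralGap hR hSE hc (hIII.hasUniformNb hG hSE hc)

end SpectralGap

section Converse

variable {X : Type*} [MeasurableSpace X] {R : Setoid X} {μ : Measure X} {A : Set X}

theorem eLpNorm_indicator_comp_sub {T : X → X} (hT : Measurable T) (hA : MeasurableSet A) :
    eLpNorm (fun x => A.indicator (fun _ => (1 : ℂ)) (T x) - A.indicator (fun _ => 1) x) 2 μ ^ 2 =
      μ (moved T A) := by
  rw [eLpNorm_two_sq, ← lintegral_indicator_one (measurableSet_moved hT hA)]
  refine lintegral_congr fun x => ?_
  by_cases hTx : T x ∈ A <;> by_cases hx : x ∈ A <;> simp [moved, hTx, hx]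

variable [IsProbabilityMeasure μ]

theorem eLpNorm_indicator_sub_integral (hA : MeasurableSet A) :
    eLpNorm (fun x => A.indicator (fun _ => (1 : ℂ)) x -
      ∫ y, A.indicator (fun _ => (1 : ℂ)) y ∂μ) 2 μ ^ 2 = μ A * (1 - μ A) := by
  have hint : ∫ y, A.indicator (fun _ => (1 : ℂ)) y ∂μ = (μ.real A : ℂ) := by
    simp [integral_indicator_const _ hA]
  set p := μ.real A with hp
  have hp0 : 0 ≤ p := measureReal_nonneg
  have hp1 : 0 ≤ 1 - p := sub_nonneg.2 measureReal_le_one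
  have hsq (x : X) : ‖A.indicator (fun _ => (1 : ℂ)) x - p‖ₑ ^ 2 =
      A.indicator (fun _ => ENNReal.ofReal ((1 - p) ^ 2)) x +
        Aᶜ.indicator (fun _ => ENNReal.ofReal (p ^ 2)) x := by
    by_cases hx : x ∈ A
    · have hnorm : ‖(1 : ℂ) - p‖ = 1 - p := by
        rw [← Complex.ofReal_one, ← Complex.ofReal_sub, Complex.norm_real, Real.norm_of_nonneg hp1]
      simp [hx, ← ofReal_norm, hnorm, ENNReal.ofReal_pow hp1]
    · simp [hx, ← ofReal_norm, abs_of_nonneg hp0, ENNReal.ofReal_pow hp0]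
  have hμA : μ A = ENNReal.ofReal p := by rw [hp, ofReal_measureReal]
  have hμAc : 1 - μ A = ENNReal.ofReal (1 - p) := by
    rw [hμA, ENNReal.ofReal_sub _ hp0, ENNReal.ofReal_one]
  rw [eLpNorm_two_sq, hint, lintegral_congr hsq,
    lintegral_add_left (measurable_const.indicator hA), lintegral_indicator_const hA,
    lintegral_indicator_const hA.compl, prob_compl_eq_one_sub hA, hμAc, hμA,
    ← ENNReal.ofReal_mul (sq_nonneg _), ← ENNReal.ofReal_mul (sq_nonneg _),
    ← ENNReal.ofReal_mul hp0, ← ENNReal.ofReal_add (by positivity) (by positivity)]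
  ring_nf

namespace HasSpectralGap

variable {ι : Type*} [Fintype ι] {θ : ι → X ≃ᵐ X} {κ : ℝ≥0}

theorem measure_mul_one_sub_le (h : HasSpectralGap μ κ θ) (hA : MeasurableSet A) :
    μ A * (1 - μ A) ≤ κ * ∑ k, μ (A ∆ (θ k '' A)) := by
  have hgap := h (A.indicator fun _ => 1)
    (memLp_indicator_const 2 hA 1 (Or.inr (measure_ne_top _ _)))
  simpa only [eLpNorm_indicator_sub_integral hA,
    eLpNorm_indicator_comp_sub (θ _).symm.measurable hA, moved_eq_symmDiff,
    ← (θ _).image_eq_preimage_symm, symmDiff_comm _ A] using hgap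

theorem isStronglyErgodic (h : HasSpectralGap μ κ θ) (hθ : ∀ k, θ k ∈ fullGroup R μ) :
    IsStronglyErgodic R μ := by
  intro A hA hinv
  have hsum : Tendsto (fun n => ∑ k, μ (A n ∆ (θ k '' A n))) atTop (𝓝 0) := by
    simpa using tendsto_finsetSum _ fun k (_ : k ∈ Finset.univ) => hinv _ (hθ k)
  have hbound := ENNReal.Tendsto.const_mul hsum (Or.inr (ENNReal.coe_ne_top (r := κ)))
  rw [mul_zero] at hbound
  exact tendsto_of_tendsto_of_tendsto_of_le_of_le tendsto_const_nhds hbound (fun _ => zero_le)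
    fun n => h.measure_mul_one_sub_le (hA n)

end HasSpectralGap

end Converse

end EqRel

theorem theoremA_general {X : Type*} [MeasurableSpace X] [StandardBorelSpace X]
    (μ : Measure X) [IsProbabilityMeasure μ] (R : Setoid X)
    (hR : EqRel.IsCountableNonsingular R μ)
    (htype : EqRel.IsInvariant R μ ∨ EqRel.IsTypeIII R μ) :
    EqRel.IsStronglyErgodic R μ ↔
      ∃ κ : ℝ≥0, 0 < κ ∧ ∃ (n : ℕ) (θ : Fin n → X ≃ᵐ X),
        (∀ k, θ k ∈ EqRel.fullGroup R μ ∧ EqRel.IsBoundedAut μ (θ k)) ∧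
        EqRel.HasSpectralGap μ κ θ := by
  refine ⟨fun hSE => hSE.exists_hasSpectralGap hR htype, ?_⟩
  rintro ⟨κ, -, n, θ, hθ, hgap⟩
  exact hgap.isStronglyErgodic fun k => (hθ k).1

theorem theoremA {X : Type*} [MeasurableSpace X] [StandardBorelSpace X]
    (μ : Measure X) [IsProbabilityMeasure μ] (R : Setoid X)
    (hR : EqRel.IsCountableNonsingular R μ) (herg : EqRel.IsErgodic R μ)
    (htype : EqRel.IsInvariant R μ ∨ EqRel.IsTypeIII R μ) :
    EqRel.IsStronglyErgodic R μ ↔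
      ∃ κ : ℝ≥0, 0 < κ ∧ ∃ (n : ℕ) (θ : Fin n → X ≃ᵐ X),
        (∀ k, θ k ∈ EqRel.fullGroup R μ ∧ EqRel.IsBoundedAut μ (θ k)) ∧
        ∀ f : X → ℂ, MemLp f 2 μ →
          eLpNorm (fun x => f x - ∫ y, f y ∂μ) 2 μ ^ 2 ≤
            (κ : ℝ≥0∞) * ∑ k, eLpNorm (fun x => f ((θ k).symm x) - f x) 2 μ ^ 2 :=
  theoremA_general μ R hR htype
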